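/- Let $D=(V,A)$ be a finite acyclic directed graph (parallel arcs allowed) and let $b\colon V\to\mathbb{R}$. Vertices $v$ with $b(v)>0$ are called sources and vertices $v$ with $b(v)<0$ are called sinks; a sink $t$ has demand $|b(t)|$. A $b$-transshipment is a flow $x\in\mathbb{R}^A_{\ge 0}$ with $\sum_{a\in\delta^{\mathrm{out}}(v)}x_a-\sum_{a\in\delta^{\mathrm{in}}(v)}x_a=b(v)$ for all $v\in V$. An unsplittable $b$-transshipment is a $b$-transshipment $y$ together with a decomposition of $y$ into flows of positive value along directed paths, each leading from a source to a sink, with at most one path for each source--sink pair. There is a polynomial-time algorithm with the following property. Given a finite acyclic digraph $D=(V,A)$, a function $b\colon V\to\mathbb{R}$ and a $b$-transshipment $x$, it computes an unsplittable $b$-transshipment $y$ (including its path decomposition) such that, if there is at least one sink, $$y_a < x_a + d_{\max}\qquad\text{for all } a\in A,$$ where $d_{\max}=\max\{|b(t)| : t\in V,\ b(t)<0\}$ is the maximum demand. Here polynomial time means that the number of elementary steps is bounded by a polynomial in $|V|+|A|$, on a random access machine with memory for natural and for real numbers, whose unit-cost operations are memory access (with indirect addressing), addition, subtraction and comparison.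 In particular, multiplication is not available, so that for rational inputs the running time is polynomial in the Turing machine model as well. -/

import Mathlib

/-! ## Digraphs, transshipments, unsplittable transshipments -/

namespace UT

/-- A directed graph with vertex set `V` and arc set `A`; parallel arcs are allowed. -/
structure MultiDigraph (V A : Type) where
  tail : A → V
  head : A → V

namespace MultiDigraph

variable {V A : Type}

/-- `D.IsWalk u l v`: the arcs in `l`, in this order, form a directed walk from `u` to `v`. -/
def IsWalk (D : MultiDigraph V A) : V → List A → V → Prop
  | u, [], v => u = v
  | u, a :: l, v => D.tail a = u ∧ D.IsWalk (D.head a) l v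

/-- A directed path: a directed walk that visits no vertex twice. -/
def IsPath (D : MultiDigraph V A) (u : V) (l : List A) (v : V) : Prop :=
  D.IsWalk u l v ∧ (u :: l.map D.head).Nodup

/-- No directed cycles: every closed directed walk is trivial. -/
def Acyclic (D : MultiDigraph V A) : Prop :=
  ∀ (v : V) (l : List A), D.IsWalk v l v → l = []

/-- `x` is a (fractional) `b`-transshipment: a nonnegative flow whose outflow minus inflow
at every vertex `v` is `b v`. -/
def IsTransshipment [Fintype A] [DecidableEq V] (D : MultiDigraph V A)
    (b : V → ℝ) (x : A → ℝ) : Prop :=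
  (∀ a, 0 ≤ x a) ∧
  ∀ v, (∑ a ∈ Finset.univ.filter (fun a => D.tail a = v), x a)
      - (∑ a ∈ Finset.univ.filter (fun a => D.head a = v), x a) = b v

end MultiDigraph

/-- A path carrying flow, as it occurs in a path decomposition. -/
structure FlowPath (V A : Type) where
  source : V
  sink : V
  arcs : List A
  value : ℝ

/-- `y` together with the path decomposition `ps` is an unsplittable `b`-transshipment:
`y` is a `b`-transshipment, every path in `ps` is a directed path with positive flow value from a
source (`b > 0`) to a sink (`b < 0`), no source-sink pair is served by two paths, and
the flow values of the paths through an arc add up to the flow on this arc. -/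
structure MultiDigraph.IsUnsplittable {V A : Type} [Fintype A] [DecidableEq V] [DecidableEq A]
    (D : MultiDigraph V A) (b : V → ℝ) (y : A → ℝ) (ps : List (FlowPath V A)) : Prop where
  isTransshipment : D.IsTransshipment b y
  source_pos : ∀ p ∈ ps, 0 < b p.source
  sink_neg : ∀ p ∈ ps, b p.sink < 0
  isPath : ∀ p ∈ ps, D.IsPath p.source p.arcs p.sink
  value_pos : ∀ p ∈ ps, 0 < p.value
  one_path_per_pair : (ps.map (fun p => (p.source, p.sink))).Nodup
  decomposition : ∀ a, y a = (ps.map (fun p => if a ∈ p.arcs then p.value else 0)).sum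

/-- The set of sinks. -/
noncomputable def sinks {V : Type} [Fintype V] (b : V → ℝ) : Finset V :=
  Finset.univ.filter (fun v => b v < 0)

/-- The maximum demand, where a sink `t` has demand `|b t|`. -/
noncomputable def dmax {V : Type} [Fintype V] (b : V → ℝ) (h : (sinks b).Nonempty) : ℝ :=
  (sinks b).sup' h (fun t => |b t|)

/-! ## Machine model

A random access machine with arrays of natural numbers and arrays of real numbers, programmed in
a structured language. In addition to control flow, indirect addressing and comparisons, the only
operations are addition and subtraction, and there are no real constants except `0`. Each
occurrence of an operation, constant, memory access, comparison or assignment that is executed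
costs at least one step. As there is no multiplication, `T` steps starting from rational
data enlarge the numbers, written over the common denominator of the data, by at most a factor
`2 ^ O(T)`; so a polynomial number of steps is also a polynomial number of bit operations. -/

/-- The memory: `s.nat i j` is entry `j` of the `i`-th array of natural numbers, `s.real i j` is
entry `j` of the `i`-th array of real numbers. -/
structure State where
  nat : ℕ → ℕ → ℕ
  real : ℕ → ℕ → ℝ

/-- Expressions for natural numbers; `get i e` reads entry `e` of the `i`-th array. -/
inductive NExp : Type
  | const : ℕ → NExp
  | get : ℕ → NExp → NExp
  | add : NExp → NExp → NExp
  | sub : NExp → NExp → NExp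

/-- Value of an expression (subtraction is truncated at `0`). -/
def NExp.eval (s : State) : NExp → ℕ
  | .const k => k
  | .get i e => s.nat i (e.eval s)
  | .add e f => e.eval s + f.eval s
  | .sub e f => e.eval s - f.eval s

/-- Number of steps for the evaluation of an expression. -/
def NExp.cost : NExp → ℕ
  | .const _ => 1
  | .get _ e => e.cost + 1
  | .add e f => e.cost + f.cost + 1
  | .sub e f => e.cost + f.cost + 1

/-- Expressions for real numbers. -/
inductive RExp : Type
  | zero : RExp
  | get : ℕ → NExp → RExp
  | add : RExp → RExp → RExp
  | sub : RExp → RExp → RExp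

/-- Value of an expression. -/
noncomputable def RExp.eval (s : State) : RExp → ℝ
  | .zero => 0
  | .get i e => s.real i (e.eval s)
  | .add e f => e.eval s + f.eval s
  | .sub e f => e.eval s - f.eval s

/-- Number of steps for the evaluation of an expression. -/
def RExp.cost : RExp → ℕ
  | .zero => 1
  | .get _ e => e.cost + 1
  | .add e f => e.cost + f.cost + 1
  | .sub e f => e.cost + f.cost + 1

/-- Tests. -/
inductive Test : Type
  | natLt : NExp → NExp → Test
  | natEq : NExp → NExp → Test
  | realLt : RExp → RExp → Test
  | realEq : RExp → RExp → Test
  | not : Test → Test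
  | and : Test → Test → Test

/-- Truth of a test. -/
def Test.holds (s : State) : Test → Prop
  | .natLt e f => e.eval s < f.eval s
  | .natEq e f => e.eval s = f.eval s
  | .realLt e f => e.eval s < f.eval s
  | .realEq e f => e.eval s = f.eval s
  | .not c => ¬ c.holds s
  | .and c d => c.holds s ∧ d.holds s

/-- Number of steps for the evaluation of a test. -/
def Test.cost : Test → ℕ
  | .natLt e f => e.cost + f.cost + 1
  | .natEq e f => e.cost + f.cost + 1
  | .realLt e f => e.cost + f.cost + 1
  | .realEq e f => e.cost + f.cost + 1
  | .not c => c.cost + 1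
  | .and c d => c.cost + d.cost + 1

/-- Programs. -/
inductive Prog : Type
  | skip : Prog
  | setNat : ℕ → NExp → NExp → Prog
  | setReal : ℕ → NExp → RExp → Prog
  | seq : Prog → Prog → Prog
  | ite : Test → Prog → Prog → Prog
  | loop : Test → Prog → Prog

/-- Store `v` in entry `j` of the `i`-th array of natural numbers. -/
def State.putNat (s : State) (i j v : ℕ) : State :=
  { s with nat := Function.update s.nat i (Function.update (s.nat i) j v) }

/-- Store `v` in entry `j` of the `i`-th array of real numbers. -/
noncomputable def State.putReal (s : State) (i j : ℕ) (v : ℝ) : State :=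
  { s with real := Function.update s.real i (Function.update (s.real i) j v) }

/-- `Exec P s T s'`: program `P`, started in memory `s`, halts after exactly `T` steps
in memory `s'`. -/
inductive Exec : Prog → State → ℕ → State → Prop
  | skip (s : State) : Exec .skip s 1 s
  | setNat (i : ℕ) (e f : NExp) (s : State) :
      Exec (.setNat i e f) s (e.cost + f.cost + 1) (s.putNat i (e.eval s) (f.eval s))
  | setReal (i : ℕ) (e : NExp) (f : RExp) (s : State) :
      Exec (.setReal i e f) s (e.cost + f.cost + 1) (s.putReal i (e.eval s) (f.eval s))
  | seq {P Q : Prog} {s s' s'' : State} {T U : ℕ} :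
      Exec P s T s' → Exec Q s' U s'' → Exec (.seq P Q) s (T + U) s''
  | iteTrue {c : Test} {P Q : Prog} {s s' : State} {T : ℕ} :
      c.holds s → Exec P s T s' → Exec (.ite c P Q) s (c.cost + T) s'
  | iteFalse {c : Test} {P Q : Prog} {s s' : State} {T : ℕ} :
      ¬ c.holds s → Exec Q s T s' → Exec (.ite c P Q) s (c.cost + T) s'
  | loopTrue {c : Test} {P : Prog} {s s' s'' : State} {T U : ℕ} :
      c.holds s → Exec P s T s' → Exec (.loop c P) s' U s'' →
      Exec (.loop c P) s (c.cost + T + U) s''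
  | loopFalse {c : Test} {P : Prog} {s : State} :
      ¬ c.holds s → Exec (.loop c P) s c.cost s

/-! ## Input and output format -/

/-- The initial memory on an instance with vertices `0, …, n - 1` and arcs `0, …, m - 1`:
the first array of naturals holds `n` and `m`, the next two hold the tails and the heads of the
arcs; the first array of reals holds the balances, the next one the given flow.
All other entries are `0`. -/
noncomputable def inputState {n m : ℕ} (D : MultiDigraph (Fin n) (Fin m))
    (b : Fin n → ℝ) (x : Fin m → ℝ) : State where
  nat i j :=
    if i = 0 then (if j = 0 then n else if j = 1 then m else 0)
    else if i = 1 then (if h : j < m then (D.tail ⟨j, h⟩ : ℕ) else 0)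
    else if i = 2 then (if h : j < m then (D.head ⟨j, h⟩ : ℕ) else 0)
    else 0
  real i j :=
    if i = 0 then (if h : j < n then b ⟨j, h⟩ else 0)
    else if i = 1 then (if h : j < m then x ⟨j, h⟩ else 0)
    else 0

/-- The memory `s` contains the flow `y` and the list of paths `ps`: `y` is in real array `2`;
the number of paths is entry `0` of natural array `3`; source, sink, number of arcs and
starting position of the `k`-th path are entry `k` of the natural arrays `4`, `5`, `6`, `7`, and
its value is entry `k` of real array `3`; its arcs are listed in natural array `8` from its
starting position on. -/
structure IsOutput {n m : ℕ} (s : State) (y : Fin m → ℝ)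
    (ps : List (FlowPath (Fin n) (Fin m))) : Prop where
  flow : ∀ a : Fin m, s.real 2 a = y a
  length : s.nat 3 0 = ps.length
  source : ∀ (k : ℕ) (h : k < ps.length), s.nat 4 k = (ps[k].source : ℕ)
  sink : ∀ (k : ℕ) (h : k < ps.length), s.nat 5 k = (ps[k].sink : ℕ)
  arcs_length : ∀ (k : ℕ) (h : k < ps.length), s.nat 6 k = ps[k].arcs.length
  arcs : ∀ (k : ℕ) (h : k < ps.length) (j : ℕ) (hj : j < ps[k].arcs.length),
    s.nat 8 (s.nat 7 k + j) = (ps[k].arcs[j] : ℕ)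
  value : ∀ (k : ℕ) (h : k < ps.length), s.real 3 k = ps[k].value

end UT

/-! The proof analyses an algorithm that splits the given flow into a part `x` that is not yet
routed and a part `y` that is already committed to paths. Sinks travel backward and sources travel
forward over arcs carrying `x`; a move transfers the whole residual balance of the terminal from `x`
to `y`. At a vertex with at most one remaining arc (a leaf), a source serves a sink with the smaller
of their two balances. This exhausts one of them, so no pair is served twice. If no such step
applies, `x` is shifted around a cycle found by walking forward where possible and backward
otherwise: forward arcs lose flow, backward arcs gain.

Only marked arcs gain flow, and an arc is marked when it is first traversed backward. Until then `y
+ x ≤ x₀`, so at that moment `y < x₀`. A sink crosses a marked arc only if this uses up its flow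
exactly; then `y` grows by at most the maximum demand `Δ` and the arc is gone. A source crosses only
from a leaf. By `Cfg.marked_le` a marked arc carries at most `Δ`, so `y + x < x₀ + Δ` at the first
crossing. Moves preserve this sum, and the leaf tail keeps the arc off all later cycles. The bound
`Cfg.marked_le` holds because the flow on a marked arc can only continue along a single path of
marked arcs until a sink absorbs it; `Cfg.MarkInv` records what this needs.

Progress rests on `Cfg.Inv.not_leaf_head` and `Cfg.Inv.not_leaf_tail`: if no terminal can be moved
or served, both ends of every arc with flow have a second such arc, so the walk continues until it
closes. As the digraph is acyclic, the cycle has a forward arc (`Cfg.Trail.exists_forward`), so the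
shift is finite; it ends when an arc is emptied or a sink's demand equals the flow on an arc
entering its position. `Cfg.measure` turns this into a polynomial bound on the iterations.

On the machine side, `Rep` ties the memory to a configuration, and `Does` is a total-correctness
judgment with a step bound in which every loop is allotted the same polynomial number of rounds. -/

namespace UT

open Function

/-! ## Walks in acyclic digraphs -/

namespace MultiDigraph

theorem isWalk_append {V A : Type} (D : MultiDigraph V A) {u w : V} {l l' : List A} :
    D.IsWalk u (l ++ l') w ↔ ∃ v, D.IsWalk u l v ∧ D.IsWalk v l' w := by
  induction l generalizing u with
  | nil => simp [IsWalk]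
  | cons a l ih => simp [IsWalk, ih, and_assoc]

/-- `ρ` increases strictly along every arc. -/
def IsRank {V A : Type} (D : MultiDigraph V A) (ρ : V → ℕ) : Prop :=
  ∀ a, ρ (D.tail a) < ρ (D.head a)

/-- The rank of a vertex counts its proper predecessors. Acyclicity says that no vertex precedes
itself, which gives both the strict increase along arcs and the strict bound. -/
theorem Acyclic.exists_rank {V A : Type} [Fintype V] {D : MultiDigraph V A} (h : D.Acyclic) :
    ∃ ρ : V → ℕ, D.IsRank ρ ∧ ∀ v, ρ v < Fintype.card V := by
  classical
  refine ⟨fun v => (Finset.univ.filter (fun u => ∃ l, l ≠ [] ∧ D.IsWalk u l v)).card, ?_, ?_⟩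
  · intro a
    apply Finset.card_lt_card
    rw [Finset.ssubset_iff_of_subset]
    · refine ⟨D.tail a, ?_, ?_⟩
      · simp only [Finset.mem_filter, Finset.mem_univ, true_and]
        exact ⟨[a], by simp, by simp [IsWalk]⟩
      · simp only [Finset.mem_filter, Finset.mem_univ, true_and]
        rintro ⟨l, hl, hw⟩
        exact hl (h _ _ hw)
    · intro u
      simp only [Finset.mem_filter, Finset.mem_univ, true_and]
      rintro ⟨l, hl, hw⟩
      refine ⟨l ++ [a], by simp, ?_⟩
      rw [isWalk_append]
      exact ⟨_, hw, by simp [IsWalk]⟩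
  · intro v
    apply Finset.card_lt_univ_of_notMem (x := v)
    simp only [Finset.mem_filter, Finset.mem_univ, true_and]
    rintro ⟨l, hl, hw⟩
    exact hl (h _ _ hw)

/-! ### Rank estimates along walks -/

section Rank

variable {V A : Type} {D : MultiDigraph V A} {ρ : V → ℕ}

theorem IsWalk.rank_add_length_le (hρ : D.IsRank ρ) {u v : V} {l : List A}
    (h : D.IsWalk u l v) : ρ u + l.length ≤ ρ v := by
  induction l generalizing u with
  | nil => simp only [IsWalk] at h; simp [h]
  | cons a l ih =>
    obtain ⟨rfl, h⟩ := h
    have := ih h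
    have := hρ a
    simp only [List.length_cons]
    omega

theorem IsWalk.rank_head_le (hρ : D.IsRank ρ) {u v : V} {l : List A}
    (h : D.IsWalk u l v) {a : A} (ha : a ∈ l) : ρ (D.head a) ≤ ρ v := by
  obtain ⟨l₁, l₂, rfl⟩ := List.append_of_mem ha
  obtain ⟨w, -, h2⟩ := (isWalk_append D).1 h
  have := h2.2.rank_add_length_le hρ
  omega

theorem IsWalk.le_rank_tail (hρ : D.IsRank ρ) {u v : V} {l : List A}
    (h : D.IsWalk u l v) {a : A} (ha : a ∈ l) : ρ u ≤ ρ (D.tail a) := by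
  obtain ⟨l₁, l₂, rfl⟩ := List.append_of_mem ha
  obtain ⟨w, h1, h2⟩ := (isWalk_append D).1 h
  have := h1.rank_add_length_le hρ
  rw [h2.1]
  omega

/-- Ranks increase strictly along a walk, so no vertex recurs. Hence the algorithm only has to
maintain walks. -/
theorem IsWalk.isPath (hρ : D.IsRank ρ) {u v : V} {l : List A}
    (h : D.IsWalk u l v) : D.IsPath u l v := by
  refine ⟨h, ?_⟩
  induction l generalizing u with
  | nil => simp
  | cons a l ih =>
    obtain ⟨rfl, h⟩ := h
    rw [List.map_cons, List.nodup_cons]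
    refine ⟨fun hmem => ?_, ih h⟩
    have h1 := hρ a
    rcases List.mem_cons.1 hmem with h2 | h2
    · rw [← h2] at h1; exact lt_irrefl _ h1
    · obtain ⟨a', ha', h3⟩ := List.mem_map.1 h2
      have h4 := h.le_rank_tail hρ ha'
      have h5 := hρ a'
      rw [h3] at h5
      omega

end Rank

/-- Outflow minus inflow at a vertex. -/
def excess {V A : Type} [Fintype A] [DecidableEq V] (D : MultiDigraph V A)
    (x : A → ℝ) (v : V) : ℝ :=
  ∑ a, ((if D.tail a = v then x a else 0) - (if D.head a = v then x a else 0))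

theorem isTransshipment_iff_excess {V A : Type} [Fintype A] [DecidableEq V]
    (D : MultiDigraph V A) (b : V → ℝ) (x : A → ℝ) :
    D.IsTransshipment b x ↔ (∀ a, 0 ≤ x a) ∧ ∀ v, D.excess x v = b v := by
  simp only [IsTransshipment, excess, Finset.sum_sub_distrib, Finset.sum_filter]

end MultiDigraph

theorem sum_eq_add_of_eq_off {ι : Type} [Fintype ι] {f g : ι → ℝ} (t : ι)
    (h : ∀ u, u ≠ t → f u = g u) : ∑ u, f u = ∑ u, g u + (f t - g t) := by
  classical
  rw [← Finset.add_sum_erase _ f (Finset.mem_univ t), ← Finset.add_sum_erase _ g (Finset.mem_univ t),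
    Finset.sum_congr rfl (fun u hu => h u (Finset.ne_of_mem_erase hu))]
  ring

theorem MultiDigraph.excess_update {V A : Type} [Fintype A] [DecidableEq V] [DecidableEq A]
    (D : MultiDigraph V A) (x : A → ℝ) (e : A) (c : ℝ) (v : V) :
    D.excess (update x e c) v = D.excess x v
      + ((if D.tail e = v then c - x e else 0) - (if D.head e = v then c - x e else 0)) := by
  unfold MultiDigraph.excess
  rw [sum_eq_add_of_eq_off e (fun u hu => by rw [update_of_ne hu])]
  simp only [update_self]
  split_ifs <;> ring

/-! ## Configurations -/

/-- A configuration of the algorithm: the flow `x` that is not yet routed, the balance `r u` of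
the terminal `u` that is not yet served, its current position `pos u`, the arcs `trav u` over
which it has been moved, the arcs whose flow may have been increased, the routed flow `y`,
and the completed paths. -/
structure Cfg (n m : ℕ) where
  x : Fin m → ℝ
  r : Fin n → ℝ
  pos : Fin n → Fin n
  trav : Fin n → List (Fin m)
  mark : Fin m → Prop
  y : Fin m → ℝ
  ps : List (FlowPath (Fin n) (Fin m))

variable {n m : ℕ}

/-- Arcs that carry flow. -/
def Cfg.Present (σ : Cfg n m) (a : Fin m) : Prop := 0 < σ.x a

/-- Incidence of arcs and vertices. -/
def MultiDigraph.Inc {V A : Type} (D : MultiDigraph V A) (a : A) (v : V) : Prop :=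
  D.tail a = v ∨ D.head a = v

/-- At most one arc at `v` carries flow. -/
def Cfg.Leaf (σ : Cfg n m) (D : MultiDigraph (Fin n) (Fin m)) (v : Fin n) : Prop :=
  ∀ a a', σ.Present a → σ.Present a' → D.Inc a v → D.Inc a' v → a = a'

/-- Total balance of the terminals at `v`. -/
def Cfg.bal (σ : Cfg n m) (v : Fin n) : ℝ := ∑ u, if σ.pos u = v then σ.r u else 0

/-- `conserve` makes `x` a transshipment for the residual balances at the current positions. `total`
ensures that `y` alone is a `b`-transshipment once `x` has vanished. -/
structure Cfg.FlowInv (σ : Cfg n m) (D : MultiDigraph (Fin n) (Fin m)) (b : Fin n → ℝ) :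
    Prop where
  nonneg : ∀ a, 0 ≤ σ.x a
  conserve : ∀ v, D.excess σ.x v = σ.bal v
  total : ∀ v, D.excess (fun a => σ.x a + σ.y a) v = b v
  source_sign : ∀ u, 0 < σ.r u → 0 < b u
  sink_sign : ∀ u, σ.r u < 0 → b u < 0

/-- A sink records its arcs while moving backward, hence the reversal. The second sum in
`decomposition` is flow of `y` committed to unfinished paths. `settled` yields one path per pair: a
pair that was served has an exhausted member and cannot meet again. -/
structure Cfg.PathInv (σ : Cfg n m) (D : MultiDigraph (Fin n) (Fin m)) (b : Fin n → ℝ) :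
    Prop where
  walk_source : ∀ u, 0 ≤ b u → D.IsWalk u (σ.trav u) (σ.pos u)
  walk_sink : ∀ u, b u < 0 → D.IsWalk (σ.pos u) (σ.trav u).reverse u
  source_pos : ∀ p ∈ σ.ps, 0 < b p.source
  sink_neg : ∀ p ∈ σ.ps, b p.sink < 0
  isWalk : ∀ p ∈ σ.ps, D.IsWalk p.source p.arcs p.sink
  value_pos : ∀ p ∈ σ.ps, 0 < p.value
  nodup : (σ.ps.map (fun p => (p.source, p.sink))).Nodup
  settled : ∀ p ∈ σ.ps, σ.r p.source = 0 ∨ σ.r p.sink = 0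
  decomposition : ∀ a, σ.y a = (σ.ps.map (fun p => if a ∈ p.arcs then p.value else 0)).sum
    + ∑ u, if a ∈ σ.trav u then |σ.r u| else 0

/-- Call a sink at the head of a marked arc small if its demand is below the flow on the arc. The
conditions on heads say that flow continues only along one path of marked arcs, and that a small
sink occurs only where this path ends, and there only once. `load_mark` has two phases: first `y <
x₀` and `x` may still grow; after a source has crossed, the sum is bounded and the leaf tail
prevents further growth. -/
structure Cfg.MarkInv (σ : Cfg n m) (D : MultiDigraph (Fin n) (Fin m)) (x₀ : Fin m → ℝ)
    (Δ : ℝ) : Prop where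
  demand_le : ∀ t, -σ.r t ≤ Δ
  out_unique : ∀ a, σ.mark a → σ.Present a → ∀ e e', σ.Present e → σ.Present e' →
    D.tail e = D.head a → D.tail e' = D.head a → e = e'
  out_mark : ∀ a, σ.mark a → σ.Present a → ∀ e, σ.Present e → D.tail e = D.head a → σ.mark e
  small_root : ∀ a, σ.mark a → σ.Present a → ∀ t, σ.r t < 0 → σ.pos t = D.head a →
    -σ.r t < σ.x a → ∀ e, σ.Present e → D.tail e ≠ D.head a
  small_unique : ∀ a, σ.mark a → σ.Present a → ∀ t t', σ.r t < 0 → σ.r t' < 0 →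
    σ.pos t = D.head a → σ.pos t' = D.head a → -σ.r t < σ.x a → -σ.r t' < σ.x a → t = t'
  load_mark : ∀ a, σ.mark a → σ.Present a →
    σ.y a < x₀ a ∨ (σ.y a + σ.x a < x₀ a + Δ ∧ σ.Leaf D (D.tail a))
  load_unmark : ∀ a, ¬ σ.mark a → σ.y a + σ.x a ≤ x₀ a
  load_absent : ∀ a, ¬ σ.Present a → σ.y a < x₀ a + Δ

structure Cfg.Inv (σ : Cfg n m) (D : MultiDigraph (Fin n) (Fin m)) (b : Fin n → ℝ)
    (x₀ : Fin m → ℝ) (Δ : ℝ) : Prop where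
  flow : σ.FlowInv D b
  path : σ.PathInv D b
  marks : σ.MarkInv D x₀ Δ

/-! ## The steps -/

/-- Move the sink `t` backward over the arc `e`. -/
noncomputable def Cfg.moveSink (σ : Cfg n m) (D : MultiDigraph (Fin n) (Fin m))
    (e : Fin m) (t : Fin n) : Cfg n m :=
  { σ with
    x := update σ.x e (σ.x e + σ.r t)
    y := update σ.y e (σ.y e - σ.r t)
    pos := update σ.pos t (D.tail e)
    trav := update σ.trav t (σ.trav t ++ [e]) }

/-- Move the source `s` forward over the arc `e`. -/
noncomputable def Cfg.moveSource (σ : Cfg n m) (D : MultiDigraph (Fin n) (Fin m))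
    (e : Fin m) (s : Fin n) : Cfg n m :=
  { σ with
    x := update σ.x e (σ.x e - σ.r s)
    y := update σ.y e (σ.y e + σ.r s)
    pos := update σ.pos s (D.head e)
    trav := update σ.trav s (σ.trav s ++ [e]) }

/-- Let the source `s` serve the sink `t` with the value `c`. -/
noncomputable def Cfg.serve (σ : Cfg n m) (s t : Fin n) (c : ℝ) : Cfg n m :=
  { σ with
    r := update (update σ.r s (σ.r s - c)) t (σ.r t + c)
    ps := σ.ps ++ [⟨s, t, σ.trav s ++ (σ.trav t).reverse, c⟩] }

/-- The sink `t` may be moved over the arc `e`. -/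
def Cfg.SinkMovable (σ : Cfg n m) (D : MultiDigraph (Fin n) (Fin m))
    (e : Fin m) (t : Fin n) : Prop :=
  σ.Present e ∧ σ.r t < 0 ∧ σ.pos t = D.head e ∧
    (σ.x e + σ.r t = 0 ∨ (¬ σ.mark e ∧ 0 < σ.x e + σ.r t))

theorem Cfg.Leaf.mono {σ σ' : Cfg n m} {D : MultiDigraph (Fin n) (Fin m)} {v : Fin n}
    (h : σ.Leaf D v) (hp : ∀ a, σ'.Present a → σ.Present a) : σ'.Leaf D v :=
  fun a a' ha ha' => h a a' (hp a ha) (hp a' ha')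

theorem bal_update_pos (σ : Cfg n m) (t w v : Fin n) :
    (∑ u, if update σ.pos t w u = v then σ.r u else 0) = σ.bal v
      + ((if w = v then σ.r t else 0) - (if σ.pos t = v then σ.r t else 0)) := by
  unfold Cfg.bal
  rw [sum_eq_add_of_eq_off t (fun u hu => by rw [update_of_ne hu])]
  simp only [update_self]

/-! ### Invariants under moves of sinks, and the flow and path invariants under moves of sources -/

section Steps

variable {D : MultiDigraph (Fin n) (Fin m)} {b : Fin n → ℝ} {x₀ : Fin m → ℝ} {Δ : ℝ}
  {ρ : Fin n → ℕ} {σ : Cfg n m}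

theorem Cfg.FlowInv.moveSink (h : σ.FlowInv D b) {e : Fin m} {t : Fin n}
    (hpos : σ.pos t = D.head e) (hle : 0 ≤ σ.x e + σ.r t) : (σ.moveSink D e t).FlowInv D b where
  nonneg a := by
    by_cases ha : a = e
    · subst ha; simpa [Cfg.moveSink] using hle
    · simpa [Cfg.moveSink, update_of_ne ha] using h.nonneg a
  conserve v := by
    have h1 := D.excess_update σ.x e (σ.x e + σ.r t) v
    have h2 := bal_update_pos σ t (D.tail e) v
    have h3 := h.conserve v
    refine h1.trans (Eq.trans ?_ h2.symm)
    rw [h3, hpos]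
    split_ifs <;> ring
  total v := by
    have : (fun a => (σ.moveSink D e t).x a + (σ.moveSink D e t).y a)
        = fun a => σ.x a + σ.y a := by
      funext a
      by_cases ha : a = e
      · subst ha; simp [Cfg.moveSink]
      · simp [Cfg.moveSink, update_of_ne ha]
    rw [this]; exact h.total v
  source_sign := h.source_sign
  sink_sign := h.sink_sign

theorem Cfg.FlowInv.moveSource (h : σ.FlowInv D b) {e : Fin m} {s : Fin n}
    (hpos : σ.pos s = D.tail e) (hle : σ.r s ≤ σ.x e) : (σ.moveSource D e s).FlowInv D b where
  nonneg a := by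
    by_cases ha : a = e
    · subst ha; simpa [Cfg.moveSource] using hle
    · simpa [Cfg.moveSource, update_of_ne ha] using h.nonneg a
  conserve v := by
    have h1 := D.excess_update σ.x e (σ.x e - σ.r s) v
    have h2 := bal_update_pos σ s (D.head e) v
    have h3 := h.conserve v
    refine h1.trans (Eq.trans ?_ h2.symm)
    rw [h3, hpos]
    split_ifs <;> ring
  total v := by
    have : (fun a => (σ.moveSource D e s).x a + (σ.moveSource D e s).y a)
        = fun a => σ.x a + σ.y a := by
      funext a
      by_cases ha : a = e
      · subst ha; simp [Cfg.moveSource]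
      · simp [Cfg.moveSource, update_of_ne ha]
    rw [this]; exact h.total v
  source_sign := h.source_sign
  sink_sign := h.sink_sign

theorem sum_trav_update (σ : Cfg n m) {u : Fin n} {e : Fin m} (hmem : e ∉ σ.trav u) (a : Fin m) :
    (∑ v, if a ∈ update σ.trav u (σ.trav u ++ [e]) v then |σ.r v| else 0)
      = (∑ v, if a ∈ σ.trav v then |σ.r v| else 0) + if a = e then |σ.r u| else 0 := by
  rw [sum_eq_add_of_eq_off u (fun v hv => by rw [update_of_ne hv])]
  congr 1
  by_cases ha : a = e
  · subst ha; simp [hmem]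
  · simp [ha]

theorem Cfg.PathInv.moveSink (hρ : D.IsRank ρ) (h : σ.PathInv D b) {e : Fin m} {t : Fin n}
    (hpos : σ.pos t = D.head e) (hr : σ.r t < 0) (hb : b t < 0) :
    (σ.moveSink D e t).PathInv D b where
  walk_source u hu := by
    have : u ≠ t := by rintro rfl; linarith
    simpa [Cfg.moveSink, update_of_ne this] using h.walk_source u hu
  walk_sink u hu := by
    by_cases hut : u = t
    · subst hut
      have := h.walk_sink u hu
      rw [hpos] at this
      simpa [Cfg.moveSink, MultiDigraph.IsWalk] using this
    · simpa [Cfg.moveSink, update_of_ne hut] using h.walk_sink u hu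
  source_pos := h.source_pos
  sink_neg := h.sink_neg
  isWalk := h.isWalk
  value_pos := h.value_pos
  nodup := h.nodup
  settled := h.settled
  decomposition a := by
    -- Every arc traversed so far has its tail at rank at least that of the current position, which
    -- is the head of `e`. So `e` is new and its indicator changes exactly once.
    have hmem : e ∉ σ.trav t := by
      intro hmem
      have h1 := (h.walk_sink t hb).le_rank_tail hρ (List.mem_reverse.2 hmem)
      have h2 := hρ e
      rw [hpos] at h1
      omega
    have h1 := sum_trav_update σ hmem a
    have h2 := h.decomposition a
    refine Eq.trans ?_ (congrArg (_ + ·) h1.symm)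
    simp only [Cfg.moveSink]
    rw [← add_assoc, ← h2]
    by_cases ha : a = e
    · subst ha; simp [abs_of_neg hr, sub_eq_add_neg]
    · simp [ha]

theorem Cfg.PathInv.moveSource (hρ : D.IsRank ρ) (h : σ.PathInv D b) {e : Fin m} {s : Fin n}
    (hpos : σ.pos s = D.tail e) (hr : 0 < σ.r s) (hb : 0 < b s) :
    (σ.moveSource D e s).PathInv D b where
  walk_source u hu := by
    by_cases hus : u = s
    · subst hus
      have := h.walk_source u hu
      rw [hpos] at this
      simp only [Cfg.moveSource, update_self]
      exact (MultiDigraph.isWalk_append D).2 ⟨_, this, rfl, rfl⟩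
    · simpa [Cfg.moveSource, update_of_ne hus] using h.walk_source u hu
  walk_sink u hu := by
    have : u ≠ s := by rintro rfl; linarith
    simpa [Cfg.moveSource, update_of_ne this] using h.walk_sink u hu
  source_pos := h.source_pos
  sink_neg := h.sink_neg
  isWalk := h.isWalk
  value_pos := h.value_pos
  nodup := h.nodup
  settled := h.settled
  decomposition a := by
    have hmem : e ∉ σ.trav s := by
      intro hmem
      have h1 := (h.walk_source s hb.le).rank_head_le hρ hmem
      have h2 := hρ e
      rw [hpos] at h1
      omega
    have h1 := sum_trav_update σ hmem a
    have h2 := h.decomposition a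
    refine Eq.trans ?_ (congrArg (_ + ·) h1.symm)
    simp only [Cfg.moveSource]
    rw [← add_assoc, ← h2]
    by_cases ha : a = e
    · subst ha; simp [abs_of_pos hr]
    · simp [ha]

theorem Cfg.Present.of_moveSink {e : Fin m} {t : Fin n} (hr : σ.r t < 0) {a : Fin m}
    (h : (σ.moveSink D e t).Present a) : σ.Present a := by
  unfold Cfg.Present at *
  by_cases ha : a = e
  · subst ha; simp [Cfg.moveSink] at h; linarith
  · simpa [Cfg.moveSink, update_of_ne ha] using h

theorem Cfg.moveSink_x_le {e : Fin m} {t : Fin n} (hr : σ.r t < 0) (a : Fin m) :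
    (σ.moveSink D e t).x a ≤ σ.x a := by
  by_cases ha : a = e
  · subst ha; simp [Cfg.moveSink]; linarith
  · simp [Cfg.moveSink, update_of_ne ha]

/-- The delicate case is a sink arriving at the head of a marked arc `a`. Then `e` is the only arc
leaving that vertex and is itself marked, so the move deletes it and nothing leaves any more.
Another small sink there would have violated `small_root` before the move. -/
theorem Cfg.MarkInv.moveSink (h : σ.MarkInv D x₀ Δ) {e : Fin m} {t : Fin n}
    (hm : σ.SinkMovable D e t) :
    (σ.moveSink D e t).MarkInv D x₀ Δ := by
  obtain ⟨he, hr, hpos, hcase⟩ := hm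
  set σ' := σ.moveSink D e t with hσ'
  have hp : ∀ a, σ'.Present a → σ.Present a := fun a => Cfg.Present.of_moveSink hr
  have hx : ∀ a, σ'.x a ≤ σ.x a := Cfg.moveSink_x_le hr
  have hposne : ∀ u, u ≠ t → σ'.pos u = σ.pos u := fun u hu => by
    simp [hσ', Cfg.moveSink, update_of_ne hu]
  have hpost : σ'.pos t = D.tail e := by simp [hσ', Cfg.moveSink]
  have hne : ∀ a, a ≠ e → σ'.x a = σ.x a ∧ σ'.y a = σ.y a := fun a ha => by
    simp [hσ', Cfg.moveSink, update_of_ne ha]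
  have hex : σ'.x e = σ.x e + σ.r t := by simp [hσ', Cfg.moveSink]
  have hey : σ'.y e = σ.y e - σ.r t := by simp [hσ', Cfg.moveSink]
  have hdel : ∀ a, σ.mark a → σ.Present a → D.tail e = D.head a → ¬ σ'.Present e := by
    intro a ha hpa hta
    rcases hcase with h0 | ⟨h0, -⟩
    · unfold Cfg.Present; rw [hex, h0]; exact lt_irrefl _
    · exact absurd (h.out_mark a ha hpa e he hta) h0
  have hold : ∀ a, σ.mark a → σ.Present a → D.tail e = D.head a → ∀ u, σ.r u < 0 →
      σ.pos u = D.head a → ¬ (-σ.r u < σ'.x a) := by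
    intro a ha hpa hta u hu hpu hlt
    exact h.small_root a ha hpa u hu hpu (hlt.trans_le (hx a)) e he hta
  refine ⟨h.demand_le, ?_, ?_, ?_, ?_, ?_, ?_, ?_⟩
  · intro a ha hpa e1 e2 h1 h2
    exact h.out_unique a ha (hp a hpa) e1 e2 (hp _ h1) (hp _ h2)
  · intro a ha hpa e1 h1
    exact h.out_mark a ha (hp a hpa) e1 (hp _ h1)
  · intro a ha hpa u hu hpu hlt e1 h1 ht1
    by_cases hut : u = t
    · subst hut
      rw [hpost] at hpu
      have := h.out_unique a ha (hp a hpa) e1 e (hp _ h1) he ht1 hpu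
      subst this
      exact hdel a ha (hp a hpa) hpu h1
    · rw [hposne u hut] at hpu
      exact h.small_root a ha (hp a hpa) u hu hpu (hlt.trans_le (hx a)) e1 (hp _ h1) ht1
  · intro a ha hpa u u' hu hu' hpu hpu' hlt hlt'
    by_cases hut : u = t
    · by_cases hut' : u' = t
      · rw [hut, hut']
      · subst hut
        rw [hpost] at hpu
        rw [hposne u' hut'] at hpu'
        exact absurd hlt' (hold a ha (hp a hpa) hpu u' hu' hpu')
    · by_cases hut' : u' = t
      · subst hut'
        rw [hpost] at hpu'
        rw [hposne u hut] at hpu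
        exact absurd hlt (hold a ha (hp a hpa) hpu' u hu hpu)
      · rw [hposne u hut] at hpu
        rw [hposne u' hut'] at hpu'
        exact h.small_unique a ha (hp a hpa) u u' hu hu' hpu hpu' (hlt.trans_le (hx a))
          (hlt'.trans_le (hx a))
  · intro a ha hpa
    by_cases hae : a = e
    · subst hae
      rcases hcase with h0 | ⟨h0, -⟩
      · unfold Cfg.Present at hpa; rw [hex, h0] at hpa; exact absurd hpa (lt_irrefl _)
      · exact absurd ha h0
    · rw [(hne a hae).1, (hne a hae).2]
      exact (h.load_mark a ha (hp a hpa)).imp_right (fun hl => ⟨hl.1, hl.2.mono hp⟩)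
  · intro a ha
    by_cases hae : a = e
    · subst hae
      have := h.load_unmark a ha
      rw [hex, hey]; linarith
    · rw [(hne a hae).1, (hne a hae).2]; exact h.load_unmark a ha
  · intro a hpa
    by_cases hae : a = e
    · subst hae
      rw [hey]
      have hd := h.demand_le t
      by_cases ha : σ.mark a
      · rcases h.load_mark a ha he with h1 | ⟨h1, -⟩
        · linarith
        · unfold Cfg.Present at hpa
          rw [hex] at hpa
          rcases hcase with h0 | ⟨h0, -⟩
          · linarith
          · exact absurd ha h0
      · have h1 := h.load_unmark a ha
        unfold Cfg.Present at he
        linarith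
    · rw [(hne a hae).2]
      refine h.load_absent a (fun hpa' => hpa ?_)
      unfold Cfg.Present at *
      rwa [(hne a hae).1]

theorem Cfg.Inv.moveSink (hρ : D.IsRank ρ) (h : σ.Inv D b x₀ Δ) {e : Fin m} {t : Fin n}
    (hm : σ.SinkMovable D e t) : (σ.moveSink D e t).Inv D b x₀ Δ :=
  ⟨h.flow.moveSink hm.2.2.1 (hm.2.2.2.elim ge_of_eq (fun h => h.2.le)),
   h.path.moveSink hρ hm.2.2.1 hm.2.1 (h.flow.sink_sign t hm.2.1),
   h.marks.moveSink hm⟩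

end Steps

end UT


namespace UT

open Function

variable {n m : ℕ} {D : MultiDigraph (Fin n) (Fin m)} {b : Fin n → ℝ} {x₀ : Fin m → ℝ} {Δ : ℝ}
  {ρ : Fin n → ℕ} {σ : Cfg n m}

/-! ## Consequences of flow conservation -/

theorem Cfg.FlowInv.x_eq_zero (h : σ.FlowInv D b) {a : Fin m} (ha : ¬ σ.Present a) :
    σ.x a = 0 := le_antisymm (not_lt.1 ha) (h.nonneg a)

theorem Cfg.FlowInv.excess_of_leaf (h : σ.FlowInv D b) {e : Fin m} {v : Fin n}
    (he : σ.Present e) (hv : D.Inc e v) (hl : σ.Leaf D v) :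
    D.excess σ.x v = (if D.tail e = v then σ.x e else 0) - (if D.head e = v then σ.x e else 0) := by
  unfold MultiDigraph.excess
  apply Finset.sum_eq_single e
  · intro a _ hae
    by_cases hp : σ.Present a
    · have : ¬ D.Inc a v := fun hi => hae (hl a e hp he hi hv)
      unfold MultiDigraph.Inc at this
      push Not at this
      simp [this.1, this.2]
    · simp [h.x_eq_zero hp]
  · intro h; exact absurd (Finset.mem_univ e) h

theorem Cfg.le_bal {v : Fin n} (hs : ∀ t, σ.r t < 0 → σ.pos t ≠ v) {u : Fin n} (hu : σ.pos u = v) :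
    σ.r u ≤ σ.bal v := by
  unfold Cfg.bal
  have := Finset.single_le_sum (f := fun u => if σ.pos u = v then σ.r u else 0) (s := Finset.univ)
    (fun w _ => by
      split_ifs with hw
      · exact not_lt.1 (fun hlt => hs w hlt hw)
      · exact le_rfl) (Finset.mem_univ u)
  simpa [hu] using this

theorem Cfg.bal_nonneg {v : Fin n} (hs : ∀ t, σ.r t < 0 → σ.pos t ≠ v) : 0 ≤ σ.bal v := by
  unfold Cfg.bal
  refine Finset.sum_nonneg (fun w _ => ?_)
  split_ifs with hw
  · exact not_lt.1 (fun hlt => hs w hlt hw)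
  · exact le_rfl

theorem Cfg.bal_le {v : Fin n} (hs : ∀ s, 0 < σ.r s → σ.pos s ≠ v) {u : Fin n} (hu : σ.pos u = v) :
    σ.bal v ≤ σ.r u := by
  -- Negating all balances exchanges sources and sinks.
  have := Cfg.le_bal (σ := { σ with r := fun u => - σ.r u }) (v := v)
    (fun t ht => hs t (by simpa using ht)) hu
  have h2 : ({ σ with r := fun u => - σ.r u } : Cfg n m).bal v = - σ.bal v := by
    unfold Cfg.bal
    rw [← Finset.sum_neg_distrib]
    refine Finset.sum_congr rfl (fun w _ => ?_)
    split_ifs <;> simp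
  rw [h2] at this
  exact neg_le_neg_iff.1 this

/-- Flow on a marked arc is bounded by the maximum demand. -/
theorem Cfg.marked_le (hρ : D.IsRank ρ) (hf : σ.FlowInv D b) (hm : σ.MarkInv D x₀ Δ)
    (hΔ : 0 < Δ) {a : Fin m} (ha : σ.mark a) : σ.x a ≤ Δ := by
  obtain ⟨N, hN⟩ : ∃ N, ∀ v, ρ v ≤ N :=
    ⟨Finset.univ.sup ρ, fun v => Finset.le_sup (Finset.mem_univ v)⟩
  -- Induction along the path of marked arcs that starts with `a`; the ranks of the heads increase
  -- on it.
  induction hk : N - ρ (D.head a) using Nat.strong_induction_on generalizing a with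
  | _ k ih =>
    by_cases hp : σ.Present a
    swap
    · rw [hf.x_eq_zero hp]; exact hΔ.le
    -- A sink at the head whose demand is at least the flow settles the claim; otherwise all sinks
    -- there are small.
    by_cases hbig : ∃ t, σ.r t < 0 ∧ σ.pos t = D.head a ∧ σ.x a ≤ -σ.r t
    · obtain ⟨t, -, -, h⟩ := hbig
      exact h.trans (hm.demand_le t)
    push Not at hbig
    have hin : σ.x a ≤ ∑ e, if D.head e = D.head a then σ.x e else 0 := by
      have := Finset.single_le_sum (f := fun e => if D.head e = D.head a then σ.x e else 0)
        (s := Finset.univ) (fun w _ => by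
          split_ifs
          · exact hf.nonneg w
          · exact le_rfl) (Finset.mem_univ a)
      simpa using this
    have hex := hf.conserve (D.head a)
    rw [MultiDigraph.excess, Finset.sum_sub_distrib] at hex
    by_cases hsink : ∃ t, σ.r t < 0 ∧ σ.pos t = D.head a
    · obtain ⟨t, ht, hpt⟩ := hsink
      exfalso
      have hlt := hbig t ht hpt
      have hroot := hm.small_root a ha hp t ht hpt hlt
      have hout : (∑ e, if D.tail e = D.head a then σ.x e else 0) = 0 := by
        refine Finset.sum_eq_zero (fun e _ => ?_)
        split_ifs with h
        · exact hf.x_eq_zero (fun hpe => hroot e hpe h)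
        · rfl
      have hbal : σ.r t ≤ σ.bal (D.head a) := by
        unfold Cfg.bal
        have h1 : (∑ u, if u = t then σ.r u else 0) = σ.r t := by simp
        rw [← h1]
        refine Finset.sum_le_sum (fun u _ => ?_)
        by_cases hut : u = t
        · subst hut; simp [hpt]
        · rw [if_neg hut]
          split_ifs with hu
          · by_contra hneg
            push Not at hneg
            exact hut (hm.small_unique a ha hp u t hneg ht hu hpt (hbig u hneg hu) hlt)
          · exact le_rfl
      linarith
    · push Not at hsink
      -- Without a sink, all flow that enters must leave, and it can only do so through one marked
      -- arc.
      have hbal := Cfg.bal_nonneg (σ := σ) (v := D.head a) hsink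
      by_cases hout : ∃ e, σ.Present e ∧ D.tail e = D.head a
      · obtain ⟨e, he, hte⟩ := hout
        have h1 : (∑ e', if D.tail e' = D.head a then σ.x e' else 0) = σ.x e := by
          rw [Finset.sum_eq_single e]
          · simp [hte]
          · intro e' _ hne
            split_ifs with h
            · by_contra hx
              have : σ.Present e' := lt_of_le_of_ne (hf.nonneg e') (Ne.symm hx)
              exact hne (hm.out_unique a ha hp e' e this he h hte)
            · rfl
          · intro h; exact absurd (Finset.mem_univ e) h
        have h2 := hρ e
        rw [hte] at h2
        have h3 := hN (D.head e)
        have := ih (N - ρ (D.head e)) (by omega) (hm.out_mark a ha hp e he hte) rfl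
        linarith
      · push Not at hout
        have h1 : (∑ e, if D.tail e = D.head a then σ.x e else 0) = 0 := by
          refine Finset.sum_eq_zero (fun e _ => ?_)
          split_ifs with h
          · exact hf.x_eq_zero (fun hpe => hout e hpe h)
          · rfl
        linarith

/-! ## Moving a source -/

/-- The source `s` may be moved over the arc `e`. -/
def Cfg.SourceMovable (σ : Cfg n m) (D : MultiDigraph (Fin n) (Fin m))
    (e : Fin m) (s : Fin n) : Prop :=
  σ.Present e ∧ σ.Leaf D (D.tail e) ∧ 0 < σ.r s ∧ σ.pos s = D.tail e

/-- A source and a sink at the same vertex, to which at most one arc is attached. -/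
def Cfg.Servable (σ : Cfg n m) (D : MultiDigraph (Fin n) (Fin m)) (s t : Fin n) : Prop :=
  0 < σ.r s ∧ σ.r t < 0 ∧ σ.pos s = σ.pos t ∧ σ.Leaf D (σ.pos t)

/-- The move preserves `y + x` on `e` and lowers `x`, so the only issue is the load of a marked `e`.
If still `y < x₀`, then `Cfg.marked_le` gives `y + x < x₀ + Δ`, and the leaf at the tail supplies
the rest of the second alternative of `load_mark`. -/
theorem Cfg.MarkInv.moveSource (hρ : D.IsRank ρ) (hf : σ.FlowInv D b) (h : σ.MarkInv D x₀ Δ)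
    (hΔ : 0 < Δ) {e : Fin m} {s : Fin n} (hm : σ.SourceMovable D e s) (hle : σ.r s ≤ σ.x e) :
    (σ.moveSource D e s).MarkInv D x₀ Δ := by
  obtain ⟨he, hleaf, hr, hpos⟩ := hm
  set σ' := σ.moveSource D e s with hσ'
  have hposne : ∀ u, u ≠ s → σ'.pos u = σ.pos u := fun u hu => by
    simp [hσ', Cfg.moveSource, update_of_ne hu]
  have hne : ∀ a, a ≠ e → σ'.x a = σ.x a ∧ σ'.y a = σ.y a := fun a ha => by
    simp [hσ', Cfg.moveSource, update_of_ne ha]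
  have hex : σ'.x e = σ.x e - σ.r s := by simp [hσ', Cfg.moveSource]
  have hey : σ'.y e = σ.y e + σ.r s := by simp [hσ', Cfg.moveSource]
  have hx : ∀ a, σ'.x a ≤ σ.x a := fun a => by
    by_cases ha : a = e
    · subst ha; rw [hex]; linarith
    · rw [(hne a ha).1]
  have hp : ∀ a, σ'.Present a → σ.Present a := fun a ha => lt_of_lt_of_le ha (hx a)
  have hsink : ∀ t, σ.r t < 0 → σ'.pos t = σ.pos t := fun t ht =>
    hposne t (by rintro rfl; linarith)
  have hload : σ.mark e → σ.y e + σ.x e < x₀ e + Δ := fun hme => by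
    rcases h.load_mark e hme he with h1 | h1
    · have := Cfg.marked_le hρ hf h hΔ hme
      linarith
    · exact h1.1
  refine ⟨h.demand_le, ?_, ?_, ?_, ?_, ?_, ?_, ?_⟩
  · intro a ha hpa e1 e2 h1 h2
    exact h.out_unique a ha (hp a hpa) e1 e2 (hp _ h1) (hp _ h2)
  · intro a ha hpa e1 h1
    exact h.out_mark a ha (hp a hpa) e1 (hp _ h1)
  · intro a ha hpa u hu hpu hlt e1 h1 ht1
    rw [hsink u hu] at hpu
    exact h.small_root a ha (hp a hpa) u hu hpu (hlt.trans_le (hx a)) e1 (hp _ h1) ht1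
  · intro a ha hpa u u' hu hu' hpu hpu' hlt hlt'
    rw [hsink u hu] at hpu
    rw [hsink u' hu'] at hpu'
    exact h.small_unique a ha (hp a hpa) u u' hu hu' hpu hpu' (hlt.trans_le (hx a))
      (hlt'.trans_le (hx a))
  · intro a ha hpa
    by_cases hae : a = e
    · subst hae
      right
      refine ⟨?_, hleaf.mono hp⟩
      rw [hex, hey]
      have := hload ha
      linarith
    · rw [(hne a hae).1, (hne a hae).2]
      exact (h.load_mark a ha (hp a hpa)).imp_right (fun hl => ⟨hl.1, hl.2.mono hp⟩)
  · intro a ha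
    by_cases hae : a = e
    · subst hae
      have := h.load_unmark a ha
      rw [hex, hey]; linarith
    · rw [(hne a hae).1, (hne a hae).2]; exact h.load_unmark a ha
  · intro a hpa
    by_cases hae : a = e
    · subst hae
      rw [hey]
      by_cases ha : σ.mark a
      · have := hload ha
        linarith
      · have h1 := h.load_unmark a ha
        linarith
    · rw [(hne a hae).2]
      refine h.load_absent a (fun hpa' => hpa ?_)
      unfold Cfg.Present at *
      rwa [(hne a hae).1]

theorem MultiDigraph.IsRank.tail_ne_head (hρ : D.IsRank ρ) (a : Fin m) : D.tail a ≠ D.head a :=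
  fun h => by have := hρ a; rw [h] at this; exact lt_irrefl _ this

theorem Cfg.Inv.moveSource (hρ : D.IsRank ρ) (h : σ.Inv D b x₀ Δ) (hΔ : 0 < Δ) {e : Fin m}
    {s : Fin n} (hm : σ.SourceMovable D e s) (hserve : ∀ s t, ¬ σ.Servable D s t) :
    (σ.moveSource D e s).Inv D b x₀ Δ := by
  -- At the leaf, the flow on `e` is the entire balance of the vertex. No sink is there, since `s`
  -- could serve it, so this balance is at least `r s`.
  have hle : σ.r s ≤ σ.x e := by
    have h1 := h.flow.excess_of_leaf hm.1 (Or.inl rfl) hm.2.1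
    rw [h.flow.conserve, if_pos rfl, if_neg (hρ.tail_ne_head e).symm, sub_zero] at h1
    rw [← h1]
    refine Cfg.le_bal (fun t ht hpt => hserve s t ⟨hm.2.2.1, ht, ?_, ?_⟩) hm.2.2.2
    · rw [hpt, hm.2.2.2]
    · rw [hpt]; exact hm.2.1
  exact ⟨h.flow.moveSource hm.2.2.2 hle,
    h.path.moveSource hρ hm.2.2.2 hm.2.2.1 (h.flow.source_sign s hm.2.2.1),
    h.marks.moveSource hρ h.flow hΔ hm hle⟩

/-! ## Serving a sink from a source -/

/-- Used with `g = id` for the balances of vertices and with `g = abs` for the flow on unfinished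
paths. -/
theorem sum_update (p : Fin n → Prop) [DecidablePred p] (f : Fin n → ℝ) (u : Fin n) (c : ℝ)
    (g : ℝ → ℝ) :
    (∑ v, if p v then g (update f u c v) else 0)
      = (∑ v, if p v then g (f v) else 0) + if p u then g c - g (f u) else 0 := by
  rw [sum_eq_add_of_eq_off u (fun v hv => by rw [update_of_ne hv])]
  congr 1
  simp only [update_self]
  split_ifs <;> simp

theorem Cfg.serve_r_source {s t : Fin n} {c : ℝ} (hst : s ≠ t) :
    (σ.serve s t c).r s = σ.r s - c := by
  simp [Cfg.serve, update_of_ne hst]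

theorem Cfg.serve_r_sink {s t : Fin n} {c : ℝ} : (σ.serve s t c).r t = σ.r t + c := by
  simp [Cfg.serve]

theorem Cfg.serve_r_of_ne {s t u : Fin n} {c : ℝ} (hs : u ≠ s) (ht : u ≠ t) :
    (σ.serve s t c).r u = σ.r u := by
  simp [Cfg.serve, update_of_ne hs, update_of_ne ht]

theorem Cfg.FlowInv.serve (h : σ.FlowInv D b) {s t : Fin n} {c : ℝ} (hm : σ.Servable D s t)
    (hc : 0 ≤ c) (hcs : c ≤ σ.r s) (hct : c ≤ -σ.r t) : (σ.serve s t c).FlowInv D b := by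
  have hst : s ≠ t := by rintro rfl; linarith [hm.1, hm.2.1]
  refine ⟨h.nonneg, fun v => ?_, h.total, fun u hu => ?_, fun u hu => ?_⟩
  · have h1 := sum_update (fun u => σ.pos u = v) (update σ.r s (σ.r s - c)) t (σ.r t + c) id
    have h2 := sum_update (fun u => σ.pos u = v) σ.r s (σ.r s - c) id
    refine (h.conserve v).trans (Eq.trans ?_ h1.symm)
    rw [h2, hm.2.2.1, update_of_ne hst.symm]
    simp only [id, Cfg.bal]
    split_ifs <;> ring
  · apply h.source_sign
    by_cases hut : u = t
    · subst hut; rw [Cfg.serve_r_sink] at hu; linarith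
    · by_cases hus : u = s
      · subst hus; exact hm.1
      · rwa [Cfg.serve_r_of_ne hus hut] at hu
  · apply h.sink_sign
    by_cases hut : u = t
    · subst hut; exact hm.2.1
    · by_cases hus : u = s
      · subst hus; rw [Cfg.serve_r_source hst] at hu; linarith
      · rwa [Cfg.serve_r_of_ne hus hut] at hu

theorem Cfg.PathInv.serve (hρ : D.IsRank ρ) (hf : σ.FlowInv D b) (h : σ.PathInv D b)
    {s t : Fin n} {c : ℝ} (hm : σ.Servable D s t)
    (hc : 0 < c) (hcs : c ≤ σ.r s) (hct : c ≤ -σ.r t) (hor : c = σ.r s ∨ c = -σ.r t) :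
    (σ.serve s t c).PathInv D b := by
  have hst : s ≠ t := by rintro rfl; linarith [hm.1, hm.2.1]
  have hbs := hf.source_sign s hm.1
  have hbt := hf.sink_sign t hm.2.1
  have hws := h.walk_source s hbs.le
  have hwt := h.walk_sink t hbt
  rw [hm.2.2.1] at hws
  refine ⟨h.walk_source, h.walk_sink, ?_, ?_, ?_, ?_, ?_, ?_, ?_⟩
  · intro p hp
    rcases List.mem_append.1 hp with hp | hp
    · exact h.source_pos p hp
    · rw [List.mem_singleton.1 hp]; exact hbs
  · intro p hp
    rcases List.mem_append.1 hp with hp | hp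
    · exact h.sink_neg p hp
    · rw [List.mem_singleton.1 hp]; exact hbt
  · intro p hp
    rcases List.mem_append.1 hp with hp | hp
    · exact h.isWalk p hp
    · rw [List.mem_singleton.1 hp]
      exact (MultiDigraph.isWalk_append D).2 ⟨_, hws, hwt⟩
  · intro p hp
    rcases List.mem_append.1 hp with hp | hp
    · exact h.value_pos p hp
    · rw [List.mem_singleton.1 hp]; exact hc
  · simp only [Cfg.serve, List.map_append, List.map_cons, List.map_nil]
    rw [List.nodup_append]
    refine ⟨h.nodup, List.nodup_singleton _, ?_⟩
    intro q hq q' hq' heq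
    rw [List.mem_singleton.1 hq'] at heq
    obtain ⟨p, hp, rfl⟩ := List.mem_map.1 hq
    obtain ⟨rfl, rfl⟩ := Prod.mk.inj heq
    -- An earlier path for the same pair would have left `s` or `t` with balance zero.
    rcases h.settled p hp with h0 | h0
    · linarith [hm.1]
    · linarith [hm.2.1]
  · intro p hp
    rcases List.mem_append.1 hp with hp | hp
    · have key : ∀ u, σ.r u = 0 → (σ.serve s t c).r u = 0 := by
        intro u hu
        rw [Cfg.serve_r_of_ne, hu]
        · rintro rfl; linarith [hm.1]
        · rintro rfl; linarith [hm.2.1]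
      exact (h.settled p hp).imp (key _) (key _)
    · rw [List.mem_singleton.1 hp]
      rcases hor with hor | hor
      · left; rw [Cfg.serve_r_source hst, hor, sub_self]
      · right; dsimp only; rw [Cfg.serve_r_sink, hor]; ring
  · intro a
    have h1 := sum_update (fun u => a ∈ σ.trav u) (update σ.r s (σ.r s - c)) t (σ.r t + c) abs
    have h2 := sum_update (fun u => a ∈ σ.trav u) σ.r s (σ.r s - c) abs
    refine (h.decomposition a).trans (Eq.trans ?_ (congrArg (_ + ·) h1.symm))
    rw [h2, update_of_ne hst.symm, abs_of_pos hm.1, abs_of_neg hm.2.1,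
      abs_of_nonneg (by linarith : 0 ≤ σ.r s - c), abs_of_nonpos (by linarith : σ.r t + c ≤ 0)]
    simp only [Cfg.serve, List.map_append, List.map_cons, List.map_nil, List.sum_append,
      List.sum_cons, List.sum_nil, List.mem_append, List.mem_reverse]
    -- The two walks meet at a vertex whose rank separates their arcs, so no arc lies on both and
    -- the combined path uses each arc at most once.
    by_cases ha : a ∈ σ.trav s
    · have hnot : a ∉ σ.trav t := by
        intro hat
        have h3 := hws.rank_head_le hρ ha
        have h4 := hwt.le_rank_tail hρ (List.mem_reverse.2 hat)
        have h5 := hρ a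
        omega
      simp only [ha, hnot, true_or, if_true, if_false]
      ring
    · by_cases hat : a ∈ σ.trav t
      · simp only [ha, hat, or_true, if_true, if_false]
        ring
      · simp only [ha, hat, or_self, if_false]
        ring

/-- Serving lowers the demand of `t` and may make it small. A marked arc entering the leaf is the
only arc there, so nothing leaves. If another sink at the vertex were small, then by `hmin` so was
`t` already before, against `small_unique`; this is why the sink of smallest demand is served. -/
theorem Cfg.MarkInv.serve (hρ : D.IsRank ρ) (h : σ.MarkInv D x₀ Δ) {s t : Fin n} {c : ℝ}
    (hm : σ.Servable D s t) (hmin : ∀ t', σ.r t' < 0 → σ.pos t' = σ.pos t → σ.r t' ≤ σ.r t)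
    (hc : 0 ≤ c) (hcs : c ≤ σ.r s) (hct : c ≤ -σ.r t) (hΔ : 0 < Δ) :
    (σ.serve s t c).MarkInv D x₀ Δ := by
  have hst : s ≠ t := by rintro rfl; linarith [hm.1, hm.2.1]
  have hneg : ∀ u, (σ.serve s t c).r u < 0 → u ≠ t → (σ.serve s t c).r u = σ.r u := by
    intro u hu hut
    by_cases hus : u = s
    · subst hus; rw [Cfg.serve_r_source hst] at hu; linarith
    · exact Cfg.serve_r_of_ne hus hut
  have hothers : ∀ a, σ.mark a → σ.Present a → σ.pos t = D.head a → ∀ u, u ≠ t → σ.r u < 0 →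
      σ.pos u = D.head a → ¬ (-σ.r u < σ.x a) := by
    intro a ha hpa hpt u hut hu hpu hlt
    have := hmin u hu (hpu.trans hpt.symm)
    exact hut (h.small_unique a ha hpa u t hu hm.2.1 hpu hpt hlt (by linarith))
  refine ⟨fun u => ?_, h.out_unique, h.out_mark, ?_, ?_, h.load_mark, h.load_unmark,
    h.load_absent⟩
  · by_cases hut : u = t
    · subst hut; rw [Cfg.serve_r_sink]; have := h.demand_le u; linarith
    · by_cases hus : u = s
      · subst hus; rw [Cfg.serve_r_source hst]; linarith
      · rw [Cfg.serve_r_of_ne hus hut]; exact h.demand_le u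
  · intro a ha hpa u hu hpu hlt e he hte
    by_cases hut : u = t
    · subst hut
      have hpu' : σ.pos u = D.head a := hpu
      have hl := hm.2.2.2
      rw [hpu'] at hl
      have hea := hl e a he hpa (Or.inl hte) (Or.inr rfl)
      subst hea
      exact hρ.tail_ne_head e hte
    · rw [hneg u hu hut] at hlt hu
      exact h.small_root a ha hpa u hu hpu hlt e he hte
  · intro a ha hpa u u' hu hu' hpu hpu' hlt hlt'
    by_cases hut : u = t
    · by_cases hut' : u' = t
      · rw [hut, hut']
      · subst hut
        rw [hneg u' hu' hut'] at hlt' hu'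
        exact absurd hlt' (hothers a ha hpa hpu u' hut' hu' hpu')
    · by_cases hut' : u' = t
      · subst hut'
        rw [hneg u hu hut] at hlt hu
        exact absurd hlt (hothers a ha hpa hpu' u hut hu hpu)
      · rw [hneg u hu hut] at hlt hu
        rw [hneg u' hu' hut'] at hlt' hu'
        exact h.small_unique a ha hpa u u' hu hu' hpu hpu' hlt hlt'

end UT


/-! ### Marking, cycle augmentation, progress and the termination measure -/

namespace UT

open Function

variable {n m : ℕ} {D : MultiDigraph (Fin n) (Fin m)} {b : Fin n → ℝ} {x₀ : Fin m → ℝ} {Δ : ℝ}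
  {ρ : Fin n → ℕ} {σ : Cfg n m}

theorem Cfg.Inv.serve (hρ : D.IsRank ρ) (h : σ.Inv D b x₀ Δ) (hΔ : 0 < Δ) {s t : Fin n} {c : ℝ}
    (hm : σ.Servable D s t) (hmin : ∀ t', σ.r t' < 0 → σ.pos t' = σ.pos t → σ.r t' ≤ σ.r t)
    (hcs : c ≤ σ.r s) (hct : c ≤ -σ.r t) (hor : c = σ.r s ∨ c = -σ.r t) :
    (σ.serve s t c).Inv D b x₀ Δ := by
  have hc : 0 < c := by
    rcases hor with h | h
    · rw [h]; exact hm.1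
    · have := hm.2.1; linarith
  exact ⟨h.flow.serve hm hc.le hcs hct, h.path.serve hρ h.flow hm hc hcs hct hor,
    h.marks.serve hρ hm hmin hc.le hcs hct hΔ⟩

/-! ## Marking an arc -/

def Cfg.setMark (σ : Cfg n m) (a : Fin m) : Cfg n m :=
  { σ with mark := fun e => e = a ∨ σ.mark e }

theorem Cfg.not_sinkMovable_setMark (h : ∀ e t, ¬ σ.SinkMovable D e t) (a : Fin m) :
    ∀ e t, ¬ (σ.setMark a).SinkMovable D e t := fun e t hm =>
  h e t ⟨hm.1, hm.2.1, hm.2.2.1, hm.2.2.2.imp_right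
    (fun h' => ⟨fun hme => h'.1 (Or.inr hme), h'.2⟩)⟩

/-- A small sink at the head of an unmarked arc would be movable over it. So if `a` is newly marked
while no sink is movable, the conditions on small sinks hold vacuously. The bound `y + x ≤ x₀` with
`x > 0` gives `y < x₀`. -/
theorem Cfg.Inv.setMark (h : σ.Inv D b x₀ Δ) (hq : ∀ e t, ¬ σ.SinkMovable D e t) {a : Fin m}
    (hpa : σ.Present a)
    (hout : ∀ e e', σ.Present e → σ.Present e' → D.tail e = D.head a → D.tail e' = D.head a →
      e = e')
    (hmark : ∀ e, σ.Present e → D.tail e = D.head a → σ.mark e) :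
    (σ.setMark a).Inv D b x₀ Δ := by
  by_cases hma : σ.mark a
  · have : σ.setMark a = σ := by
      have : (fun e => e = a ∨ σ.mark e) = σ.mark := by
        funext e
        exact propext ⟨fun h => h.elim (fun h => h ▸ hma) id, Or.inr⟩
      unfold Cfg.setMark
      rw [this]
    rw [this]; exact h
  have hbig : ∀ t, σ.r t < 0 → σ.pos t = D.head a → ¬ (-σ.r t < σ.x a) := fun t ht hpt hlt =>
    hq a t ⟨hpa, ht, hpt, Or.inr ⟨hma, by linarith⟩⟩
  refine ⟨⟨h.flow.1, h.flow.2, h.flow.3, h.flow.4, h.flow.5⟩,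
    ⟨h.path.1, h.path.2, h.path.3, h.path.4, h.path.5, h.path.6, h.path.7, h.path.8, h.path.9⟩,
    ⟨h.marks.demand_le, ?_, ?_, ?_, ?_, ?_, ?_, h.marks.load_absent⟩⟩
  · rintro e (rfl | he)
    · exact fun _ => hout
    · exact h.marks.out_unique e he
  · rintro e (rfl | he)
    · exact fun _ e' he' hte => Or.inr (hmark e' he' hte)
    · exact fun hpe e' he' hte => Or.inr (h.marks.out_mark e he hpe e' he' hte)
  · rintro e (rfl | he)
    · exact fun _ t ht hpt hlt => absurd hlt (hbig t ht hpt)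
    · exact h.marks.small_root e he
  · rintro e (rfl | he)
    · exact fun _ t _ ht _ hpt _ hlt => absurd hlt (hbig t ht hpt)
    · exact h.marks.small_unique e he
  · rintro e (rfl | he)
    · intro _
      left
      have := h.marks.load_unmark e hma
      unfold Cfg.Present at hpa
      change σ.y e < x₀ e
      linarith
    · exact h.marks.load_mark e he
  · intro e he
    exact h.marks.load_unmark e (fun h' => he (Or.inr h'))

/-! ## Augmenting -/

/-- An arc that gains flow is marked and its tail is not a leaf, so it is in the phase `y < x₀`,
where the size of `x` does not matter. The last clause of `hinc` stops the gain at the next larger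
demand, so that no sink becomes small. -/
theorem Cfg.Inv.augment (h : σ.Inv D b x₀ Δ) (hΔ : 0 < Δ)
    (hq : ∀ e t, ¬ σ.SinkMovable D e t) {x' : Fin m → ℝ}
    (hex : ∀ v, D.excess x' v = D.excess σ.x v) (hnn : ∀ a, 0 ≤ x' a)
    (habs : ∀ a, ¬ σ.Present a → x' a = 0)
    (hinc : ∀ a, σ.x a < x' a → σ.mark a ∧ ¬ σ.Leaf D (D.tail a) ∧
      ∀ t, σ.r t < 0 → σ.pos t = D.head a → σ.x a < -σ.r t → x' a ≤ -σ.r t) :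
    ({ σ with x := x' } : Cfg n m).Inv D b x₀ Δ := by
  set σ' : Cfg n m := { σ with x := x' } with hσ'
  have hp : ∀ a, σ'.Present a → σ.Present a := by
    intro a ha
    by_contra hna
    exact absurd (habs a hna) (ne_of_gt ha)
  have hsmall : ∀ a, σ.mark a → σ.Present a → ∀ t, σ.r t < 0 → σ.pos t = D.head a →
      -σ.r t < x' a → -σ.r t < σ.x a := by
    intro a ha hpa t ht hpt hlt
    by_contra hle
    -- Equality of flow and demand is impossible, since such a sink would be movable.
    rcases (not_lt.1 hle).lt_or_eq with hlt' | heq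
    · exact absurd ((hinc a (hlt'.trans hlt)).2.2 t ht hpt hlt') (not_le.2 hlt)
    · exact hq a t ⟨hpa, ht, hpt, Or.inl (by linarith)⟩
  refine ⟨⟨hnn, fun v => (hex v).trans (h.flow.conserve v), fun v => ?_, h.flow.4, h.flow.5⟩,
    ⟨h.path.1, h.path.2, h.path.3, h.path.4, h.path.5, h.path.6, h.path.7, h.path.8, h.path.9⟩,
    ⟨h.marks.demand_le, ?_, ?_, ?_, ?_, ?_, ?_, ?_⟩⟩
  · have hadd : ∀ f g : Fin m → ℝ, D.excess (fun a => f a + g a) v = D.excess f v + D.excess g v := by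
      intro f g
      unfold MultiDigraph.excess
      rw [← Finset.sum_add_distrib]
      refine Finset.sum_congr rfl (fun a _ => ?_)
      split_ifs <;> ring
    have h1 := h.flow.total v
    rw [hadd] at h1
    refine (hadd x' σ.y).trans ?_
    rw [hex, h1]
  · intro a ha hpa e1 e2 h1 h2
    exact h.marks.out_unique a ha (hp a hpa) e1 e2 (hp _ h1) (hp _ h2)
  · intro a ha hpa e1 h1
    exact h.marks.out_mark a ha (hp a hpa) e1 (hp _ h1)
  · intro a ha hpa t ht hpt hlt e he
    exact h.marks.small_root a ha (hp a hpa) t ht hpt (hsmall a ha (hp a hpa) t ht hpt hlt) e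
      (hp e he)
  · intro a ha hpa t t' ht ht' hpt hpt' hlt hlt'
    exact h.marks.small_unique a ha (hp a hpa) t t' ht ht' hpt hpt'
      (hsmall a ha (hp a hpa) t ht hpt hlt) (hsmall a ha (hp a hpa) t' ht' hpt' hlt')
  · intro a ha hpa
    rcases h.marks.load_mark a ha (hp a hpa) with h1 | ⟨h1, h2⟩
    · exact Or.inl h1
    · right
      refine ⟨?_, h2.mono hp⟩
      have : x' a ≤ σ.x a := not_lt.1 (fun hlt => (hinc a hlt).2.1 h2)
      change σ.y a + x' a < _
      linarith
  · intro a ha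
    have : x' a ≤ σ.x a := not_lt.1 (fun hlt => ha (hinc a hlt).1)
    have h1 := h.marks.load_unmark a ha
    change σ.y a + x' a ≤ _
    linarith
  · intro a hpa
    by_cases hpa' : σ.Present a
    · have hx : 0 < σ.x a := hpa'
      change σ.y a < _
      by_cases ha : σ.mark a
      · rcases h.marks.load_mark a ha hpa' with h1 | ⟨h1, h2⟩ <;> linarith
      · have h1 := h.marks.load_unmark a ha
        linarith
    · exact h.marks.load_absent a hpa'

/-! ## Progress -/

/-- If `e` were the only arc at its head, its flow would end at sinks there, with no source left at
the vertex. Hence no demand exceeds the flow, and since no sink is movable, `e` is marked and all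
these sinks are small. So there is just one, and its demand equals the flow: a contradiction. -/
theorem Cfg.Inv.not_leaf_head (hρ : D.IsRank ρ) (h : σ.Inv D b x₀ Δ)
    (hq : ∀ e t, ¬ σ.SinkMovable D e t) (hserve : ∀ s t, ¬ σ.Servable D s t) {e : Fin m}
    (he : σ.Present e) : ¬ σ.Leaf D (D.head e) := by
  intro hl
  have hbal := h.flow.excess_of_leaf he (Or.inr rfl) hl
  rw [h.flow.conserve, if_pos rfl, if_neg (hρ.tail_ne_head e), zero_sub] at hbal
  have hpos : 0 < σ.x e := he
  obtain ⟨t, ht, hpt⟩ : ∃ t, σ.r t < 0 ∧ σ.pos t = D.head e := by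
    by_contra hno
    push Not at hno
    have := Cfg.bal_nonneg (σ := σ) hno
    linarith
  have hns : ∀ s, 0 < σ.r s → σ.pos s ≠ D.head e := fun s hs hps =>
    hserve s t ⟨hs, ht, hps.trans hpt.symm, by rw [hpt]; exact hl⟩
  have hle : ∀ u, σ.pos u = D.head e → -σ.r u ≤ σ.x e := fun u hu => by
    have := Cfg.bal_le hns hu
    linarith
  have hlt : ∀ u, σ.r u < 0 → σ.pos u = D.head e → σ.mark e ∧ -σ.r u < σ.x e := by
    intro u hur hu
    have hne : σ.x e + σ.r u ≠ 0 := fun h0 => hq e u ⟨he, hur, hu, Or.inl h0⟩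
    have h1 : -σ.r u < σ.x e := lt_of_le_of_ne (hle u hu) (fun h' => hne (by linarith))
    refine ⟨?_, h1⟩
    by_contra hm
    exact hq e u ⟨he, hur, hu, Or.inr ⟨hm, by linarith⟩⟩
  obtain ⟨hm, hlt'⟩ := hlt t ht hpt
  have : σ.bal (D.head e) = σ.r t := by
    unfold Cfg.bal
    rw [Finset.sum_eq_single t]
    · rw [if_pos hpt]
    · intro u _ hut
      split_ifs with hu
      · by_contra hr
        rcases lt_or_gt_of_ne hr with hr | hr
        · exact hut (h.marks.small_unique e hm he u t hr ht hu hpt (hlt u hr hu).2 hlt')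
        · exact hns u hr hu
      · rfl
    · intro h; exact absurd (Finset.mem_univ t) h
  linarith

/-- Flow leaving a leaf needs a positive balance there, hence a source that can be moved over `e`.
-/
theorem Cfg.Inv.not_leaf_tail (hρ : D.IsRank ρ) (h : σ.Inv D b x₀ Δ)
    (hsrc : ∀ e s, ¬ σ.SourceMovable D e s) {e : Fin m}
    (he : σ.Present e) : ¬ σ.Leaf D (D.tail e) := by
  intro hl
  have hbal := h.flow.excess_of_leaf he (Or.inl rfl) hl
  rw [h.flow.conserve, if_pos rfl, if_neg (hρ.tail_ne_head e).symm, sub_zero] at hbal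
  have hpos : 0 < σ.x e := he
  have : σ.bal (D.tail e) ≤ 0 := by
    unfold Cfg.bal
    refine Finset.sum_nonpos (fun s _ => ?_)
    split_ifs with hs
    · exact not_lt.1 (fun hr => hsrc e s ⟨he, hl, hr, hs⟩)
    · exact le_rfl
  linarith

theorem Cfg.exists_other_arc {v : Fin n} (h : ¬ σ.Leaf D v) (e : Fin m) :
    ∃ e', σ.Present e' ∧ D.Inc e' v ∧ e' ≠ e := by
  unfold Cfg.Leaf at h
  push Not at h
  obtain ⟨a, a', ha, ha', hi, hi', hne⟩ := h
  by_cases hae : a = e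
  · exact ⟨a', ha', hi', fun h => hne (hae.trans h.symm)⟩
  · exact ⟨a, ha, hi, hae⟩

/-- Without flow every vertex is a leaf with total balance zero. As nothing is servable, the
terminals at a vertex do not have opposite signs, so all their balances vanish. -/
theorem Cfg.Inv.r_eq_zero (h : σ.Inv D b x₀ Δ) (hserve : ∀ s t, ¬ σ.Servable D s t)
    (habs : ∀ a, ¬ σ.Present a) (u : Fin n) : σ.r u = 0 := by
  have hbal : ∀ v, σ.bal v = 0 := by
    intro v
    rw [← h.flow.conserve v]
    unfold MultiDigraph.excess
    refine Finset.sum_eq_zero (fun a _ => ?_)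
    rw [h.flow.x_eq_zero (habs a)]
    simp
  have hleaf : ∀ v, σ.Leaf D v := fun v a _ ha => absurd ha (habs a)
  by_contra hr
  rcases lt_or_gt_of_ne hr with hr | hr
  · have := Cfg.bal_le (σ := σ) (v := σ.pos u) (u := u)
      (fun s hs hps => hserve s u ⟨hs, hr, hps, hleaf _⟩) rfl
    linarith [hbal (σ.pos u)]
  · have := Cfg.le_bal (σ := σ) (v := σ.pos u) (u := u)
      (fun t ht hpt => hserve u t ⟨hr, ht, hpt.symm, hleaf _⟩) rfl
    linarith [hbal (σ.pos u)]

theorem Cfg.Inv.isUnsplittable (hρ : D.IsRank ρ) (h : σ.Inv D b x₀ Δ)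
    (hserve : ∀ s t, ¬ σ.Servable D s t) (habs : ∀ a, ¬ σ.Present a) :
    D.IsUnsplittable b σ.y σ.ps := by
  have hdec : ∀ a, σ.y a = (σ.ps.map (fun p => if a ∈ p.arcs then p.value else 0)).sum := by
    intro a
    rw [h.path.decomposition a, add_eq_left]
    refine Finset.sum_eq_zero (fun u _ => ?_)
    rw [h.r_eq_zero hserve habs u]
    simp
  refine ⟨?_, h.path.source_pos, h.path.sink_neg, fun p hp => (h.path.isWalk p hp).isPath hρ,
    h.path.value_pos, h.path.nodup, hdec⟩
  rw [MultiDigraph.isTransshipment_iff_excess]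
  constructor
  · intro a
    rw [hdec a]
    refine List.sum_nonneg (fun z hz => ?_)
    obtain ⟨p, hp, rfl⟩ := List.mem_map.1 hz
    split_ifs
    · exact (h.path.value_pos p hp).le
    · exact le_rfl
  · intro v
    rw [← h.flow.total v]
    congr 1
    funext a
    rw [h.flow.x_eq_zero (habs a), zero_add]

/-! ## The initial configuration -/

/-- The configuration at the start. -/
def Cfg.init (b : Fin n → ℝ) (x : Fin m → ℝ) : Cfg n m where
  x := x
  r := b
  pos := id
  trav _ := []
  mark _ := False
  y _ := 0
  ps := []

theorem Cfg.inv_init {x : Fin m → ℝ} (h : D.IsTransshipment b x) (hΔ : 0 < Δ)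
    (hd : ∀ t, -b t ≤ Δ) : (Cfg.init b x).Inv D b x Δ := by
  rw [MultiDigraph.isTransshipment_iff_excess] at h
  refine ⟨⟨h.1, fun v => ?_, fun v => ?_, fun _ => id, fun _ => id⟩,
    ⟨fun u _ => rfl, fun u _ => rfl, ?_, ?_, ?_, ?_, ?_, ?_, ?_⟩,
    ⟨hd, ?_, ?_, ?_, ?_, ?_, ?_, ?_⟩⟩
  · simp only [Cfg.init, Cfg.bal, h.2 v, id]
    rw [Finset.sum_eq_single v] <;> simp +contextual
  · simp [Cfg.init, h.2 v]
  all_goals simp [Cfg.init]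
  intro a ha
  have := h.1 a
  linarith

/-! ## Termination -/

open Classical in
/-- A bound for the number of steps that move or serve terminals or delete arcs. -/
noncomputable def Cfg.size (σ : Cfg n m) : ℕ :=
  (Finset.univ.filter (fun u => σ.r u ≠ 0)).card + (Finset.univ.filter σ.Present).card
    + ∑ u, (n - (σ.trav u).length)

/-- Some sink can be moved over an arc that is deleted thereby. -/
def Cfg.Tight (σ : Cfg n m) (D : MultiDigraph (Fin n) (Fin m)) : Prop :=
  ∃ e t, σ.Present e ∧ σ.r t < 0 ∧ σ.pos t = D.head e ∧ σ.x e + σ.r t = 0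

open Classical in
/-- A bound for the number of iterations. -/
noncomputable def Cfg.measure (σ : Cfg n m) (D : MultiDigraph (Fin n) (Fin m)) : ℕ :=
  2 * σ.size + if σ.Tight D then 0 else 1

/-- The factor `2` in the measure outweighs any change of the tightness term. -/
theorem Cfg.measure_lt_of_size_lt {σ' : Cfg n m} (h : σ'.size < σ.size) :
    σ'.measure D < σ.measure D := by
  unfold Cfg.measure
  split_ifs <;> omega

theorem Cfg.measure_le : σ.measure D ≤ 2 * (n + m + n * n) + 1 := by
  classical
  unfold Cfg.measure Cfg.size
  have h1 : (Finset.univ.filter (fun u => σ.r u ≠ 0)).card ≤ n :=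
    (Finset.card_le_univ _).trans (by simp)
  have h2 : (Finset.univ.filter σ.Present).card ≤ m :=
    (Finset.card_le_univ _).trans (by simp)
  have h3 : ∑ u, (n - (σ.trav u).length) ≤ n * n := by
    refine (Finset.sum_le_sum (fun u _ => Nat.sub_le n _)).trans ?_
    simp
  split_ifs <;> omega

/-- Besides making the truncated differences in `Cfg.size` drop strictly, this lets the path of each
terminal fit into a block of `n` memory cells. -/
theorem Cfg.Inv.length_trav_lt (hρ : D.IsRank ρ) (hn : ∀ v, ρ v < n) (h : σ.PathInv D b)
    (u : Fin n) : (σ.trav u).length < n := by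
  rcases le_or_gt 0 (b u) with hu | hu
  · have := (h.walk_source u hu).rank_add_length_le hρ
    have := hn (σ.pos u)
    omega
  · have := (h.walk_sink u hu).rank_add_length_le hρ
    have := hn u
    rw [List.length_reverse] at *
    omega

theorem Cfg.sum_trav_lt {σ' : Cfg n m} {u : Fin n} {e : Fin m}
    (ht : σ'.trav = update σ.trav u (σ.trav u ++ [e])) (hlen : (σ'.trav u).length < n) :
    ∑ v, (n - (σ'.trav v).length) < ∑ v, (n - (σ.trav v).length) := by
  have hlen' : (σ'.trav u).length = (σ.trav u).length + 1 := by simp [ht]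
  refine Finset.sum_lt_sum (fun v _ => ?_) ⟨u, Finset.mem_univ u, by omega⟩
  by_cases hv : v = u
  · subst hv; omega
  · rw [ht, update_of_ne hv]

theorem Cfg.card_present_le {σ' : Cfg n m} (hp : ∀ a, σ'.Present a → σ.Present a)
    [DecidablePred σ'.Present] [DecidablePred σ.Present] :
    (Finset.univ.filter σ'.Present).card ≤ (Finset.univ.filter σ.Present).card :=
  Finset.card_le_card (fun a ha => by
    simp only [Finset.mem_filter, Finset.mem_univ, true_and] at *
    exact hp a ha)

theorem Cfg.measure_moveSink (hρ : D.IsRank ρ) (hn : ∀ v, ρ v < n) (h : σ.Inv D b x₀ Δ)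
    {e : Fin m} {t : Fin n} (hm : σ.SinkMovable D e t) :
    (σ.moveSink D e t).measure D < σ.measure D := by
  classical
  refine Cfg.measure_lt_of_size_lt ?_
  have h1 := Cfg.sum_trav_lt (σ := σ) (σ' := σ.moveSink D e t) (u := t) (e := e) rfl
    (Cfg.Inv.length_trav_lt hρ hn (h.moveSink hρ hm).path t)
  have h2 := Cfg.card_present_le (σ := σ) (σ' := σ.moveSink D e t)
    (fun a => Cfg.Present.of_moveSink hm.2.1)
  unfold Cfg.size
  have h3 : (σ.moveSink D e t).r = σ.r := rfl
  rw [h3]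
  convert (by omega : (Finset.univ.filter (fun u => σ.r u ≠ 0)).card +
    (Finset.univ.filter (σ.moveSink D e t).Present).card
    + ∑ u, (n - ((σ.moveSink D e t).trav u).length) < (Finset.univ.filter (fun u => σ.r u ≠ 0)).card
    + (Finset.univ.filter σ.Present).card + ∑ u, (n - (σ.trav u).length)) using 1

theorem Cfg.measure_moveSource (hρ : D.IsRank ρ) (hn : ∀ v, ρ v < n)
    {e : Fin m} {s : Fin n} (h : (σ.moveSource D e s).PathInv D b) (hs : 0 < σ.r s) :
    (σ.moveSource D e s).measure D < σ.measure D := by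
  classical
  refine Cfg.measure_lt_of_size_lt ?_
  have h1 := Cfg.sum_trav_lt (σ := σ) (σ' := σ.moveSource D e s) (u := s) (e := e) rfl
    (Cfg.Inv.length_trav_lt hρ hn h s)
  have h2 := Cfg.card_present_le (σ := σ) (σ' := σ.moveSource D e s)
    (fun a ha => by
      unfold Cfg.Present at *
      by_cases hae : a = e
      · subst hae; simp [Cfg.moveSource] at ha; linarith
      · simpa [Cfg.moveSource, update_of_ne hae] using ha)
  unfold Cfg.size
  have h3 : (σ.moveSource D e s).r = σ.r := rfl
  rw [h3]
  convert (by omega : (Finset.univ.filter (fun u => σ.r u ≠ 0)).card +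
    (Finset.univ.filter (σ.moveSource D e s).Present).card
    + ∑ u, (n - ((σ.moveSource D e s).trav u).length)
    < (Finset.univ.filter (fun u => σ.r u ≠ 0)).card
    + (Finset.univ.filter σ.Present).card + ∑ u, (n - (σ.trav u).length)) using 1

theorem Cfg.measure_serve {s t : Fin n} {c : ℝ} (hm : σ.Servable D s t)
    (hor : c = σ.r s ∨ c = -σ.r t) : (σ.serve s t c).measure D < σ.measure D := by
  classical
  have hst : s ≠ t := by rintro rfl; linarith [hm.1, hm.2.1]
  refine Cfg.measure_lt_of_size_lt ?_
  have h1 : (Finset.univ.filter (fun u => (σ.serve s t c).r u ≠ 0)).card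
      < (Finset.univ.filter (fun u => σ.r u ≠ 0)).card := by
    apply Finset.card_lt_card
    rw [Finset.ssubset_iff_of_subset]
    · rcases hor with hor | hor
      · refine ⟨s, by simp [hm.1.ne'], ?_⟩
        simp [Cfg.serve_r_source hst, hor]
      · refine ⟨t, by simp [hm.2.1.ne], ?_⟩
        simp [Cfg.serve_r_sink, hor]
    · intro u
      simp only [Finset.mem_filter, Finset.mem_univ, true_and]
      intro hu
      by_cases hus : u = s
      · rw [hus]; exact hm.1.ne'
      · by_cases hut : u = t
        · rw [hut]; exact hm.2.1.ne
        · rwa [Cfg.serve_r_of_ne hus hut] at hu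
  unfold Cfg.size
  have h3 : (σ.serve s t c).trav = σ.trav := rfl
  have h4 : (σ.serve s t c).Present = σ.Present := rfl
  rw [h3, h4]
  convert (by omega : (Finset.univ.filter (fun u => (σ.serve s t c).r u ≠ 0)).card +
    (Finset.univ.filter σ.Present).card
    + ∑ u, (n - (σ.trav u).length) < (Finset.univ.filter (fun u => σ.r u ≠ 0)).card
    + (Finset.univ.filter σ.Present).card + ∑ u, (n - (σ.trav u).length)) using 1

/-- Either an arc disappears and the size drops, or a tight sink appears. In the second case there
was none before, because it would have been movable, so the tightness term falls from `1` to `0`. -/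
theorem Cfg.measure_augment (hq : ∀ e t, ¬ σ.SinkMovable D e t) {x' : Fin m → ℝ}
    (habs : ∀ a, ¬ σ.Present a → x' a = 0)
    (hprog : (∃ a, σ.Present a ∧ x' a = 0) ∨
      ∃ a t, 0 < x' a ∧ σ.r t < 0 ∧ σ.pos t = D.head a ∧ x' a + σ.r t = 0) :
    ({ σ with x := x' } : Cfg n m).measure D < σ.measure D := by
  classical
  set σ' : Cfg n m := { σ with x := x' } with hσ'
  have hp : ∀ a, σ'.Present a → σ.Present a := by
    intro a ha
    by_contra hna
    exact absurd (habs a hna) (ne_of_gt ha)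
  have hsize : σ'.size = (Finset.univ.filter (fun u => σ.r u ≠ 0)).card
    + (Finset.univ.filter σ'.Present).card + ∑ u, (n - (σ.trav u).length) := by
    unfold Cfg.size; congr
  have hsize' : σ.size = (Finset.univ.filter (fun u => σ.r u ≠ 0)).card
    + (Finset.univ.filter σ.Present).card + ∑ u, (n - (σ.trav u).length) := by
    unfold Cfg.size; congr
  rcases hprog with ⟨a, ha, ha'⟩ | ⟨a, t, ha, ht, hpt, h0⟩
  · refine Cfg.measure_lt_of_size_lt ?_
    have : (Finset.univ.filter σ'.Present).card < (Finset.univ.filter σ.Present).card := by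
      apply Finset.card_lt_card
      rw [Finset.ssubset_iff_of_subset]
      · refine ⟨a, by simpa using ha, ?_⟩
        simp [Cfg.Present, hσ', ha']
      · intro e
        simpa using hp e
    omega
  · have h1 : σ'.Tight D := ⟨a, t, ha, ht, hpt, h0⟩
    have h2 : ¬ σ.Tight D := fun ⟨e, t, he, ht, hpt, h0⟩ => hq e t ⟨he, ht, hpt, Or.inl h0⟩
    have h3 := Cfg.card_present_le hp
    unfold Cfg.measure
    rw [if_pos h1, if_neg h2]
    omega

end UT


/-! ### Time-bounded reasoning about programs -/

namespace UT

open Function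

/-! ## A weakest precondition calculus with step bounds -/

/-- A bound for the number of iterations of every loop in the program. -/
noncomputable def iterPoly : Polynomial ℕ := 4 * (Polynomial.X + 1) ^ 2

/-- A bound for the number of steps, if every loop stops within `iterPoly` iterations. -/
noncomputable def Prog.timePoly : Prog → Polynomial ℕ
  | .skip => 1
  | .setNat _ e f => Polynomial.C (e.cost + f.cost + 1)
  | .setReal _ e f => Polynomial.C (e.cost + f.cost + 1)
  | .seq P Q => P.timePoly + Q.timePoly
  | .ite c P Q => Polynomial.C c.cost + P.timePoly + Q.timePoly
  | .loop c P => Polynomial.C c.cost + iterPoly * (Polynomial.C c.cost + P.timePoly)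

/-- Started in `s`, the program halts in time in a memory that satisfies `Q`. -/
def Does (N : ℕ) (P : Prog) (s : State) (Q : State → Prop) : Prop :=
  ∃ T s', Exec P s T s' ∧ T ≤ P.timePoly.eval N ∧ Q s'

theorem Does.mono {N : ℕ} {P : Prog} {s : State} {Q R : State → Prop} (h : Does N P s Q)
    (hQR : ∀ s', Q s' → R s') : Does N P s R := by
  obtain ⟨T, s', h1, h2, h3⟩ := h
  exact ⟨T, s', h1, h2, hQR _ h3⟩

theorem does_skip {N : ℕ} {s : State} {Q : State → Prop} (h : Q s) : Does N .skip s Q :=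
  ⟨1, s, .skip s, by simp [Prog.timePoly], h⟩

theorem does_setNat {N i : ℕ} {e f : NExp} {s : State} {Q : State → Prop}
    (h : Q (s.putNat i (e.eval s) (f.eval s))) : Does N (.setNat i e f) s Q :=
  ⟨_, _, .setNat i e f s, by simp [Prog.timePoly], h⟩

theorem does_setReal {N i : ℕ} {e : NExp} {f : RExp} {s : State} {Q : State → Prop}
    (h : Q (s.putReal i (e.eval s) (f.eval s))) : Does N (.setReal i e f) s Q :=
  ⟨_, _, .setReal i e f s, by simp [Prog.timePoly], h⟩

theorem does_seq {N : ℕ} {P R : Prog} {s : State} {Q : State → Prop}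
    (h : Does N P s (fun s' => Does N R s' Q)) : Does N (.seq P R) s Q := by
  obtain ⟨T, s', h1, h2, U, s'', h3, h4, h5⟩ := h
  refine ⟨T + U, s'', .seq h1 h3, ?_, h5⟩
  simp only [Prog.timePoly, Polynomial.eval_add]
  omega

theorem does_ite {N : ℕ} {c : Test} {P R : Prog} {s : State} {Q : State → Prop}
    (h1 : c.holds s → Does N P s Q) (h2 : ¬ c.holds s → Does N R s Q) :
    Does N (.ite c P R) s Q := by
  by_cases hc : c.holds s
  · obtain ⟨T, s', h3, h4, h5⟩ := h1 hc
    refine ⟨_, s', .iteTrue hc h3, ?_, h5⟩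
    simp only [Prog.timePoly, Polynomial.eval_add, Polynomial.eval_C]
    omega
  · obtain ⟨T, s', h3, h4, h5⟩ := h2 hc
    refine ⟨_, s', .iteFalse hc h3, ?_, h5⟩
    simp only [Prog.timePoly, Polynomial.eval_add, Polynomial.eval_C]
    omega

/-- The index of the invariant `I` is a variant: it falls strictly in each round, so its initial
value bounds the number of rounds. It need not fall by exactly one. -/
theorem does_loop {N : ℕ} {c : Test} {P : Prog} {s : State} {Q : State → Prop}
    (I : ℕ → State → Prop) {k : ℕ} (hk : k ≤ iterPoly.eval N) (hI : I k s)
    (hstep : ∀ k s, I k s → c.holds s → Does N P s (fun s' => ∃ k', k' < k ∧ I k' s'))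
    (hend : ∀ k s, I k s → ¬ c.holds s → Q s) : Does N (.loop c P) s Q := by
  have key : ∀ k s, I k s → ∃ T s', Exec (.loop c P) s T s' ∧
      T ≤ c.cost + k * (c.cost + P.timePoly.eval N) ∧ Q s' := by
    intro k
    induction k using Nat.strong_induction_on with
    | _ k ih =>
      intro s hI
      by_cases hc : c.holds s
      · obtain ⟨T, s', h1, h2, k', hk', h3⟩ := hstep k s hI hc
        obtain ⟨U, s'', h4, h5, h6⟩ := ih k' hk' s' h3
        refine ⟨_, s'', .loopTrue hc h1 h4, ?_, h6⟩
        have h7 : (k' + 1) * (c.cost + P.timePoly.eval N) ≤ k * (c.cost + P.timePoly.eval N) :=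
          Nat.mul_le_mul_right _ hk'
        rw [Nat.succ_mul] at h7
        omega
      · exact ⟨_, s, .loopFalse hc, by omega, hend k s hI hc⟩
  obtain ⟨T, s', h1, h2, h3⟩ := key k s hI
  refine ⟨T, s', h1, h2.trans ?_, h3⟩
  simp only [Prog.timePoly, Polynomial.eval_add, Polynomial.eval_mul, Polynomial.eval_C]
  exact Nat.add_le_add_left (Nat.mul_le_mul_right _ hk) _

/-! ## Memory access -/

@[simp] theorem State.putNat_nat (s : State) (i j v i' j' : ℕ) :
    (s.putNat i j v).nat i' j' = if i' = i ∧ j' = j then v else s.nat i' j' := by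
  unfold State.putNat
  by_cases hi : i' = i
  · subst hi
    by_cases hj : j' = j
    · subst hj; simp
    · simp [hj]
  · simp [hi]

@[simp] theorem State.putNat_real (s : State) (i j v : ℕ) : (s.putNat i j v).real = s.real := rfl

@[simp] theorem State.putReal_real (s : State) (i j : ℕ) (v : ℝ) (i' j' : ℕ) :
    (s.putReal i j v).real i' j' = if i' = i ∧ j' = j then v else s.real i' j' := by
  unfold State.putReal
  by_cases hi : i' = i
  · subst hi
    by_cases hj : j' = j
    · subst hj; simp
    · simp [hj]
  · simp [hi]

@[simp] theorem State.putReal_nat (s : State) (i j : ℕ) (v : ℝ) : (s.putReal i j v).nat = s.nat :=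
  rfl

theorem State.putNat_putNat (s : State) (i j v w : ℕ) :
    (s.putNat i j v).putNat i j w = s.putNat i j w := by
  simp [State.putNat]

theorem State.putNat_comm (s : State) {i i' : ℕ} (h : i ≠ i') (j j' v w : ℕ) :
    (s.putNat i j v).putNat i' j' w = (s.putNat i' j' w).putNat i j v := by
  simp [State.putNat, update_comm h, update_of_ne h, update_of_ne h.symm]

/-- The variable that is stored in entry `0` of the array `k`. -/
def NExp.var (k : ℕ) : NExp := .get k (.const 0)

/-- Disjunction of tests. -/
def Test.or (c d : Test) : Test := .not (.and (.not c) (.not d))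

@[simp] theorem NExp.eval_var (s : State) (k : ℕ) : (NExp.var k).eval s = s.nat k 0 := rfl

@[simp] theorem NExp.eval_const (s : State) (k : ℕ) : (NExp.const k).eval s = k := rfl

@[simp] theorem NExp.eval_get (s : State) (i : ℕ) (e : NExp) :
    (NExp.get i e).eval s = s.nat i (e.eval s) := rfl

@[simp] theorem NExp.eval_add (s : State) (e f : NExp) :
    (NExp.add e f).eval s = e.eval s + f.eval s := rfl

@[simp] theorem NExp.eval_sub (s : State) (e f : NExp) :
    (NExp.sub e f).eval s = e.eval s - f.eval s := rfl

@[simp] theorem RExp.eval_zero (s : State) : RExp.zero.eval s = 0 := rfl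

@[simp] theorem RExp.eval_get (s : State) (i : ℕ) (e : NExp) :
    (RExp.get i e).eval s = s.real i (e.eval s) := rfl

@[simp] theorem RExp.eval_add (s : State) (e f : RExp) :
    (RExp.add e f).eval s = e.eval s + f.eval s := rfl

@[simp] theorem RExp.eval_sub (s : State) (e f : RExp) :
    (RExp.sub e f).eval s = e.eval s - f.eval s := rfl

@[simp] theorem Test.holds_natLt (s : State) (e f : NExp) :
    (Test.natLt e f).holds s ↔ e.eval s < f.eval s := Iff.rfl

@[simp] theorem Test.holds_natEq (s : State) (e f : NExp) :
    (Test.natEq e f).holds s ↔ e.eval s = f.eval s := Iff.rfl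

@[simp] theorem Test.holds_realLt (s : State) (e f : RExp) :
    (Test.realLt e f).holds s ↔ e.eval s < f.eval s := Iff.rfl

@[simp] theorem Test.holds_realEq (s : State) (e f : RExp) :
    (Test.realEq e f).holds s ↔ e.eval s = f.eval s := Iff.rfl

@[simp] theorem Test.holds_not (s : State) (c : Test) : (Test.not c).holds s ↔ ¬ c.holds s :=
  Iff.rfl

@[simp] theorem Test.holds_and (s : State) (c d : Test) :
    (Test.and c d).holds s ↔ c.holds s ∧ d.holds s := Iff.rfl

@[simp] theorem Test.holds_or (s : State) (c d : Test) :
    (Test.or c d).holds s ↔ c.holds s ∨ d.holds s := by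
  simp only [Test.or, Test.holds_not, Test.holds_and]
  tauto

/-! ## Loops over a range and linear search -/

/-- Assign a value to a variable. -/
def Prog.assign (i : ℕ) (e : NExp) : Prog := .setNat i (.const 0) e

theorem does_assign {N i : ℕ} {f : NExp} {s : State} {Q : State → Prop}
    (h : Q (s.putNat i 0 (f.eval s))) : Does N (.assign i f) s Q :=
  does_setNat h

/-- Execute `P` for `i = e, …, f - 1`. -/
def Prog.for (i : ℕ) (e f : NExp) (P : Prog) : Prog :=
  .seq (.assign i e) (.loop (.natLt (.var i) f) (.seq P (.assign i (.add (.var i) (.const 1)))))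

/-- The bound `f` is evaluated anew in every round, so `hf` asks for its value in every memory
satisfying the invariant. `I (j + 1)` refers to the memory after the counter has been increased. -/
theorem does_for {N i : ℕ} {e f : NExp} {P : Prog} {s : State} {Q : State → Prop} (B : ℕ)
    (I : ℕ → State → Prop) (hB : B ≤ iterPoly.eval N) (he : e.eval s ≤ B)
    (hf : ∀ j s, s.nat i 0 = j → I j s → f.eval s = B)
    (hI : I (e.eval s) (s.putNat i 0 (e.eval s)))
    (hstep : ∀ j s, j < B → s.nat i 0 = j → I j s →
      Does N P s (fun s' => s'.nat i 0 = j ∧ I (j + 1) (s'.putNat i 0 (j + 1))))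
    (hend : ∀ s, s.nat i 0 = B → I B s → Q s) : Does N (.for i e f P) s Q := by
  refine does_seq (does_assign ?_)
  refine does_loop (fun k s => ∃ j, j ≤ B ∧ k = B - j ∧ s.nat i 0 = j ∧ I j s)
    (k := B - e.eval s) ((Nat.sub_le _ _).trans hB) ⟨_, he, rfl, by simp, hI⟩ ?_ ?_
  · rintro k s ⟨j, hj, rfl, hi, h⟩ hc
    have hlt : j < B := by simpa [hi, hf j s hi h] using hc
    refine does_seq ((hstep j s hlt hi h).mono ?_)
    rintro s' ⟨hi', h'⟩
    refine does_assign ⟨B - (j + 1), by omega, j + 1, hlt, rfl, ?_, ?_⟩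
    · simp [hi']
    · simpa [hi'] using h'
  · rintro k s ⟨j, hj, rfl, hi, h⟩ hc
    have hlt : ¬ j < B := by simpa [hi, hf j s hi h] using hc
    obtain rfl : j = B := by omega
    exact hend s hi h

/-- Set `i` to the first value below `f` for which `c` holds, and to `f` if there is none. -/
def Prog.search (i : ℕ) (f : NExp) (c : Test) : Prog :=
  .seq (.assign i (.const 0))
    (.loop (.and (.natLt (.var i) f) (.not c)) (.assign i (.add (.var i) (.const 1))))

theorem does_search {N i : ℕ} {f : NExp} {c : Test} {s : State} {Q : State → Prop} (B : ℕ)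
    (hB : B ≤ iterPoly.eval N) (hf : ∀ j, f.eval (s.putNat i 0 j) = B)
    (hfound : ∀ j, j < B → c.holds (s.putNat i 0 j) → Q (s.putNat i 0 j))
    (hnone : (∀ j, j < B → ¬ c.holds (s.putNat i 0 j)) → Q (s.putNat i 0 B)) :
    Does N (.search i f c) s Q := by
  refine does_seq (does_assign ?_)
  refine does_loop (fun k s' => ∃ j, j ≤ B ∧ k = B - j ∧ s' = s.putNat i 0 j ∧
    ∀ j', j' < j → ¬ c.holds (s.putNat i 0 j')) (k := B) hB ⟨0, by simp⟩ ?_ ?_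
  · rintro k s' ⟨j, hj, rfl, rfl, h⟩ hc
    have hc' : j < B ∧ ¬ c.holds (s.putNat i 0 j) := by simpa [hf] using hc
    refine does_assign ⟨B - (j + 1), by omega, j + 1, by omega, rfl, ?_, ?_⟩
    · simp [State.putNat_putNat]
    · intro j' hj'
      rcases Nat.lt_succ_iff_lt_or_eq.1 hj' with h' | rfl
      · exact h j' h'
      · exact hc'.2
  · rintro k s' ⟨j, hj, rfl, rfl, h⟩ hc
    by_cases hlt : j < B
    · refine hfound j hlt ?_
      by_contra hn
      exact hc (by simpa [hf] using ⟨hlt, hn⟩)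
    · obtain rfl : j = B := by omega
      exact hnone h

/-- Search for values of `i` below `f` and `j` below `g` for which `c` holds. If there are none,
set `i` to `f`. -/
def Prog.search₂ (i j : ℕ) (f g : NExp) (c : Test) : Prog :=
  .seq (.assign i (.const 0)) (.seq (.assign j (.const 0))
    (.loop (.and (.natLt (.var i) f) (.not (.and (.natLt (.var j) g) c)))
      (.ite (.natLt (.var j) g) (.assign j (.add (.var j) (.const 1)))
        (.seq (.assign i (.add (.var i) (.const 1))) (.assign j (.const 0))))))

theorem does_search₂ {N i j : ℕ} {f g : NExp} {c : Test} {s : State} {Q : State → Prop}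
    (A B : ℕ) (hij : i ≠ j) (hAB : A * (B + 1) + B ≤ iterPoly.eval N)
    (hf : ∀ p q, f.eval ((s.putNat i 0 p).putNat j 0 q) = A)
    (hg : ∀ p q, g.eval ((s.putNat i 0 p).putNat j 0 q) = B)
    (hfound : ∀ p q, p < A → q < B → c.holds ((s.putNat i 0 p).putNat j 0 q) →
      Q ((s.putNat i 0 p).putNat j 0 q))
    (hnone : (∀ p q, p < A → q < B → ¬ c.holds ((s.putNat i 0 p).putNat j 0 q)) → ∀ q,
      Q ((s.putNat i 0 A).putNat j 0 q)) :
    Does N (.search₂ i j f g c) s Q := by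
  refine does_seq (does_assign (does_seq (does_assign ?_)))
  -- A row takes `B` increments of the inner counter and one reset, hence the weight `B + 1` in the
  -- variant.
  refine does_loop (fun k s' => ∃ p q, p ≤ A ∧ q ≤ B ∧ k = (A - p) * (B + 1) + (B - q) ∧
    s' = (s.putNat i 0 p).putNat j 0 q ∧
    (∀ p' q', p' < p → q' < B → ¬ c.holds ((s.putNat i 0 p').putNat j 0 q')) ∧
    (∀ q', q' < q → ¬ c.holds ((s.putNat i 0 p).putNat j 0 q')))
    (k := A * (B + 1) + B) hAB ⟨0, 0, by simp⟩ ?_ ?_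
  · rintro k s' ⟨p, q, hp, hq, rfl, rfl, h1, h2⟩ hc
    have hc' : p < A ∧ (q < B → ¬ c.holds ((s.putNat i 0 p).putNat j 0 q)) := by
      simpa [hf, hg, hij] using hc
    refine does_ite (fun ht => ?_) (fun ht => ?_)
    · have hlt : q < B := by simpa [hg] using ht
      refine does_assign ⟨_, ?_, p, q + 1, hp, hlt, rfl, ?_, h1, ?_⟩
      · omega
      · simp [State.putNat_putNat]
      · intro q' hq'
        rcases Nat.lt_succ_iff_lt_or_eq.1 hq' with h' | rfl
        · exact h2 q' h'
        · exact hc'.2 hlt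
    · have hlt : ¬ q < B := by simpa [hg] using ht
      obtain rfl : q = B := by omega
      refine does_seq (does_assign (does_assign ⟨_, ?_, p + 1, 0, hc'.1, by omega, rfl, ?_, ?_, ?_⟩))
      · obtain ⟨d, rfl⟩ := Nat.exists_eq_add_of_lt hc'.1
        have e1 : p + d + 1 - p = d + 1 := by omega
        have e2 : p + d + 1 - (p + 1) = d := by omega
        rw [e1, e2]
        ring_nf
        omega
      · rw [State.putNat_comm _ hij.symm, State.putNat_putNat, State.putNat_putNat]
        simp [hij]
      · intro p' q' hp' hq'
        rcases Nat.lt_succ_iff_lt_or_eq.1 hp' with h' | rfl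
        · exact h1 p' q' h' hq'
        · exact h2 q' hq'
      · intro q' hq'; omega
  · rintro k s' ⟨p, q, hp, hq, rfl, rfl, h1, h2⟩ hc
    by_cases hlt : p < A
    · have hc' : q < B ∧ c.holds ((s.putNat i 0 p).putNat j 0 q) := by
        by_contra hn
        refine hc ?_
        simp [hf, hg, hij, hlt]
        tauto
      exact hfound p q hlt hc'.1 hc'.2
    · obtain rfl : p = A := by omega
      exact hnone h1 q

end UT


namespace UT

open Function

variable {n m : ℕ}

/-! ## Representation of configurations in the memory -/

/-- The memory `s` represents the configuration `σ`. The path of the terminal `v` is stored in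
natural array `12` from position `v * n` on. -/
structure Rep (s : State) (D : MultiDigraph (Fin n) (Fin m)) (σ : Cfg n m) : Prop where
  n_eq : s.nat 0 0 = n
  m_eq : s.nat 0 1 = m
  tail : ∀ a : Fin m, s.nat 1 a = D.tail a
  head : ∀ a : Fin m, s.nat 2 a = D.head a
  r : ∀ v : Fin n, s.real 0 v = σ.r v
  x : ∀ a : Fin m, s.real 1 a = σ.x a
  y : ∀ a : Fin m, s.real 2 a = σ.y a
  pos : ∀ v : Fin n, s.nat 9 v = σ.pos v
  base : ∀ v : Fin n, s.nat 10 v = v * n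
  len : ∀ v : Fin n, s.nat 11 v = (σ.trav v).length
  trav : ∀ (v : Fin n) (j : ℕ) (h : j < (σ.trav v).length), s.nat 12 (v * n + j) = (σ.trav v)[j]
  mark : ∀ a : Fin m, s.nat 13 a = 0 ↔ ¬ σ.mark a
  ps_length : s.nat 3 0 = σ.ps.length
  ps_source : ∀ (k : ℕ) (h : k < σ.ps.length), s.nat 4 k = (σ.ps[k].source : ℕ)
  ps_sink : ∀ (k : ℕ) (h : k < σ.ps.length), s.nat 5 k = (σ.ps[k].sink : ℕ)
  ps_arcs_length : ∀ (k : ℕ) (h : k < σ.ps.length), s.nat 6 k = σ.ps[k].arcs.length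
  ps_arcs : ∀ (k : ℕ) (h : k < σ.ps.length) (j : ℕ) (hj : j < σ.ps[k].arcs.length),
    s.nat 8 (s.nat 7 k + j) = (σ.ps[k].arcs[j] : ℕ)
  ps_value : ∀ (k : ℕ) (h : k < σ.ps.length), s.real 3 k = σ.ps[k].value
  ps_end : ∀ (k : ℕ) (h : k < σ.ps.length), s.nat 7 k + σ.ps[k].arcs.length ≤ s.nat 14 0

variable {s : State} {D : MultiDigraph (Fin n) (Fin m)} {σ : Cfg n m}

/-- Natural arrays from `15` on and real arrays from `4` on are scratch space. -/
theorem Rep.congr {s' : State} (h : Rep s D σ) (hn : ∀ i, i < 15 → s'.nat i = s.nat i)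
    (hr : ∀ i, i < 4 → s'.real i = s.real i) : Rep s' D σ := by
  constructor
  · rw [hn 0 (by norm_num)]; exact h.n_eq
  · rw [hn 0 (by norm_num)]; exact h.m_eq
  · rw [hn 1 (by norm_num)]; exact h.tail
  · rw [hn 2 (by norm_num)]; exact h.head
  · rw [hr 0 (by norm_num)]; exact h.r
  · rw [hr 1 (by norm_num)]; exact h.x
  · rw [hr 2 (by norm_num)]; exact h.y
  · rw [hn 9 (by norm_num)]; exact h.pos
  · rw [hn 10 (by norm_num)]; exact h.base
  · rw [hn 11 (by norm_num)]; exact h.len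
  · rw [hn 12 (by norm_num)]; exact h.trav
  · rw [hn 13 (by norm_num)]; exact h.mark
  · rw [hn 3 (by norm_num)]; exact h.ps_length
  · rw [hn 4 (by norm_num)]; exact h.ps_source
  · rw [hn 5 (by norm_num)]; exact h.ps_sink
  · rw [hn 6 (by norm_num)]; exact h.ps_arcs_length
  · rw [hn 7 (by norm_num), hn 8 (by norm_num)]; exact h.ps_arcs
  · rw [hr 3 (by norm_num)]; exact h.ps_value
  · rw [hn 7 (by norm_num), hn 14 (by norm_num)]; exact h.ps_end

theorem State.putNat_nat_of_ne (s : State) {i i' : ℕ} (h : i' ≠ i) (j v : ℕ) :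
    (s.putNat i j v).nat i' = s.nat i' := by
  unfold State.putNat; simp [update_of_ne h]

theorem State.putReal_real_of_ne (s : State) {i i' : ℕ} (h : i' ≠ i) (j : ℕ) (v : ℝ) :
    (s.putReal i j v).real i' = s.real i' := by
  unfold State.putReal; simp [update_of_ne h]

theorem Rep.putNat (h : Rep s D σ) {i : ℕ} (hi : 15 ≤ i) (j v : ℕ) : Rep (s.putNat i j v) D σ :=
  h.congr (fun _ hi' => s.putNat_nat_of_ne (by omega) _ _) (fun _ _ => rfl)

theorem Rep.putReal (h : Rep s D σ) {i : ℕ} (hi : 4 ≤ i) (j : ℕ) (v : ℝ) :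
    Rep (s.putReal i j v) D σ :=
  h.congr (fun _ _ => rfl) (fun _ hi' => s.putReal_real_of_ne (by omega) _ _)

/-! ## Bounds for the number of iterations -/

/-- The right-hand side covers the main loop: the bound of `Cfg.measure_le` plus one round that
finds nothing left to do. -/
theorem le_eval_iterPoly (k n m : ℕ) (h : k ≤ 2 * (n + m + n * n) + 2) :
    k ≤ iterPoly.eval (n + m) := by
  have : iterPoly.eval (n + m) = 4 * (n + m + 1) ^ 2 := by simp [iterPoly]
  rw [this]
  nlinarith

theorem mul_le_eval_iterPoly {A B n m : ℕ} (hA : A ≤ n + m) (hB : B ≤ n + m) :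
    A * (B + 1) + B ≤ iterPoly.eval (n + m) := by
  have : iterPoly.eval (n + m) = 4 * (n + m + 1) ^ 2 := by simp [iterPoly]
  rw [this]
  have : A * (B + 1) ≤ (n + m) * (n + m + 1) := Nat.mul_le_mul hA (by omega)
  nlinarith

/-! ## Subprograms for the steps -/

/-- Number of vertices. -/
def NExp.numV : NExp := .get 0 (.const 0)

/-- Number of arcs. -/
def NExp.numA : NExp := .get 0 (.const 1)

theorem Rep.eval_numV (h : Rep s D σ) : NExp.numV.eval s = n := h.n_eq

theorem Rep.eval_numA (h : Rep s D σ) : NExp.numA.eval s = m := h.m_eq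

/-- The arc `e` carries flow. -/
def Test.present (e : NExp) : Test := .realLt .zero (.get 1 e)

theorem Rep.holds_present (h : Rep s D σ) {e : NExp} {a : Fin m} (ha : e.eval s = a) :
    (Test.present e).holds s ↔ σ.Present a := by
  simp [Test.present, Cfg.Present, ha, h.x]

/-- The arc `e` is incident to the vertex `v`. -/
def Test.inc (e v : NExp) : Test := .or (.natEq (.get 1 e) v) (.natEq (.get 2 e) v)

theorem Rep.holds_inc (h : Rep s D σ) {e v : NExp} {a : Fin m} {w : Fin n} (ha : e.eval s = a)
    (hw : v.eval s = w) : (Test.inc e v).holds s ↔ D.Inc a w := by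
  simp [Test.inc, MultiDigraph.Inc, ha, hw, h.tail, h.head, Fin.ext_iff]

/-- Append the arc `var 21` to the path of the terminal `var 22` and move the terminal to the
vertex `v`. -/
def Prog.relocate (v : NExp) : Prog :=
  .seq (.setNat 12 (.add (.get 10 (.var 22)) (.get 11 (.var 22))) (.var 21))
  (.seq (.setNat 11 (.var 22) (.add (.get 11 (.var 22)) (.const 1)))
    (.setNat 9 (.var 22) v))

def Prog.moveSink : Prog :=
  .seq (.relocate (.get 1 (.var 21)))
  (.seq (.setReal 1 (.var 21) (.add (.get 1 (.var 21)) (.get 0 (.var 22))))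
    (.setReal 2 (.var 21) (.sub (.get 2 (.var 21)) (.get 0 (.var 22)))))

def Prog.moveSource : Prog :=
  .seq (.relocate (.get 2 (.var 21)))
  (.seq (.setReal 1 (.var 21) (.sub (.get 1 (.var 21)) (.get 0 (.var 22))))
    (.setReal 2 (.var 21) (.add (.get 2 (.var 21)) (.get 0 (.var 22)))))

/-- The memory blocks of different terminals are disjoint. -/
theorem mul_add_eq_mul_add_iff {n a b i j : ℕ} (hi : i < n) (hj : j < n) :
    a * n + i = b * n + j ↔ a = b ∧ i = j := by
  constructor
  · intro h
    have h1 : (a * n + i) / n = a := by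
      rw [Nat.mul_comm, Nat.mul_add_div (by omega), Nat.div_eq_of_lt hi, Nat.add_zero]
    have h2 : (b * n + j) / n = b := by
      rw [Nat.mul_comm, Nat.mul_add_div (by omega), Nat.div_eq_of_lt hj, Nat.add_zero]
    have : a = b := by rw [← h1, ← h2, h]
    subst this
    exact ⟨rfl, by omega⟩
  · rintro ⟨rfl, rfl⟩; rfl

/-- The target `v` is evaluated after the path has been extended, so `hv` allows arrays `11` and
`12` to have changed. -/
theorem does_relocate {N : ℕ} {Q : State → Prop} (h : Rep s D σ) {e : Fin m} {u w : Fin n}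
    {v : NExp} (he : s.nat 21 0 = e) (hu : s.nat 22 0 = u)
    (hv : ∀ s', (∀ i, i ≠ 12 → i ≠ 11 → s'.nat i = s.nat i) → v.eval s' = w)
    (hlen : ∀ v, (σ.trav v).length < n)
    (hQ : ∀ s', Rep s' D { σ with pos := update σ.pos u w,
                                  trav := update σ.trav u (σ.trav u ++ [e]) } →
      s'.nat 21 0 = e → s'.nat 22 0 = u → Q s') :
    Does N (.relocate v) s Q := by
  refine does_seq (does_setNat (does_seq (does_setNat (does_setNat ?_))))
  rw [hv _ (fun i h1 h2 => by
    rw [State.putNat_nat_of_ne _ h2, State.putNat_nat_of_ne _ h1])]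
  simp only [NExp.eval_add, NExp.eval_get, NExp.eval_var, NExp.eval_const, State.putNat_nat, he,
    hu, h.base, h.len, Nat.reduceEqDiff, false_and, if_false]
  apply hQ
  · constructor
    · simpa using h.n_eq
    · simpa using h.m_eq
    · simpa using h.tail
    · simpa using h.head
    · simpa using h.r
    · simpa using h.x
    · simpa using h.y
    · intro v
      by_cases hvu : v = u
      · subst hvu; simp
      · have : (v : ℕ) ≠ u := fun h => hvu (Fin.ext h)
        simp [hvu, this, h.pos]
    · simpa using h.base
    · intro v
      by_cases hvu : v = u
      · subst hvu; simp
      · have : (v : ℕ) ≠ u := fun h => hvu (Fin.ext h)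
        simp [hvu, this, h.len]
    · intro v j hj
      by_cases hvu : v = u
      · subst hvu
        simp only [update_self, List.length_append, List.length_singleton] at hj
        simp only [State.putNat_nat, Nat.reduceEqDiff, false_and, if_false, true_and, update_self,
          Nat.add_left_cancel_iff]
        by_cases hjl : j = (σ.trav v).length
        · subst hjl; simp
        · have hj' : j < (σ.trav v).length := by omega
          simp [hjl, h.trav v j hj', List.getElem_append_left hj']
      · have hvu' : (v : ℕ) ≠ u := fun h => hvu (Fin.ext h)
        simp only [update_of_ne hvu] at hj ⊢
        have := hlen v
        have hne : ¬ ((v : ℕ) * n + j = u * n + (σ.trav u).length) := fun heq =>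
          hvu' ((mul_add_eq_mul_add_iff (by omega) (hlen u)).1 heq).1
        simp [hne, h.trav v j hj]
    · simpa using h.mark
    · simpa using h.ps_length
    · simpa using h.ps_source
    · simpa using h.ps_sink
    · simpa using h.ps_arcs_length
    · simpa using h.ps_arcs
    · simpa using h.ps_value
    · simpa using h.ps_end
  · simpa using he
  · simpa using hu

theorem Rep.putReal_x_y {e : Fin m} {c d : ℝ} (h : Rep s D σ) :
    Rep ((s.putReal 1 e c).putReal 2 e d) D { σ with x := update σ.x e c, y := update σ.y e d } := by
  constructor
  · exact h.n_eq
  · exact h.m_eq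
  · exact h.tail
  · exact h.head
  · simpa using h.r
  · intro a
    simp only [State.putReal_real, update_apply, Fin.ext_iff, h.x]
    simp
  · intro a
    simp only [State.putReal_real, update_apply, Fin.ext_iff, h.y]
    simp
  · exact h.pos
  · exact h.base
  · exact h.len
  · exact h.trav
  · exact h.mark
  · exact h.ps_length
  · exact h.ps_source
  · exact h.ps_sink
  · exact h.ps_arcs_length
  · exact h.ps_arcs
  · simpa using h.ps_value
  · exact h.ps_end

theorem does_moveSink {N : ℕ} {Q : State → Prop} (h : Rep s D σ) {e : Fin m} {t : Fin n}
    (he : s.nat 21 0 = e) (ht : s.nat 22 0 = t) (hlen : ∀ v, (σ.trav v).length < n)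
    (hQ : ∀ s', Rep s' D (σ.moveSink D e t) → Q s') : Does N .moveSink s Q := by
  refine does_seq (does_relocate h he ht (w := D.tail e) ?_ hlen ?_)
  · intro s' hs'
    simp [hs' 1, hs' 21, he, h.tail]
  · intro s' h' he' ht'
    refine does_seq (does_setReal (does_setReal (hQ _ ?_)))
    simpa [he', ht', h'.x, h'.y, h'.r, Cfg.moveSink] using h'.putReal_x_y (e := e)
      (c := σ.x e + σ.r t) (d := σ.y e - σ.r t)

theorem does_moveSource {N : ℕ} {Q : State → Prop} (h : Rep s D σ) {e : Fin m} {u : Fin n}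
    (he : s.nat 21 0 = e) (hu : s.nat 22 0 = u) (hlen : ∀ v, (σ.trav v).length < n)
    (hQ : ∀ s', Rep s' D (σ.moveSource D e u) → Q s') : Does N .moveSource s Q := by
  refine does_seq (does_relocate h he hu (w := D.head e) ?_ hlen ?_)
  · intro s' hs'
    simp [hs' 2, hs' 21, he, h.head]
  · intro s' h' he' hu'
    refine does_seq (does_setReal (does_setReal (hQ _ ?_)))
    simpa [he', hu', h'.x, h'.y, h'.r, Cfg.moveSource] using h'.putReal_x_y (e := e)
      (c := σ.x e - σ.r u) (d := σ.y e + σ.r u)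

/-! ## Serving -/

/-- Write the values of `f`, for `var 24 = 0, …, k - 1`, into array `8` from position `e` on. -/
def Prog.copy (e k f : NExp) : Prog :=
  .for 24 (.const 0) k (.setNat 8 (.add e (.var 24)) f)

/-- The copied values may depend on anything but array `8`, which is being written. Cells below `E`
are preserved, so paths recorded earlier survive. -/
theorem does_copy {N : ℕ} {Q : State → Prop} {e k f : NExp} (E K : ℕ) (g : ℕ → ℕ)
    (hK : K ≤ iterPoly.eval N)
    (he : ∀ s', (∀ i, i ≠ 8 → i ≠ 24 → s'.nat i = s.nat i) → e.eval s' = E)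
    (hk : ∀ s', (∀ i, i ≠ 8 → i ≠ 24 → s'.nat i = s.nat i) → k.eval s' = K)
    (hf : ∀ s' j, (∀ i, i ≠ 8 → i ≠ 24 → s'.nat i = s.nat i) → j < K → s'.nat 24 0 = j →
      f.eval s' = g j)
    (hQ : ∀ s', (∀ i, i ≠ 8 → i ≠ 24 → s'.nat i = s.nat i) → s'.real = s.real →
      (∀ p, p < E → s'.nat 8 p = s.nat 8 p) → (∀ j, j < K → s'.nat 8 (E + j) = g j) → Q s') :
    Does N (.copy e k f) s Q := by
  refine does_for K (fun j s' => (∀ i, i ≠ 8 → i ≠ 24 → s'.nat i = s.nat i) ∧ s'.real = s.real ∧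
    (∀ p, p < E → s'.nat 8 p = s.nat 8 p) ∧ (∀ j', j' < j → s'.nat 8 (E + j') = g j')) hK
    (Nat.zero_le _) ?_ ?_ ?_ ?_
  · rintro j s' - ⟨h1, -⟩
    exact hk s' h1
  · refine ⟨fun i _ hi => State.putNat_nat_of_ne _ hi _ _, rfl, by simp, by simp⟩
  · rintro j s' hj hj' ⟨h1, h2, h3, h4⟩
    refine does_setNat ?_
    rw [NExp.eval_add, he s' h1, hf s' j h1 hj hj', NExp.eval_var, hj']
    refine ⟨by simpa using hj', fun i hi hi' => ?_, h2, fun p hp => ?_, fun j' hjj => ?_⟩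
    · rw [State.putNat_nat_of_ne _ hi', State.putNat_nat_of_ne _ hi, h1 i hi hi']
    · have : p ≠ E + j := by omega
      simp [this, h3 p hp]
    · rcases Nat.lt_succ_iff_lt_or_eq.1 hjj with h' | rfl
      · have : j' ≠ j := by omega
        simp [this, h4 j' h']
      · simp
  · rintro s' - ⟨h1, h2, h3, h4⟩
    exact hQ s' h1 h2 h3 h4

/-- Record that the source `var 21` serves the sink `var 22` with the value in real array `11`. -/
def Prog.record : Prog :=
  .seq (.copy (.var 14) (.get 11 (.var 21)) (.get 12 (.add (.get 10 (.var 21)) (.var 24))))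
  (.seq (.copy (.add (.var 14) (.get 11 (.var 21))) (.get 11 (.var 22))
    (.get 12 (.add (.get 10 (.var 22))
      (.sub (.get 11 (.var 22)) (.add (.var 24) (.const 1))))))
  (.seq (.setNat 4 (.var 3) (.var 21))
  (.seq (.setNat 5 (.var 3) (.var 22))
  (.seq (.setNat 6 (.var 3) (.add (.get 11 (.var 21)) (.get 11 (.var 22))))
  (.seq (.setNat 7 (.var 3) (.var 14))
  (.seq (.assign 14 (.add (.var 14) (.add (.get 11 (.var 21)) (.get 11 (.var 22)))))
  (.seq (.setReal 3 (.var 3) (.get 11 (.const 0)))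
  (.seq (.assign 3 (.add (.var 3) (.const 1)))
  (.seq (.setReal 0 (.var 21) (.sub (.get 0 (.var 21)) (.get 11 (.const 0))))
    (.setReal 0 (.var 22) (.add (.get 0 (.var 22)) (.get 11 (.const 0)))))))))))))

theorem does_record {Q : State → Prop} (h : Rep s D σ) {u t : Fin n} {c : ℝ}
    (hu : s.nat 21 0 = u) (ht : s.nat 22 0 = t) (hut : u ≠ t) (hc : s.real 11 0 = c)
    (hlen : ∀ v, (σ.trav v).length < n)
    (hQ : ∀ s', Rep s' D (σ.serve u t c) → Q s') : Does (n + m) .record s Q := by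
  have hlu := hlen u
  have hlt := hlen t
  refine does_seq (does_copy (s.nat 14 0) (σ.trav u).length
    (fun j => s.nat 12 (u * n + j)) (le_eval_iterPoly _ _ _ (by omega)) ?_ ?_ ?_ ?_)
  · intro s' hs'; simp [hs' 14]
  · intro s' hs'; simp [hs' 11, hs' 21, hu, h.len]
  · intro s' j hs' hj hj'; simp [hs' 12, hs' 10, hs' 21, hu, h.base, hj']
  intro s₂ hn₂ hr₂ hlow₂ hnew₂
  refine does_seq (does_copy (s.nat 14 0 + (σ.trav u).length) (σ.trav t).length
    (fun j => s.nat 12 (t * n + ((σ.trav t).length - (j + 1))))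
    (le_eval_iterPoly _ _ _ (by omega)) ?_ ?_ ?_ ?_)
  · intro s' hs'; simp [hs', hn₂, hu, h.len]
  · intro s' hs'; simp [hs', hn₂, ht, h.len]
  · intro s' j hs' hj hj'; simp [hs', hn₂, ht, h.len, h.base, hj']
  intro s₃ hn₃ hr₃ hlow₃ hnew₃
  have hr : s₃.real = s.real := hr₃.trans hr₂
  have hn : ∀ i, i ≠ 8 → i ≠ 24 → s₃.nat i = s.nat i := fun i h1 h2 =>
    (hn₃ i h1 h2).trans (hn₂ i h1 h2)
  have hlow : ∀ p, p < s.nat 14 0 → s₃.nat 8 p = s.nat 8 p := fun p hp =>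
    (hlow₃ p (by omega)).trans (hlow₂ p hp)
  -- The path of the sink was stored in backward order, so its second half is read from the end.
  have hnew : ∀ j (hj : j < (σ.trav u ++ (σ.trav t).reverse).length),
      s₃.nat 8 (s.nat 14 0 + j) = ((σ.trav u ++ (σ.trav t).reverse)[j] : ℕ) := by
    intro j hj
    by_cases hju : j < (σ.trav u).length
    · rw [hlow₃ _ (by omega), hnew₂ j hju, List.getElem_append_left hju, h.trav u j hju]
    · obtain ⟨i, rfl⟩ := Nat.exists_eq_add_of_le (not_lt.1 hju)
      have hi : i < (σ.trav t).length := by simpa using hj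
      rw [← Nat.add_assoc, hnew₃ i hi, h.trav t _ (by omega)]
      simp only [List.getElem_append_right (Nat.le_add_right _ _), Nat.add_sub_cancel_left,
        List.getElem_reverse]
      congr 2
      omega
  clear hn₂ hr₂ hlow₂ hnew₂ hn₃ hr₃ hlow₃ hnew₃
  refine does_seq (does_setNat (does_seq (does_setNat (does_seq (does_setNat (does_seq
    (does_setNat (does_seq (does_assign (does_seq (does_setReal (does_seq (does_assign (does_seq
    (does_setReal (does_setReal ?_))))))))))))))))
  have hut' : (t : ℕ) ≠ u := fun h => hut (Fin.ext h.symm)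
  simp only [NExp.eval_add, NExp.eval_get, NExp.eval_var, NExp.eval_const, State.putNat_nat,
    State.putReal_nat, State.putNat_real, State.putReal_real, RExp.eval_add, RExp.eval_sub,
    RExp.eval_get, Nat.reduceEqDiff, false_and, if_false, OfNat.ofNat_ne_zero,
    hn, hr, hu, ht, h.len, h.ps_length, hc, h.r, ne_eq,
    not_false_eq_true, hut', and_false]
  apply hQ
  have hnth : ∀ k, k < (σ.serve u t c).ps.length → k ≠ σ.ps.length → k < σ.ps.length := by
    intro k hk hne
    simp only [Cfg.serve, List.length_append, List.length_singleton] at hk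
    omega
  constructor
  · simpa [hn] using h.n_eq
  · simpa [hn] using h.m_eq
  · simpa [hn] using h.tail
  · simpa [hn] using h.head
  · intro v
    by_cases hvt : v = t
    · subst hvt; simp [Cfg.serve]
    · have h1 : (v : ℕ) ≠ t := fun h => hvt (Fin.ext h)
      by_cases hvu : v = u
      · subst hvu; simp [Cfg.serve, hvt, h1]
      · have h2 : (v : ℕ) ≠ u := fun h => hvu (Fin.ext h)
        simp [Cfg.serve, hvt, h1, hvu, h2, hr, h.r]
  · simpa [hr, Cfg.serve] using h.x
  · simpa [hr, Cfg.serve] using h.y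
  · simpa [hn, Cfg.serve] using h.pos
  · simpa [hn] using h.base
  · simpa [hn, Cfg.serve] using h.len
  · simpa [hn, Cfg.serve] using h.trav
  · simpa [hn, Cfg.serve] using h.mark
  · simp [Cfg.serve]
  · intro k hk
    by_cases hkl : k = σ.ps.length
    · subst hkl; simp [Cfg.serve]
    · simp [Cfg.serve, hkl, hn, List.getElem_append_left (hnth k hk hkl), h.ps_source k (hnth k hk hkl)]
  · intro k hk
    by_cases hkl : k = σ.ps.length
    · subst hkl; simp [Cfg.serve]
    · simp [Cfg.serve, hkl, hn, List.getElem_append_left (hnth k hk hkl), h.ps_sink k (hnth k hk hkl)]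
  · intro k hk
    by_cases hkl : k = σ.ps.length
    · subst hkl; simp [Cfg.serve]
    · simp [Cfg.serve, hkl, hn, List.getElem_append_left (hnth k hk hkl),
        h.ps_arcs_length k (hnth k hk hkl)]
  · intro k hk j hj
    by_cases hkl : k = σ.ps.length
    · subst hkl
      have hj' : j < (σ.trav u ++ (σ.trav t).reverse).length := by simpa [Cfg.serve] using hj
      simpa [Cfg.serve] using hnew j hj'
    · have hk' := hnth k hk hkl
      have hj' : j < σ.ps[k].arcs.length := by
        simpa [Cfg.serve, List.getElem_append_left hk'] using hj
      -- Older paths end before the first free cell, so the copying has not touched them.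
      have h1 := h.ps_end k hk'
      have h2 := hlow (s.nat 7 k + j) (by omega)
      simp [Cfg.serve, hkl, hn, List.getElem_append_left hk', h2, h.ps_arcs k hk' j hj']
  · intro k hk
    by_cases hkl : k = σ.ps.length
    · subst hkl; simp [Cfg.serve]
    · simp [Cfg.serve, hkl, hr, List.getElem_append_left (hnth k hk hkl), h.ps_value k (hnth k hk hkl)]
  · intro k hk
    by_cases hkl : k = σ.ps.length
    · subst hkl; simp [Cfg.serve]
    · have := h.ps_end k (hnth k hk hkl)
      simp [Cfg.serve, hkl, hn, List.getElem_append_left (hnth k hk hkl)]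
      omega

/-- Let the source `var 21` serve the sink `var 22` as far as possible. -/
def Prog.serve : Prog :=
  .seq (.ite (.realLt .zero (.add (.get 0 (.var 21)) (.get 0 (.var 22))))
    (.setReal 11 (.const 0) (.sub .zero (.get 0 (.var 22))))
    (.setReal 11 (.const 0) (.get 0 (.var 21)))) .record

theorem does_serve {Q : State → Prop} (h : Rep s D σ) {u t : Fin n}
    (hu : s.nat 21 0 = u) (ht : s.nat 22 0 = t) (hut : u ≠ t)
    (hlen : ∀ v, (σ.trav v).length < n)
    (hQ : ∀ s' c, c ≤ σ.r u → c ≤ -σ.r t → (c = σ.r u ∨ c = -σ.r t) →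
      Rep s' D (σ.serve u t c) → Q s') : Does (n + m) .serve s Q := by
  -- The sign of the sum of the two balances decides which one has the smaller absolute value.
  refine does_seq (does_ite (fun hlt => does_setReal ?_) (fun hlt => does_setReal ?_))
  · simp only [Test.holds_realLt, RExp.eval_zero, RExp.eval_add, RExp.eval_get, NExp.eval_var, hu,
      ht, h.r] at hlt
    exact does_record (h.putReal (by norm_num) _ _) hu ht hut (c := -σ.r t) (by simp [ht, h.r]) hlen
      (fun s' hs' => hQ s' _ (by linarith) le_rfl (Or.inr rfl) hs')
  · simp only [Test.holds_realLt, RExp.eval_zero, RExp.eval_add, RExp.eval_get, NExp.eval_var, hu,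
      ht, h.r] at hlt
    exact does_record (h.putReal (by norm_num) _ _) hu ht hut (c := σ.r u) (by simp [hu, h.r]) hlen
      (fun s' hs' => hQ s' _ le_rfl (by linarith) (Or.inl rfl) hs')

end UT


namespace UT

open Function

variable {n m : ℕ} {s : State} {D : MultiDigraph (Fin n) (Fin m)} {σ : Cfg n m}

/-! ## Searching for a step -/

theorem does_search₂_fin {N i j : ℕ} {f g : NExp} {c : Test} {s : State} {Q : State → Prop}
    {A B : ℕ} (R : Fin A → Fin B → Prop) (hij : i ≠ j) (hAB : A * (B + 1) + B ≤ iterPoly.eval N)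
    (hf : ∀ p q, f.eval ((s.putNat i 0 p).putNat j 0 q) = A)
    (hg : ∀ p q, g.eval ((s.putNat i 0 p).putNat j 0 q) = B)
    (hc : ∀ (p : Fin A) (q : Fin B), c.holds ((s.putNat i 0 p).putNat j 0 q) ↔ R p q)
    (hfound : ∀ (p : Fin A) (q : Fin B), R p q → Q ((s.putNat i 0 p).putNat j 0 q))
    (hnone : (∀ p q, ¬ R p q) → ∀ q, Q ((s.putNat i 0 A).putNat j 0 q)) :
    Does N (.search₂ i j f g c) s Q :=
  does_search₂ A B hij hAB hf hg
    (fun p q hp hq h => hfound ⟨p, hp⟩ ⟨q, hq⟩ ((hc ⟨p, hp⟩ ⟨q, hq⟩).1 h))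
    (fun h => hnone (fun p q hR => h p q p.2 q.2 ((hc p q).2 hR)))

theorem Rep.putNat₂ (h : Rep s D σ) {i j : ℕ} (hi : 15 ≤ i) (hj : 15 ≤ j) (p q : ℕ) :
    Rep ((s.putNat i 0 p).putNat j 0 q) D σ := (h.putNat hi 0 p).putNat hj 0 q

/-- The sink `var 22` may be moved over the arc `var 21`. -/
def Test.sinkMovable : Test :=
  .and (.present (.var 21)) (.and (.realLt (.get 0 (.var 22)) .zero)
    (.and (.natEq (.get 9 (.var 22)) (.get 2 (.var 21)))
      (.or (.realEq (.add (.get 1 (.var 21)) (.get 0 (.var 22))) .zero)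
        (.and (.natEq (.get 13 (.var 21)) (.const 0))
          (.realLt .zero (.add (.get 1 (.var 21)) (.get 0 (.var 22))))))))

theorem Rep.holds_sinkMovable (h : Rep s D σ) {e : Fin m} {t : Fin n} (he : s.nat 21 0 = e)
    (ht : s.nat 22 0 = t) : Test.sinkMovable.holds s ↔ σ.SinkMovable D e t := by
  simp [Test.sinkMovable, Cfg.SinkMovable, h.holds_present (e := .var 21) he, he, ht, h.r, h.x,
    h.pos, h.head, h.mark, Fin.ext_iff]

theorem does_searchSink {Q : State → Prop} (h : Rep s D σ)
    (hfound : ∀ e t, σ.SinkMovable D e t → Q ((s.putNat 21 0 e).putNat 22 0 t))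
    (hnone : (∀ e t, ¬ σ.SinkMovable D e t) → ∀ q, Q ((s.putNat 21 0 m).putNat 22 0 q)) :
    Does (n + m) (.search₂ 21 22 .numA .numV .sinkMovable) s Q :=
  does_search₂_fin (σ.SinkMovable D) (by norm_num)
    (mul_le_eval_iterPoly (by omega) (by omega))
    (fun p q => (h.putNat₂ (by norm_num) (by norm_num) p q).eval_numA)
    (fun p q => (h.putNat₂ (by norm_num) (by norm_num) p q).eval_numV)
    (fun p q => (h.putNat₂ (by norm_num) (by norm_num) p q).holds_sinkMovable (by simp) (by simp))
    hfound hnone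

/-- Two arcs `var 21` and `var 22` with flow at the vertex `var 23`. -/
def Test.twoArcs : Test :=
  .and (.present (.var 21)) (.and (.inc (.var 21) (.var 23))
    (.and (.present (.var 22)) (.and (.inc (.var 22) (.var 23))
      (.not (.natEq (.var 21) (.var 22))))))

/-- Set array `15` to `1` at the vertices with at most one arc with flow, and to `0` elsewhere. -/
def Prog.leaves : Prog :=
  .for 23 (.const 0) .numV
    (.seq (.search₂ 21 22 .numA .numA .twoArcs)
      (.ite (.natLt (.var 21) .numA) (.setNat 15 (.var 23) (.const 0))
        (.setNat 15 (.var 23) (.const 1))))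

theorem does_leaves {Q : State → Prop} (h : Rep s D σ)
    (hQ : ∀ s', Rep s' D σ → (∀ v : Fin n, s'.nat 15 v = 1 ↔ σ.Leaf D v) → Q s') :
    Does (n + m) .leaves s Q := by
  refine does_for n (fun j s' => Rep s' D σ ∧
    ∀ v : Fin n, (v : ℕ) < j → (s'.nat 15 v = 1 ↔ σ.Leaf D v))
    (le_eval_iterPoly _ _ _ (by omega)) (Nat.zero_le _) ?_ ?_ ?_ ?_
  · rintro j s' - ⟨h', -⟩; exact h'.eval_numV
  · exact ⟨h.putNat (by norm_num) _ _, by simp⟩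
  · rintro j s' hj hj' ⟨h', hl⟩
    have hr := fun p q => h'.putNat₂ (i := 21) (j := 22) (by norm_num) (by norm_num) p q
    refine does_seq (does_search₂_fin
      (fun p q => σ.Present p ∧ D.Inc p ⟨j, hj⟩ ∧ σ.Present q ∧ D.Inc q ⟨j, hj⟩ ∧ p ≠ q)
      (by norm_num) (mul_le_eval_iterPoly (by omega) (by omega))
      (fun p q => (hr p q).eval_numA) (fun p q => (hr p q).eval_numA) ?_ ?_ ?_)
    · intro p q
      simp [Test.twoArcs, (hr p q).holds_present (e := .var 21) (a := p) (by simp),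
        (hr p q).holds_present (e := .var 22) (a := q) (by simp),
        (hr p q).holds_inc (e := .var 21) (v := .var 23) (a := p) (w := ⟨j, hj⟩) (by simp)
          (by simpa using hj'),
        (hr p q).holds_inc (e := .var 22) (v := .var 23) (a := q) (w := ⟨j, hj⟩) (by simp)
          (by simpa using hj'), Fin.ext_iff]
    · rintro p q ⟨h1, h2, h3, h4, h5⟩
      refine does_ite (fun _ => does_setNat ?_) (fun hc => absurd ?_ hc)
      · refine ⟨by simpa using hj',
          ((hr p q).putNat (by norm_num) _ _).putNat (by norm_num) _ _, fun v hv => ?_⟩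
        rcases Nat.lt_succ_iff_lt_or_eq.1 hv with hv' | hv'
        · simp [hj', hv'.ne, hl v hv']
        · have : v = ⟨j, hj⟩ := Fin.ext hv'
          subst this
          simp only [NExp.eval_var, NExp.eval_const, State.putNat_nat, hj']
          simp only [Nat.reduceEqDiff, false_and, if_false, and_self, if_true, zero_ne_one,
            false_iff]
          exact fun hleaf => h5 (hleaf p q h1 h3 h2 h4)
      · rw [Test.holds_natLt, (hr p q).eval_numA]; simp
    · intro hno q
      refine does_ite (fun hc => absurd hc ?_) (fun _ => does_setNat ?_)
      · rw [Test.holds_natLt, (hr m q).eval_numA]; simp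
      · refine ⟨by simpa using hj',
          ((hr m q).putNat (by norm_num) _ _).putNat (by norm_num) _ _, fun v hv => ?_⟩
        rcases Nat.lt_succ_iff_lt_or_eq.1 hv with hv' | hv'
        · simp [hj', hv'.ne, hl v hv']
        · have : v = ⟨j, hj⟩ := Fin.ext hv'
          subst this
          simp only [NExp.eval_var, NExp.eval_const, State.putNat_nat, hj']
          simp only [Nat.reduceEqDiff, false_and, if_false, and_self, if_true, true_iff]
          intro a a' ha ha' hi hi'
          by_contra hne
          exact hno a a' ⟨ha, hi, ha', hi', hne⟩
  · rintro s' - ⟨h', hl⟩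
    exact hQ s' h' (fun v => hl v v.2)

/-- The source `var 21` and the sink `var 22` are at the same vertex, which is a leaf. -/
def Test.servable : Test :=
  .and (.realLt .zero (.get 0 (.var 21))) (.and (.realLt (.get 0 (.var 22)) .zero)
    (.and (.natEq (.get 9 (.var 21)) (.get 9 (.var 22)))
      (.natEq (.get 15 (.get 9 (.var 22))) (.const 1))))

theorem does_searchServable {Q : State → Prop} (h : Rep s D σ)
    (hl : ∀ v : Fin n, s.nat 15 v = 1 ↔ σ.Leaf D v)
    (hfound : ∀ u t, σ.Servable D u t → Q ((s.putNat 21 0 u).putNat 22 0 t))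
    (hnone : (∀ u t, ¬ σ.Servable D u t) → ∀ q, Q ((s.putNat 21 0 n).putNat 22 0 q)) :
    Does (n + m) (.search₂ 21 22 .numV .numV .servable) s Q :=
  does_search₂_fin (σ.Servable D) (by norm_num)
    (mul_le_eval_iterPoly (by omega) (by omega))
    (fun p q => (h.putNat₂ (by norm_num) (by norm_num) p q).eval_numV)
    (fun p q => (h.putNat₂ (by norm_num) (by norm_num) p q).eval_numV)
    (fun p q => by
      simp [Test.servable, Cfg.Servable, h.r, h.pos, hl, Fin.ext_iff])
    hfound hnone

/-- The source `var 22` may be moved over the arc `var 21`. -/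
def Test.sourceMovable : Test :=
  .and (.present (.var 21)) (.and (.natEq (.get 15 (.get 1 (.var 21))) (.const 1))
    (.and (.realLt .zero (.get 0 (.var 22))) (.natEq (.get 9 (.var 22)) (.get 1 (.var 21)))))

theorem does_searchSource {Q : State → Prop} (h : Rep s D σ)
    (hl : ∀ v : Fin n, s.nat 15 v = 1 ↔ σ.Leaf D v)
    (hfound : ∀ e u, σ.SourceMovable D e u → Q ((s.putNat 21 0 e).putNat 22 0 u))
    (hnone : (∀ e u, ¬ σ.SourceMovable D e u) → ∀ q, Q ((s.putNat 21 0 m).putNat 22 0 q)) :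
    Does (n + m) (.search₂ 21 22 .numA .numV .sourceMovable) s Q :=
  does_search₂_fin (σ.SourceMovable D) (by norm_num)
    (mul_le_eval_iterPoly (by omega) (by omega))
    (fun p q => (h.putNat₂ (by norm_num) (by norm_num) p q).eval_numA)
    (fun p q => (h.putNat₂ (by norm_num) (by norm_num) p q).eval_numV)
    (fun p q => by
      simp [Test.sourceMovable, Cfg.SourceMovable, Test.present, Cfg.Present, h.r, h.x, h.pos, h.tail,
        hl, Fin.ext_iff])
    hfound hnone

/-- Replace `var 22` by the sink of smallest demand at the same vertex. -/
def Prog.minSink : Prog :=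
  .for 23 (.const 0) .numV
    (.ite (.and (.realLt (.get 0 (.var 23)) .zero)
        (.and (.natEq (.get 9 (.var 23)) (.get 9 (.var 22)))
          (.realLt (.get 0 (.var 22)) (.get 0 (.var 23)))))
      (.assign 22 (.var 23)) .skip)

/-- Smallest demand means largest `r`. The sink may be exchanged for another one, but only at the
same vertex, so the pair stays servable. -/
theorem does_minSink {Q : State → Prop} (h : Rep s D σ) {u t : Fin n} (hu : s.nat 21 0 = u)
    (ht : s.nat 22 0 = t) (hr : σ.r t < 0)
    (hQ : ∀ (s' : State) (t' : Fin n), Rep s' D σ → s'.nat 21 0 = u → s'.nat 22 0 = t' → σ.r t' < 0 →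
      σ.pos t' = σ.pos t → (∀ w, σ.r w < 0 → σ.pos w = σ.pos t' → σ.r w ≤ σ.r t') → Q s') :
    Does (n + m) .minSink s Q := by
  refine does_for n (fun j s' => Rep s' D σ ∧ s'.nat 21 0 = u ∧ ∃ t' : Fin n, s'.nat 22 0 = t' ∧
    σ.r t' < 0 ∧ σ.pos t' = σ.pos t ∧
    ∀ w : Fin n, (w : ℕ) < j → σ.r w < 0 → σ.pos w = σ.pos t' → σ.r w ≤ σ.r t')
    (le_eval_iterPoly _ _ _ (by omega)) (Nat.zero_le _) ?_ ?_ ?_ ?_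
  · rintro j s' - ⟨h', -⟩; exact h'.eval_numV
  · exact ⟨h.putNat (by norm_num) _ _, by simpa using hu, t, by simpa using ht, hr, rfl, by simp⟩
  · rintro j s' hj hj' ⟨h', hu', t', ht', hr', hp', hmin⟩
    have hcond : (Test.and (.realLt (.get 0 (.var 23)) .zero)
        (.and (.natEq (.get 9 (.var 23)) (.get 9 (.var 22)))
          (.realLt (.get 0 (.var 22)) (.get 0 (.var 23))))).holds s' ↔
        σ.r ⟨j, hj⟩ < 0 ∧ σ.pos ⟨j, hj⟩ = σ.pos t' ∧ σ.r t' < σ.r ⟨j, hj⟩ := by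
      have e1 := h'.r ⟨j, hj⟩
      have e2 := h'.pos ⟨j, hj⟩
      simp only at e1 e2
      simp [hj', ht', e1, e2, h'.r, h'.pos, Fin.ext_iff]
    refine does_ite (fun hc => does_assign ?_) (fun hc => does_skip ?_)
    · obtain ⟨h1, h2, h3⟩ := hcond.1 hc
      refine ⟨by simpa using hj', (h'.putNat (by norm_num) _ _).putNat (by norm_num) _ _,
        by simpa using hu', ⟨j, hj⟩, by simpa using hj', h1, h2.trans hp', fun w hw hrw hpw => ?_⟩
      rcases Nat.lt_succ_iff_lt_or_eq.1 hw with hw' | hw'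
      · exact (hmin w hw' hrw (hpw.trans h2)).trans h3.le
      · rw [show w = ⟨j, hj⟩ from Fin.ext hw']
    · refine ⟨hj', h'.putNat (by norm_num) _ _, by simpa using hu', t', by simpa using ht', hr', hp',
        fun w hw hrw hpw => ?_⟩
      rcases Nat.lt_succ_iff_lt_or_eq.1 hw with hw' | hw'
      · exact hmin w hw' hrw hpw
      · obtain rfl : w = ⟨j, hj⟩ := Fin.ext hw'
        exact not_lt.1 (fun hlt => hc (hcond.2 ⟨hrw, hpw, hlt⟩))
  · rintro s' - ⟨h', hu', t', ht', hr', hp', hmin⟩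
    exact hQ s' t' h' hu' ht' hr' hp' (fun w => hmin w w.2)

end UT


namespace UT

open Function

variable {n m : ℕ} {s : State} {D : MultiDigraph (Fin n) (Fin m)} {σ : Cfg n m}
  {b : Fin n → ℝ} {x₀ : Fin m → ℝ} {Δ : ℝ} {ρ : Fin n → ℕ}

/-! ## Alternating walks -/

/-- A walk that traverses the arc `W j` from the vertex `c j` to the vertex `c (j + 1)` for
`j < k`, forward if `F j` and backward otherwise; the arcs that are traversed backward are
marked. -/
structure Cfg.Trail (σ : Cfg n m) (D : MultiDigraph (Fin n) (Fin m)) (k : ℕ) (W : ℕ → Fin m)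
    (F : ℕ → Prop) (c : ℕ → Fin n) : Prop where
  present : ∀ j, j < k → σ.Present (W j)
  fwd : ∀ j, j < k → F j → D.tail (W j) = c j ∧ D.head (W j) = c (j + 1)
  bwd : ∀ j, j < k → ¬ F j → D.head (W j) = c j ∧ D.tail (W j) = c (j + 1) ∧ σ.mark (W j)
  ne : ∀ j, j + 1 < k → W (j + 1) ≠ W j
  inj : ∀ i j, i < k → j < k → c i = c j → i = j

/-- The arc `g` can be traversed next from `v`, forward if `f` and backward otherwise. -/
structure Cfg.Next (σ : Cfg n m) (D : MultiDigraph (Fin n) (Fin m)) (v : Fin n) (g : Fin m)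
    (f : Prop) : Prop where
  present : σ.Present g
  fwd : f → D.tail g = v
  bwd : ¬ f → D.head g = v
  out_unique : ¬ f → ∀ e e', σ.Present e → σ.Present e' → D.tail e = v → D.tail e' = v → e = e'
  out_mark : ¬ f → ∀ e, σ.Present e → D.tail e = v → σ.mark e

theorem Cfg.Trail.le_card {k : ℕ} {W : ℕ → Fin m} {F : ℕ → Prop} {c : ℕ → Fin n}
    (h : σ.Trail D k W F c) : k ≤ n := by
  have := Fintype.card_le_of_injective (fun i : Fin k => c i)
    (fun i j hij => Fin.ext (h.inj i j i.2 j.2 hij))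
  simpa using this

/-- Distinctness in a trail concerns only the first `k` vertices, so that the last one may close a
cycle; `hnew` says that this has not happened yet. `M` lets the marks grow with the step. -/
theorem Cfg.Trail.push {k : ℕ} {W : ℕ → Fin m} {F : ℕ → Prop} {c : ℕ → Fin n}
    (h : σ.Trail D k W F c) (hnew : ∀ j, j < k → c j ≠ c k) {g : Fin m} {f : Prop}
    (hg : σ.Next D (c k) g f) (hne : ∀ j, j + 1 = k → g ≠ W j)
    {M : Fin m → Prop} (hM : ∀ e, σ.mark e → M e) (hMg : ¬ f → M g) {w : Fin n}
    (hwf : f → D.head g = w) (hwb : ¬ f → D.tail g = w) :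
    ({ σ with mark := M } : Cfg n m).Trail D (k + 1) (update W k g) (update F k f)
      (update c (k + 1) w) := by
  have hc : ∀ j, j < k + 1 → update c (k + 1) w j = c j := fun j hj => update_of_ne (by omega) _ _
  have hcs : ∀ j, j < k → update c (k + 1) w (j + 1) = c (j + 1) := fun j hj => hc _ (by omega)
  refine ⟨fun j hj => ?_, fun j hj hf => ?_, fun j hj hf => ?_, fun j hj => ?_, fun i j hi hj => ?_⟩
  · by_cases hjk : j = k
    · subst hjk; rw [update_self]; exact hg.present
    · rw [update_of_ne hjk]; exact h.present j (by omega)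
  · rw [hc j hj]
    by_cases hjk : j = k
    · subst hjk
      rw [update_self] at *
      exact ⟨hg.fwd hf, by rw [update_self]; exact hwf hf⟩
    · rw [update_of_ne hjk] at hf ⊢
      rw [hcs j (by omega)]
      exact h.fwd j (by omega) hf
  · rw [hc j hj]
    by_cases hjk : j = k
    · subst hjk
      rw [update_self] at *
      exact ⟨hg.bwd hf, by rw [update_self]; exact hwb hf, hMg hf⟩
    · rw [update_of_ne hjk] at hf ⊢
      rw [hcs j (by omega)]
      obtain ⟨h1, h2, h3⟩ := h.bwd j (by omega) hf
      exact ⟨h1, h2, hM _ h3⟩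
  · rw [update_of_ne (show j ≠ k by omega)]
    by_cases hjk : j + 1 = k
    · rw [hjk, update_self]; exact hne j hjk
    · rw [update_of_ne hjk]; exact h.ne j (by omega)
  · rw [hc i hi, hc j hj]
    intro hij
    rcases Nat.lt_succ_iff_lt_or_eq.1 hi with hi' | rfl
    · rcases Nat.lt_succ_iff_lt_or_eq.1 hj with hj' | rfl
      · exact h.inj i j hi' hj' hij
      · exact absurd hij (hnew i hi')
    · rcases Nat.lt_succ_iff_lt_or_eq.1 hj with hj' | rfl
      · exact absurd hij.symm (hnew j hj')
      · rfl

theorem Cfg.next_forward {v : Fin n} {g' : Fin m} (hp : σ.Present g') (ht : D.tail g' = v) :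
    σ.Next D v g' True :=
  ⟨hp, fun _ => ht, fun h => absurd trivial h, fun h => absurd trivial h,
    fun h => absurd trivial h⟩

/-- The walk turns backward at `v` only if no arc other than the previous one, `g`, leaves `v`. If
`g` entered `v` forward, it does not leave `v` either; otherwise it was traversed backward and is
marked. These are the hypotheses for marking the next arc. -/
theorem Cfg.next_backward (hρ : D.IsRank ρ) {v : Fin n} {g g' : Fin m}
    (hno : ∀ e, σ.Present e → D.tail e = v → e = g) (hg : D.head g = v ∨ σ.mark g)
    (hp : σ.Present g') (ht : D.head g' = v) : σ.Next D v g' False := by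
  refine ⟨hp, False.elim, fun _ => ht, fun _ e e' he he' hte hte' => ?_, fun _ e he hte => ?_⟩
  · rw [hno e he hte, hno e' he' hte']
  · obtain rfl := hno e he hte
    exact hg.resolve_left (fun h => hρ.tail_ne_head e (hte.trans h.symm))

/-- If the arcs agree, then `c j` is an end of `W i`, so `j = i + 1` by distinctness of the
vertices; but consecutive arcs differ. -/
theorem Cfg.Trail.arc_injective {k : ℕ} {W : ℕ → Fin m} {F : ℕ → Prop} {c : ℕ → Fin n}
    (h : σ.Trail D k W F c) {i j : ℕ} (hij : i < j) (hj : j < k) : W i ≠ W j := by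
  intro heq
  have hends : c j = c i ∨ c j = c (i + 1) := by
    by_cases hfi : F i
    · obtain ⟨h1, h2⟩ := h.fwd i (by omega) hfi
      by_cases hfj : F j
      · left; rw [← (h.fwd j hj hfj).1, ← heq, h1]
      · right; rw [← (h.bwd j hj hfj).1, ← heq, h2]
    · obtain ⟨h1, h2, -⟩ := h.bwd i (by omega) hfi
      by_cases hfj : F j
      · right; rw [← (h.fwd j hj hfj).1, ← heq, h2]
      · left; rw [← (h.bwd j hj hfj).1, ← heq, h1]
  rcases hends with h1 | h1
  · have := h.inj j i hj (by omega) h1; omega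
  · have := h.inj j (i + 1) hj (by omega) h1
    subst this
    exact h.ne i hj heq.symm

/-- Backward steps lower the rank, so a closed walk cannot consist of them alone. This keeps the
amount of augmentation finite. -/
theorem Cfg.Trail.exists_forward (hρ : D.IsRank ρ) {k : ℕ} {W : ℕ → Fin m} {F : ℕ → Prop}
    {c : ℕ → Fin n} (h : σ.Trail D k W F c) {i : ℕ} (hi : i < k) (hc : c i = c k) :
    ∃ j, i ≤ j ∧ j < k ∧ F j := by
  by_contra hno
  push Not at hno
  have key : ∀ d, i + d ≤ k → ρ (c (i + d)) + d ≤ ρ (c i) := by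
    intro d
    induction d with
    | zero => intro _; simp
    | succ d ih =>
      intro hd
      have h1 := ih (by omega)
      obtain ⟨h2, h3, -⟩ := h.bwd (i + d) (by omega) (hno _ (by omega) (by omega))
      have h4 := hρ (W (i + d))
      rw [h2, h3] at h4
      rw [show i + (d + 1) = i + d + 1 from rfl]
      omega
  have := key (k - i) (by omega)
  rw [show i + (k - i) = k by omega, ← hc] at this
  omega

/-- The values that bound the amount of augmentation on step `j` of the walk. -/
def Cfg.Limit (σ : Cfg n m) (D : MultiDigraph (Fin n) (Fin m)) (W : ℕ → Fin m) (F : ℕ → Prop)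
    (j : ℕ) (z : ℝ) : Prop :=
  (F j ∧ z = σ.x (W j)) ∨ (¬ F j ∧ ∃ t, σ.r t < 0 ∧ σ.pos t = D.head (W j) ∧
    σ.x (W j) + σ.r t < 0 ∧ z = -σ.r t - σ.x (W j))

/-- The flow `x'` arises by augmenting along the steps `i, …, j - 1` of the walk by `ε`. -/
structure Cfg.Pushed (σ : Cfg n m) (D : MultiDigraph (Fin n) (Fin m)) (W : ℕ → Fin m)
    (F : ℕ → Prop) (c : ℕ → Fin n) (ε : ℝ) (i j : ℕ) (x' : Fin m → ℝ) : Prop where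
  excess : ∀ v, D.excess x' v = D.excess σ.x v
    + ((if c j = v then ε else 0) - (if c i = v then ε else 0))
  fwd : ∀ l, i ≤ l → l < j → F l → x' (W l) = σ.x (W l) - ε
  bwd : ∀ l, i ≤ l → l < j → ¬ F l → x' (W l) = σ.x (W l) + ε
  off : ∀ a, (∀ l, i ≤ l → l < j → W l ≠ a) → x' a = σ.x a

theorem Cfg.Pushed.step {k : ℕ} {W : ℕ → Fin m} {F : ℕ → Prop} {c : ℕ → Fin n}
    (h : σ.Trail D k W F c) {ε : ℝ} {i j : ℕ} {x' : Fin m → ℝ} (hp : σ.Pushed D W F c ε i j x')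
    (hij : i ≤ j) (hj : j < k) {z : ℝ} (hzf : F j → z = x' (W j) - ε)
    (hzb : ¬ F j → z = x' (W j) + ε) :
    σ.Pushed D W F c ε i (j + 1) (update x' (W j) z) := by
  -- No arc occurs twice on the walk, so `W j` still has its original flow.
  have hx : x' (W j) = σ.x (W j) := hp.off _ (fun l _ hl => h.arc_injective hl hj)
  refine ⟨fun v => ?_, fun l hl hlj hf => ?_, fun l hl hlj hf => ?_, fun a ha => ?_⟩
  · rw [D.excess_update, hp.excess v]
    by_cases hf : F j
    · obtain ⟨h1, h2⟩ := h.fwd j hj hf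
      rw [hzf hf, h1, h2]
      split_ifs <;> ring
    · obtain ⟨h1, h2, -⟩ := h.bwd j hj hf
      rw [hzb hf, h1, h2]
      split_ifs <;> ring
  · rcases Nat.lt_succ_iff_lt_or_eq.1 hlj with hl' | rfl
    · rw [update_of_ne (h.arc_injective hl' hj)]; exact hp.fwd l hl hl' hf
    · rw [update_self, hzf hf, hx]
  · rcases Nat.lt_succ_iff_lt_or_eq.1 hlj with hl' | rfl
    · rw [update_of_ne (h.arc_injective hl' hj)]; exact hp.bwd l hl hl' hf
    · rw [update_self, hzb hf, hx]
  · by_cases haj : a = W j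
    · subst haj
      exact absurd rfl (ha j hij (by omega))
    · rw [update_of_ne haj]
      exact hp.off a (fun l hl hlj => ha l hl (by omega))

/-- Minimality of `ε` keeps forward arcs nonnegative and stops backward arcs at the next larger
demand. Attainment gives progress: a forward arc is emptied or a sink becomes tight. -/
theorem Cfg.Pushed.augment (h : σ.Inv D b x₀ Δ) (hΔ : 0 < Δ)
    (hq : ∀ e t, ¬ σ.SinkMovable D e t) (hleaf : ∀ e, σ.Present e → ¬ σ.Leaf D (D.tail e))
    {k : ℕ} {W : ℕ → Fin m} {F : ℕ → Prop} {c : ℕ → Fin n}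
    (ht : σ.Trail D k W F c) {ε : ℝ} {i : ℕ} {x' : Fin m → ℝ} (hp : σ.Pushed D W F c ε i k x')
    (hc : c i = c k) (hε : 0 < ε) (hlim : ∃ j, i ≤ j ∧ j < k ∧ σ.Limit D W F j ε)
    (hmin : ∀ j z, i ≤ j → j < k → σ.Limit D W F j z → ε ≤ z) :
    ({ σ with x := x' } : Cfg n m).Inv D b x₀ Δ ∧
      ({ σ with x := x' } : Cfg n m).measure D < σ.measure D := by
  have hon : ∀ a, x' a ≠ σ.x a → ∃ l, i ≤ l ∧ l < k ∧ W l = a := by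
    intro a ha
    by_contra hno
    push Not at hno
    exact ha (hp.off a hno)
  have habs : ∀ a, ¬ σ.Present a → x' a = 0 := by
    intro a ha
    rw [← h.flow.x_eq_zero ha]
    by_contra hne
    obtain ⟨l, -, hl, rfl⟩ := hon a hne
    exact ha (ht.present l hl)
  have hinc : ∀ a, σ.x a < x' a → ∃ l, i ≤ l ∧ l < k ∧ W l = a ∧ ¬ F l := by
    intro a ha
    obtain ⟨l, h1, h2, rfl⟩ := hon a ha.ne'
    refine ⟨l, h1, h2, rfl, fun hf => ?_⟩
    rw [hp.fwd l h1 h2 hf] at ha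
    linarith
  refine ⟨h.augment hΔ hq (fun v => ?_) (fun a => ?_) habs (fun a ha => ?_),
    Cfg.measure_augment hq habs ?_⟩
  · rw [hp.excess v, hc, sub_self, add_zero]
  · by_cases hxa : x' a = σ.x a
    · rw [hxa]; exact h.flow.nonneg a
    · obtain ⟨l, h1, h2, rfl⟩ := hon a hxa
      by_cases hf : F l
      · rw [hp.fwd l h1 h2 hf]
        have := hmin l _ h1 h2 (Or.inl ⟨hf, rfl⟩)
        linarith
      · rw [hp.bwd l h1 h2 hf]
        have := h.flow.nonneg (W l)
        linarith
  · obtain ⟨l, h1, h2, rfl, hf⟩ := hinc a ha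
    refine ⟨(ht.bwd l h2 hf).2.2, hleaf _ (ht.present l h2), fun t htr htp hlt => ?_⟩
    have := hmin l _ h1 h2 (Or.inr ⟨hf, t, htr, htp, by linarith, rfl⟩)
    rw [hp.bwd l h1 h2 hf]
    linarith
  · obtain ⟨l, h1, h2, hlim⟩ := hlim
    rcases hlim with ⟨hf, hz⟩ | ⟨hf, t, htr, htp, -, hz⟩
    · left
      refine ⟨W l, ht.present l h2, ?_⟩
      rw [hp.fwd l h1 h2 hf, hz, sub_self]
    · right
      have hpos : 0 < σ.x (W l) := ht.present l h2
      refine ⟨W l, t, ?_, htr, htp, ?_⟩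
      · rw [hp.bwd l h1 h2 hf]; linarith
      · rw [hp.bwd l h1 h2 hf, hz]; ring

end UT


/-! ### Implementation of the search for a cycle -/

namespace UT

open Function

variable {n m : ℕ} {s : State} {D : MultiDigraph (Fin n) (Fin m)} {σ : Cfg n m}
  {b : Fin n → ℝ} {x₀ : Fin m → ℝ} {Δ : ℝ} {ρ : Fin n → ℕ}

/-! ## The walk program -/

/-- The memory contains a walk of length `var 26`: the arcs in array `17`, the directions in array
`18` (`0` for forward), the last vertex in `var 23`. Entry `v` of array `16` is `j + 1` if `v` is
vertex `j` of the walk. -/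
structure TrailRep (s : State) (k : ℕ) (W : ℕ → Fin m) (F : ℕ → Prop) (c : ℕ → Fin n) : Prop where
  length : s.nat 26 0 = k
  arc : ∀ j, j < k → s.nat 17 j = W j
  dir : ∀ j, j < k → (s.nat 18 j = 0 ↔ F j)
  seen : ∀ j, j < k → s.nat 16 (c j) = j + 1
  unseen : ∀ v, (∀ j, j < k → c j ≠ v) → s.nat 16 v = 0
  last : s.nat 23 0 = c k

theorem TrailRep.congr {s' : State} {k : ℕ} {W : ℕ → Fin m} {F : ℕ → Prop} {c : ℕ → Fin n}
    (h : TrailRep s k W F c) (h16 : s'.nat 16 = s.nat 16) (h17 : s'.nat 17 = s.nat 17)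
    (h18 : s'.nat 18 = s.nat 18) (h23 : s'.nat 23 = s.nat 23) (h26 : s'.nat 26 = s.nat 26) :
    TrailRep s' k W F c :=
  ⟨by rw [h26]; exact h.length, by rw [h17]; exact h.arc, by rw [h18]; exact h.dir,
    by rw [h16]; exact h.seen, by rw [h16]; exact h.unseen, by rw [h23]; exact h.last⟩

/-- Choose an arc other than `var 24` at the vertex `var 23`: an outgoing arc, if possible. -/
def Prog.chooseNext : Prog :=
  .seq (.search 21 .numA (.and (.present (.var 21)) (.and (.natEq (.get 1 (.var 21)) (.var 23))
      (.not (.natEq (.var 21) (.var 24))))))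
    (.ite (.natLt (.var 21) .numA) (.seq (.assign 24 (.var 21)) (.assign 25 (.const 0)))
      (.seq (.search 21 .numA (.and (.present (.var 21))
          (.and (.natEq (.get 2 (.var 21)) (.var 23)) (.not (.natEq (.var 21) (.var 24))))))
        (.seq (.assign 24 (.var 21)) (.assign 25 (.const 1)))))

theorem does_chooseNext (hρ : D.IsRank ρ) {Q : State → Prop} (h : Rep s D σ) {v : Fin n}
    {g : Fin m} (hv : s.nat 23 0 = v) (hg : s.nat 24 0 = g) (hmark : D.head g = v ∨ σ.mark g)
    (hleaf : ¬ σ.Leaf D v)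
    (hQ : ∀ (s' : State) (g' : Fin m) (f : Prop), Rep s' D σ →
      (∀ i, i ≠ 21 → i ≠ 24 → i ≠ 25 → s'.nat i = s.nat i) → σ.Next D v g' f → g' ≠ g →
      s'.nat 24 0 = g' → (s'.nat 25 0 = 0 ↔ f) → Q s') :
    Does (n + m) .chooseNext s Q := by
  have hm : m ≤ iterPoly.eval (n + m) := le_eval_iterPoly _ _ _ (by omega)
  have hr := fun p => h.putNat (i := 21) (by norm_num) 0 p
  refine does_seq (does_search m hm (fun p => (hr p).eval_numA) (fun p hp hc => ?_) (fun hno => ?_))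
  · have hc' : σ.Present ⟨p, hp⟩ ∧ D.tail ⟨p, hp⟩ = v ∧ (⟨p, hp⟩ : Fin m) ≠ g := by
      have e1 := h.x ⟨p, hp⟩
      have e2 := h.tail ⟨p, hp⟩
      simp only at e1 e2
      simpa [Test.present, Cfg.Present, e1, e2, hv, hg, Fin.ext_iff] using hc
    refine does_ite (fun _ => ?_) (fun hn => absurd ?_ hn)
    · refine does_seq (does_assign (does_assign ?_))
      refine hQ _ ⟨p, hp⟩ True ?_ ?_ (Cfg.next_forward hc'.1 hc'.2.1) hc'.2.2 (by simp) (by simp)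
      · exact ((hr p).putNat (by norm_num) _ _).putNat (by norm_num) _ _
      · intro i h1 h2 h3
        rw [State.putNat_nat_of_ne _ h3, State.putNat_nat_of_ne _ h2, State.putNat_nat_of_ne _ h1]
    · rw [Test.holds_natLt, (hr p).eval_numA]; simpa using hp
  · have hno' : ∀ e, σ.Present e → D.tail e = v → e = g := by
      intro e he hte
      by_contra hne
      refine hno e e.2 ?_
      simp only [Test.present, Test.holds_and, Test.holds_realLt, Test.holds_natEq, Test.holds_not,
        RExp.eval_zero, RExp.eval_get, NExp.eval_get, NExp.eval_var, State.putNat_real]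
      simp only [State.putNat_nat, Nat.reduceEqDiff, false_and, if_false, and_self, if_true, h.x,
        h.tail, hv, hg, hte, true_and]
      exact ⟨he, fun h => hne (Fin.ext h)⟩
    refine does_ite (fun hn => absurd hn ?_) (fun _ => ?_)
    · rw [Test.holds_natLt, (hr m).eval_numA]; simp
    have hr' := fun p => (hr m).putNat (i := 21) (by norm_num) 0 p
    simp only [State.putNat_putNat] at hr'
    refine does_seq (does_search m hm (fun p => ?_) (fun p hp hc => ?_) (fun hno₂ => ?_))
    · rw [State.putNat_putNat]; exact (hr' p).eval_numA
    · rw [State.putNat_putNat] at hc ⊢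
      have hc' : σ.Present ⟨p, hp⟩ ∧ D.head ⟨p, hp⟩ = v ∧ (⟨p, hp⟩ : Fin m) ≠ g := by
        have e1 := h.x ⟨p, hp⟩
        have e2 := h.head ⟨p, hp⟩
        simp only at e1 e2
        simpa [Test.present, Cfg.Present, e1, e2, hv, hg, Fin.ext_iff] using hc
      refine does_seq (does_assign (does_assign ?_))
      refine hQ _ ⟨p, hp⟩ False ?_ ?_ (Cfg.next_backward hρ hno' hmark hc'.1 hc'.2.1) hc'.2.2
        (by simp) (by simp)
      · exact ((hr p).putNat (by norm_num) _ _).putNat (by norm_num) _ _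
      · intro i h1 h2 h3
        rw [State.putNat_nat_of_ne _ h3, State.putNat_nat_of_ne _ h2, State.putNat_nat_of_ne _ h1]
    -- The second search cannot fail: as `v` is not a leaf, an arc other than `g` is present there,
    -- and since it does not leave `v`, it enters.
    · exfalso
      obtain ⟨e, he, hi, hne⟩ := Cfg.exists_other_arc hleaf g
      have hhe : D.head e = v := hi.resolve_left (fun hte => hne (hno' e he hte))
      refine hno₂ e e.2 ?_
      rw [State.putNat_putNat]
      simp only [Test.present, Test.holds_and, Test.holds_realLt, Test.holds_natEq, Test.holds_not,
        RExp.eval_zero, RExp.eval_get, NExp.eval_get, NExp.eval_var, State.putNat_real]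
      simp only [State.putNat_nat, Nat.reduceEqDiff, false_and, if_false, and_self, if_true, h.x,
        h.head, hv, hg, hhe, true_and]
      exact ⟨he, fun h => hne (Fin.ext h)⟩

theorem Rep.setMark (h : Rep s D σ) (g : Fin m) : Rep (s.putNat 13 g 1) D (σ.setMark g) := by
  constructor
  · simpa [Cfg.setMark] using h.n_eq
  · simpa [Cfg.setMark] using h.m_eq
  · simpa [Cfg.setMark] using h.tail
  · simpa [Cfg.setMark] using h.head
  · exact h.r
  · exact h.x
  · exact h.y
  · simpa [Cfg.setMark] using h.pos
  · simpa [Cfg.setMark] using h.base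
  · simpa [Cfg.setMark] using h.len
  · simpa [Cfg.setMark] using h.trav
  · intro a
    by_cases ha : a = g
    · subst ha; simp [Cfg.setMark]
    · have : (a : ℕ) ≠ g := fun h => ha (Fin.ext h)
      simp [Cfg.setMark, ha, this, h.mark]
  · simpa [Cfg.setMark] using h.ps_length
  · simpa [Cfg.setMark] using h.ps_source
  · simpa [Cfg.setMark] using h.ps_sink
  · simpa [Cfg.setMark] using h.ps_arcs_length
  · simpa [Cfg.setMark] using h.ps_arcs
  · exact h.ps_value
  · simpa [Cfg.setMark] using h.ps_end

/-- Append the arc `var 24` to the walk. -/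
def Prog.pushArc : Prog :=
  .seq (.setNat 17 (.var 26) (.var 24))
  (.seq (.setNat 18 (.var 26) (.var 25))
  (.seq (.setNat 16 (.var 23) (.add (.var 26) (.const 1)))
  (.seq (.assign 26 (.add (.var 26) (.const 1)))
    (.ite (.natEq (.var 25) (.const 0)) (.assign 23 (.get 2 (.var 24)))
      (.seq (.assign 23 (.get 1 (.var 24))) (.setNat 13 (.var 24) (.const 1)))))))

theorem TrailRep.push {k : ℕ} {W : ℕ → Fin m} {F : ℕ → Prop} {c : ℕ → Fin n}
    (h : TrailRep s k W F c) (ht : σ.Trail D k W F c) (hnew : ∀ j, j < k → c j ≠ c k) {g : Fin m}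
    {f : Prop} {w : Fin n} {z : ℕ} (hz : z = 0 ↔ f) :
    TrailRep (((((s.putNat 17 k g).putNat 18 k z).putNat 16 (c k) (k + 1)).putNat 26 0
      (k + 1)).putNat 23 0 w) (k + 1) (update W k g) (update F k f) (update c (k + 1) w) := by
  have hc : ∀ j, j < k + 1 → update c (k + 1) w j = c j := fun j hj => update_of_ne (by omega) _ _
  refine ⟨by simp, fun j hj => ?_, fun j hj => ?_, fun j hj => ?_, fun v hv => ?_, by simp⟩
  · by_cases hjk : j = k
    · subst hjk; simp
    · simp [hjk, h.arc j (by omega)]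
  · by_cases hjk : j = k
    · subst hjk; simp [hz]
    · simp [hjk, h.dir j (by omega)]
  · rw [hc j hj]
    by_cases hjk : j = k
    · subst hjk; simp
    · have hjk' : j < k := by omega
      have : (c j : ℕ) ≠ c k := fun h => hnew j hjk' (Fin.ext h)
      simp [this, h.seen j hjk']
  · have hv' : ∀ j, j < k + 1 → c j ≠ v := fun j hj => by rw [← hc j hj]; exact hv j hj
    have : (v : ℕ) ≠ c k := fun h => hv' k (by omega) (Fin.ext h.symm)
    simp [this, h.unseen v (fun j hj => hv' j (by omega))]

/-- Marks are set during the walk, so the current configuration is `σ` with changing marks `M`. A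
backward step is a legal marking by the conditions in `Cfg.Next`. -/
theorem does_pushArc {N : ℕ} {Q : State → Prop} (h : Rep s D σ) (hI : σ.Inv D b x₀ Δ)
    (hq : ∀ e t, ¬ σ.SinkMovable D e t) {k : ℕ} {W : ℕ → Fin m} {F : ℕ → Prop} {c : ℕ → Fin n}
    (ht : σ.Trail D k W F c) (hr : TrailRep s k W F c) (hnew : ∀ j, j < k → c j ≠ c k) {g : Fin m}
    {f : Prop} (hg : σ.Next D (c k) g f) (hne : ∀ j, j + 1 = k → g ≠ W j)
    (hs : s.nat 24 0 = g) (hf : s.nat 25 0 = 0 ↔ f)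
    (hQ : ∀ (s' : State) (M : Fin m → Prop) (w : Fin n), Rep s' D { σ with mark := M } →
      ({ σ with mark := M } : Cfg n m).Inv D b x₀ Δ →
      (∀ e t, ¬ ({ σ with mark := M } : Cfg n m).SinkMovable D e t) →
      ({ σ with mark := M } : Cfg n m).Trail D (k + 1) (update W k g) (update F k f)
        (update c (k + 1) w) →
      TrailRep s' (k + 1) (update W k g) (update F k f) (update c (k + 1) w) →
      s'.nat 24 0 = g → s'.nat 23 0 = w → (D.head g = w ∨ M g) → D.Inc g w → Q s') :
    Does N .pushArc s Q := by
  have key := fun w : Fin n => hr.push ht hnew (g := g) (f := f) (w := w) hf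
  have hrep : ∀ w : ℕ, Rep (((((s.putNat 17 k g).putNat 18 k (s.nat 25 0)).putNat 16 (c k)
      (k + 1)).putNat 26 0 (k + 1)).putNat 23 0 w) D σ := fun w =>
    ((((h.putNat (by norm_num) _ _).putNat (by norm_num) _ _).putNat (by norm_num) _ _).putNat
      (by norm_num) _ _).putNat (by norm_num) _ _
  refine does_seq (does_setNat (does_seq (does_setNat (does_seq (does_setNat (does_seq
    (does_assign ?_)))))))
  simp only [NExp.eval_add, NExp.eval_var, NExp.eval_const, State.putNat_nat, Nat.reduceEqDiff,
    false_and, if_false, hr.length, hr.last, hs]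
  refine does_ite (fun hc => does_assign ?_) (fun hc => does_seq (does_assign (does_setNat ?_)))
  · have hf' : f := hf.1 (by simpa using hc)
    have e1 : ∀ s' : State, s'.nat 24 0 = g → s'.nat 2 = s.nat 2 →
        (NExp.get 2 (.var 24)).eval s' = D.head g := fun s' h1 h2 => by
      simp [h1, h2, h.head]
    rw [e1 _ (by simpa using hs) (by simp only [State.putNat_nat_of_ne, ne_eq, Nat.reduceEqDiff,
      not_false_eq_true])]
    exact hQ _ σ.mark (D.head g) (hrep _) hI hq
      (ht.push hnew hg hne (fun _ => id) (fun h => absurd hf' h) (fun _ => rfl)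
        (fun h => absurd hf' h)) (key _) (by simpa using hs) (by simp) (Or.inl rfl) (Or.inr rfl)
  · have hf' : ¬ f := fun hf' => hc (by simpa using hf.2 hf')
    have e1 : ∀ s' : State, s'.nat 24 0 = g → s'.nat 1 = s.nat 1 →
        (NExp.get 1 (.var 24)).eval s' = D.tail g := fun s' h1 h2 => by
      simp [h1, h2, h.tail]
    rw [e1 _ (by simpa using hs) (by simp only [State.putNat_nat_of_ne, ne_eq, Nat.reduceEqDiff,
      not_false_eq_true])]
    have e2 : ∀ s' : State, s'.nat 24 0 = g → (NExp.var 24).eval s' = g := fun s' h => h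
    rw [e2 _ (by simpa using hs), NExp.eval_const]
    have hbw := hg.bwd hf'
    refine hQ _ (σ.setMark g).mark (D.tail g) ((hrep _).setMark g)
      (hI.setMark hq hg.present (by rw [hbw]; exact hg.out_unique hf')
        (by rw [hbw]; exact hg.out_mark hf'))
      (Cfg.not_sinkMovable_setMark hq g)
      (ht.push (M := (σ.setMark g).mark) hnew hg hne (fun _ => Or.inr) (fun _ => Or.inl rfl)
        (fun h => absurd h hf') (fun _ => rfl)) ((key _).congr ?_ ?_ ?_ ?_ ?_) ?_ ?_ (Or.inr (Or.inl rfl)) (Or.inl rfl)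
    all_goals first
      | exact State.putNat_nat_of_ne _ (by norm_num) _ _
      | simp [hs]

/-- Starting with the arc `var 21`, walk along arcs with flow until a vertex is repeated. -/
def Prog.walk : Prog :=
  .seq (.for 27 (.const 0) .numV (.setNat 16 (.var 27) (.const 0)))
  (.seq (.assign 26 (.const 0))
  (.seq (.assign 24 (.var 21))
  (.seq (.assign 25 (.const 0))
  (.seq (.assign 23 (.get 1 (.var 21)))
    (.loop (.natEq (.get 16 (.var 23)) (.const 0)) (.seq .pushArc .chooseNext))))))

theorem does_walk (hρ : D.IsRank ρ) {Q : State → Prop} (h : Rep s D σ) (hI : σ.Inv D b x₀ Δ)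
    (hq : ∀ e t, ¬ σ.SinkMovable D e t) (hleaf : ∀ e v, σ.Present e → D.Inc e v → ¬ σ.Leaf D v)
    {e₀ : Fin m} (he : s.nat 21 0 = e₀) (hp : σ.Present e₀)
    (hQ : ∀ (s' : State) (M : Fin m → Prop) (k : ℕ) (W : ℕ → Fin m) (F : ℕ → Prop) (c : ℕ → Fin n)
      (i : ℕ), Rep s' D { σ with mark := M } →
      ({ σ with mark := M } : Cfg n m).Inv D b x₀ Δ →
      (∀ e t, ¬ ({ σ with mark := M } : Cfg n m).SinkMovable D e t) →
      ({ σ with mark := M } : Cfg n m).Trail D k W F c → TrailRep s' k W F c → i < k →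
      c i = c k → s'.nat 16 (s'.nat 23 0) = i + 1 → Q s') :
    Does (n + m) .walk s Q := by
  refine does_seq (does_for n (fun j s' => Rep s' D σ ∧ s'.nat 21 0 = e₀ ∧
    ∀ v, v < j → s'.nat 16 v = 0) (le_eval_iterPoly _ _ _ (by omega)) (Nat.zero_le _) ?_ ?_ ?_ ?_)
  · rintro j s' - ⟨h', -⟩; exact h'.eval_numV
  · exact ⟨h.putNat (by norm_num) _ _, by simpa using he, by simp⟩
  · rintro j s' hj hj' ⟨h', he', hz⟩
    refine does_setNat ⟨by simpa using hj', (h'.putNat (by norm_num) _ _).putNat (by norm_num) _ _,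
      by simpa using he', fun v hv => ?_⟩
    rcases Nat.lt_succ_iff_lt_or_eq.1 hv with hv' | rfl
    · simp [hj', hv'.ne, hz v hv']
    · simp [hj']
  rintro s₁ - ⟨h₁, he₁, hz⟩
  refine does_seq (does_assign (does_seq (does_assign (does_seq (does_assign (does_seq
    (does_assign ?_)))))))
  -- The next arc `g` is chosen before the loop test, so it belongs to the invariant. A trail has at
  -- most `n` arcs, so the variant `n + 1 - k` is positive. Marks affect neither presence nor
  -- leaves, so `hleaf` stays applicable.
  refine does_loop (fun K s' => ∃ M k W F c g f, Rep s' D { σ with mark := M } ∧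
      ({ σ with mark := M } : Cfg n m).Inv D b x₀ Δ ∧
      (∀ e t, ¬ ({ σ with mark := M } : Cfg n m).SinkMovable D e t) ∧
      ({ σ with mark := M } : Cfg n m).Trail D k W F c ∧ TrailRep s' k W F c ∧
      ({ σ with mark := M } : Cfg n m).Next D (c k) g f ∧ (∀ j, j + 1 = k → g ≠ W j) ∧
      s'.nat 24 0 = g ∧ (s'.nat 25 0 = 0 ↔ f) ∧ K = n + 1 - k) (k := n + 1)
    (le_eval_iterPoly _ _ _ (by omega)) ?_ ?_ ?_
  · refine ⟨σ.mark, 0, fun _ => e₀, fun _ => True, fun _ => D.tail e₀, e₀, True, ?_, hI, hq,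
      ⟨by simp, by simp, by simp, by simp, by simp⟩, ⟨by simp, by simp, by simp, by simp, ?_, ?_⟩,
      Cfg.next_forward hp rfl, by simp, ?_, ?_, rfl⟩
    · exact (((h₁.putNat (by norm_num) _ _).putNat (by norm_num) _ _).putNat (by norm_num) _
        _).putNat (by norm_num) _ _
    · intro v _; simpa using hz v v.2
    · simp [he₁, h₁.tail]
    · simp [he₁]
    · simp
  · rintro K s' ⟨M, k, W, F, c, g, f, h', hI', hq', ht, hr, hg, hne, hs, hf, rfl⟩ hc
    have hnew : ∀ j, j < k → c j ≠ c k := by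
      intro j hj heq
      have h1 := hr.seen j hj
      rw [heq, ← hr.last] at h1
      have h2 : s'.nat 16 (s'.nat 23 0) = 0 := hc
      omega
    refine does_seq (does_pushArc h' hI' hq' ht hr hnew hg hne hs hf ?_)
    intro s₂ M₂ w h₂ hI₂ hq₂ ht₂ hr₂ hs₂ hw₂ hm₂ hinc
    refine does_chooseNext hρ h₂ hw₂ hs₂ hm₂ (hleaf g w hg.present hinc) ?_
    intro s₃ g' f' h₃ hn₃ hg₃ hne₃ hs₃ hf₃
    refine ⟨n + 1 - (k + 1), ?_, M₂, k + 1, update W k g, update F k f, update c (k + 1) w, g', f',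
      h₃, hI₂, hq₂, ht₂, hr₂.congr ?_ ?_ ?_ ?_ ?_, ?_, ?_, hs₃, hf₃, rfl⟩
    · have := ht.le_card; omega
    · exact hn₃ _ (by norm_num) (by norm_num) (by norm_num)
    · exact hn₃ _ (by norm_num) (by norm_num) (by norm_num)
    · exact hn₃ _ (by norm_num) (by norm_num) (by norm_num)
    · exact hn₃ _ (by norm_num) (by norm_num) (by norm_num)
    · exact hn₃ _ (by norm_num) (by norm_num) (by norm_num)
    · rw [update_self]; exact hg₃
    · intro j hj
      obtain rfl : j = k := by omega
      rw [update_self]; exact hne₃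
  · rintro K s' ⟨M, k, W, F, c, g, f, h', hI', hq', ht, hr, -, -, -, -, -⟩ hc
    -- Positions are stored increased by one, so a nonzero entry means that the vertex was visited,
    -- even as vertex `0` of the walk.
    have hc' : s'.nat 16 (c k) ≠ 0 := by rw [← hr.last]; exact hc
    obtain ⟨i, hi, hik⟩ : ∃ i, i < k ∧ c i = c k := by
      by_contra hno
      push Not at hno
      exact hc' (hr.unseen _ hno)
    refine hQ s' M k W F c i h' hI' hq' ht hr hi hik ?_
    rw [hr.last, ← hik, hr.seen i hi]

end UT


namespace UT

open Function

variable {n m : ℕ} {s : State} {D : MultiDigraph (Fin n) (Fin m)} {σ : Cfg n m}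
  {b : Fin n → ℝ} {x₀ : Fin m → ℝ} {Δ : ℝ} {ρ : Fin n → ℕ}

/-! ## The augmentation program -/

/-- `ε` is the minimum of the set `S` of positive numbers, or `0` if `S` is empty. -/
def MinOf (ε : ℝ) (S : ℝ → Prop) : Prop :=
  (ε = 0 ∧ ∀ z, ¬ S z) ∨ (0 < ε ∧ S ε ∧ ∀ z, S z → ε ≤ z)

/-- Replace the number in real array `10` by its minimum with `z`; there, `0` stands for
infinity. -/
def Prog.limit (z : RExp) : Prog :=
  .ite (.or (.realEq (.get 10 (.const 0)) .zero) (.realLt z (.get 10 (.const 0))))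
    (.setReal 10 (.const 0) z) .skip

/-- Positivity of `z₀` is essential, because `0` encodes the minimum of the empty set. -/
theorem does_limit {N : ℕ} {Q : State → Prop} {z : RExp} {S S' : ℝ → Prop} (z₀ : ℝ)
    (hS : MinOf (s.real 10 0) S) (hz : z.eval s = z₀) (hpos : 0 < z₀)
    (hS' : ∀ y, S' y ↔ S y ∨ y = z₀)
    (hQ : ∀ s', s'.nat = s.nat → (∀ i, i ≠ 10 → s'.real i = s.real i) →
      MinOf (s'.real 10 0) S' → Q s') : Does N (.limit z) s Q := by
  refine does_ite (fun hc => does_setReal ?_) (fun hc => does_skip ?_)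
  · refine hQ _ rfl (fun i hi => State.putReal_real_of_ne _ hi _ _) ?_
    have hc' : s.real 10 0 = 0 ∨ z₀ < s.real 10 0 := by simpa [hz] using hc
    right
    simp only [State.putReal_real, NExp.eval_const, and_self, if_true, hz]
    refine ⟨hpos, (hS' _).2 (Or.inr rfl), fun y hy => ?_⟩
    rcases (hS' y).1 hy with hy | rfl
    · rcases hS with ⟨-, h1⟩ | ⟨h1, -, h2⟩
      · exact absurd hy (h1 y)
      · rcases hc' with h0 | h0
        · linarith
        · exact h0.le.trans (h2 y hy)
    · exact le_rfl
  · refine hQ _ rfl (fun _ _ => rfl) ?_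
    have hc' : s.real 10 0 ≠ 0 ∧ s.real 10 0 ≤ z₀ := by simpa [hz, not_or] using hc
    rcases hS with ⟨h1, -⟩ | ⟨h1, h2, h3⟩
    · exact absurd h1 hc'.1
    · right
      refine ⟨h1, (hS' _).2 (Or.inl h2), fun y hy => ?_⟩
      rcases (hS' y).1 hy with hy | rfl
      · exact h3 y hy
      · exact hc'.2

theorem MinOf.congr {ε : ℝ} {S S' : ℝ → Prop} (h : MinOf ε S) (hS : ∀ z, S z ↔ S' z) :
    MinOf ε S' := by
  have : S = S' := funext (fun z => propext (hS z))
  rwa [← this]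

/-- Put the amount of augmentation along the cycle into real array `10`. -/
def Prog.amount : Prog :=
  .seq (.setReal 10 (.const 0) .zero)
  (.for 27 (.var 28) (.var 26)
    (.ite (.natEq (.get 18 (.var 27)) (.const 0)) (.limit (.get 1 (.get 17 (.var 27))))
      (.for 22 (.const 0) .numV
        (.ite (.and (.realLt (.get 0 (.var 22)) .zero)
            (.and (.natEq (.get 9 (.var 22)) (.get 2 (.get 17 (.var 27))))
              (.realLt (.add (.get 1 (.get 17 (.var 27))) (.get 0 (.var 22))) .zero)))
          (.limit (.sub (.sub .zero (.get 0 (.var 22))) (.get 1 (.get 17 (.var 27)))))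
          .skip))))

/-- The part of the memory that the augmentation does not change before it is carried out. -/
structure CycleRep (s : State) (D : MultiDigraph (Fin n) (Fin m)) (σ : Cfg n m) (k : ℕ)
    (W : ℕ → Fin m) (F : ℕ → Prop) (c : ℕ → Fin n) (i : ℕ) : Prop where
  rep : Rep s D σ
  trail : TrailRep s k W F c
  start : s.nat 28 0 = i

theorem CycleRep.congr {s' : State} {k : ℕ} {W : ℕ → Fin m} {F : ℕ → Prop} {c : ℕ → Fin n} {i : ℕ}
    (h : CycleRep s D σ k W F c i) (hn : ∀ l, l ≠ 22 → l ≠ 27 → s'.nat l = s.nat l)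
    (hr : ∀ l, l ≠ 10 → s'.real l = s.real l) : CycleRep s' D σ k W F c i :=
  ⟨h.rep.congr (fun l _ => hn l (by omega) (by omega)) (fun l _ => hr l (by omega)),
    h.trail.congr (hn _ (by norm_num) (by norm_num)) (hn _ (by norm_num) (by norm_num))
      (hn _ (by norm_num) (by norm_num)) (hn _ (by norm_num) (by norm_num))
      (hn _ (by norm_num) (by norm_num)),
    by rw [hn 28 (by norm_num) (by norm_num)]; exact h.start⟩

theorem CycleRep.putNat {k : ℕ} {W : ℕ → Fin m} {F : ℕ → Prop} {c : ℕ → Fin n} {i : ℕ}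
    (h : CycleRep s D σ k W F c i) {l : ℕ} (hl : l = 22 ∨ l = 27) (j v : ℕ) :
    CycleRep (s.putNat l j v) D σ k W F c i :=
  h.congr (fun l' h1 h2 => State.putNat_nat_of_ne _ (by omega) _ _) (fun _ _ => rfl)

theorem does_amount {Q : State → Prop} {k : ℕ} {W : ℕ → Fin m} {F : ℕ → Prop} {c : ℕ → Fin n}
    {i : ℕ} (h : CycleRep s D σ k W F c i) (ht : σ.Trail D k W F c) (hik : i < k)
    (hQ : ∀ s', CycleRep s' D σ k W F c i →
      MinOf (s'.real 10 0) (fun z => ∃ l, i ≤ l ∧ l < k ∧ σ.Limit D W F l z) → Q s') :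
    Does (n + m) .amount s Q := by
  have hkn := ht.le_card
  refine does_seq (does_setReal ?_)
  refine does_for k (fun j s' => i ≤ j ∧ CycleRep s' D σ k W F c i ∧
    MinOf (s'.real 10 0) (fun z => ∃ l, i ≤ l ∧ l < j ∧ σ.Limit D W F l z))
    (le_eval_iterPoly _ _ _ (by omega)) ?_ ?_ ?_ ?_ ?_
  · simpa [h.start] using hik.le
  · rintro j s' - ⟨-, h', -⟩; exact h'.trail.length
  · refine ⟨by simp [h.start], h.congr (fun l _ h2 => ?_) (fun l hl => ?_), ?_⟩
    · exact State.putNat_nat_of_ne _ h2 _ _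
    · exact State.putReal_real_of_ne _ hl _ _
    · left
      refine ⟨by simp, ?_⟩
      rintro z ⟨l, h1, h2, -⟩
      have h3 : l < i := by simpa [h.start] using h2
      omega
  · rintro j s' hj hj' ⟨hij, h', hmin⟩
    have hW : ∀ s'' : State, s''.nat 27 0 = j → CycleRep s'' D σ k W F c i →
        (NExp.get 17 (.var 27)).eval s'' = W j := fun s'' h1 h2 => by
      simp [h1, h2.trail.arc j hj]
    refine does_ite (fun hc => ?_) (fun hc => ?_)
    · have hf : F j := (h'.trail.dir j hj).1 (by simpa [hj'] using hc)
      refine does_limit (σ.x (W j)) hmin ?_ (ht.present j hj) (S' := fun z => ∃ l, i ≤ l ∧ l < j + 1 ∧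
        σ.Limit D W F l z) ?_ ?_
      · rw [RExp.eval_get, hW s' hj' h', h'.rep.x]
      · intro y
        constructor
        · rintro ⟨l, h1, h2, h3⟩
          rcases Nat.lt_succ_iff_lt_or_eq.1 h2 with h4 | rfl
          · exact Or.inl ⟨l, h1, h4, h3⟩
          · rcases h3 with ⟨-, h3⟩ | ⟨h3, -⟩
            · exact Or.inr h3
            · exact absurd hf h3
        · rintro (⟨l, h1, h2, h3⟩ | rfl)
          · exact ⟨l, h1, by omega, h3⟩
          · exact ⟨j, hij, by omega, Or.inl ⟨hf, rfl⟩⟩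
      · intro s'' hn hr hmin'
        exact ⟨by rw [hn]; exact hj', by omega, (h'.congr (fun l _ _ => by rw [hn]) hr).putNat (Or.inr rfl) _ _,
          hmin'⟩
    · have hf : ¬ F j := fun hf => hc (by simpa [hj'] using (h'.trail.dir j hj).2 hf)
      -- The set being minimized consists of the limits from earlier steps and, for step `j`, those
      -- from the sinks below `q`.
      refine does_for n (fun q s'' => s''.nat 27 0 = j ∧ CycleRep s'' D σ k W F c i ∧
        MinOf (s''.real 10 0) (fun z => (∃ l, i ≤ l ∧ l < j ∧ σ.Limit D W F l z) ∨
          ∃ t : Fin n, (t : ℕ) < q ∧ σ.r t < 0 ∧ σ.pos t = D.head (W j) ∧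
            σ.x (W j) + σ.r t < 0 ∧ z = -σ.r t - σ.x (W j)))
        (le_eval_iterPoly _ _ _ (by omega)) (Nat.zero_le _) ?_ ?_ ?_ ?_
      · rintro q s'' - ⟨-, h'', -⟩; exact h''.rep.eval_numV
      · exact ⟨by simpa using hj', h'.putNat (Or.inl rfl) _ _, hmin.congr (by simp)⟩
      · rintro q s'' hq hq' ⟨hj'', h'', hmin'⟩
        have e1 := h''.rep.r ⟨q, hq⟩
        have e2 := h''.rep.pos ⟨q, hq⟩
        simp only at e1 e2
        have hcond : (Test.and (.realLt (.get 0 (.var 22)) .zero)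
            (.and (.natEq (.get 9 (.var 22)) (.get 2 (.get 17 (.var 27))))
              (.realLt (.add (.get 1 (.get 17 (.var 27))) (.get 0 (.var 22))) .zero))).holds s'' ↔
            σ.r ⟨q, hq⟩ < 0 ∧ σ.pos ⟨q, hq⟩ = D.head (W j) ∧ σ.x (W j) + σ.r ⟨q, hq⟩ < 0 := by
          simp only [Test.holds_and, Test.holds_realLt, Test.holds_natEq, RExp.eval_get,
            RExp.eval_zero, RExp.eval_add, NExp.eval_var, hq', e1]
          rw [NExp.eval_get, NExp.eval_get, hW s'' hj'' h'', NExp.eval_var, hq', e2,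
            h''.rep.head, h''.rep.x, Fin.ext_iff]
        refine does_ite (fun hc' => ?_) (fun hc' => does_skip ?_)
        · obtain ⟨h1, h2, h3⟩ := hcond.1 hc'
          refine does_limit (-σ.r ⟨q, hq⟩ - σ.x (W j)) hmin' ?_ (by linarith)
            (S' := fun z => (∃ l, i ≤ l ∧ l < j ∧ σ.Limit D W F l z) ∨
              ∃ t : Fin n, (t : ℕ) < q + 1 ∧ σ.r t < 0 ∧ σ.pos t = D.head (W j) ∧
              σ.x (W j) + σ.r t < 0 ∧ z = -σ.r t - σ.x (W j)) ?_ ?_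
          · simp only [RExp.eval_sub, RExp.eval_get, RExp.eval_zero, NExp.eval_var, hq', e1]
            rw [hW s'' hj'' h'', h''.rep.x, zero_sub]
          · intro y
            constructor
            · rintro (h4 | ⟨t, h4, h5⟩)
              · exact Or.inl (Or.inl h4)
              · rcases Nat.lt_succ_iff_lt_or_eq.1 h4 with h6 | h6
                · exact Or.inl (Or.inr ⟨t, h6, h5⟩)
                · obtain rfl : t = ⟨q, hq⟩ := Fin.ext h6
                  exact Or.inr h5.2.2.2
            · rintro ((h4 | ⟨t, h4, h5⟩) | rfl)
              · exact Or.inl h4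
              · exact Or.inr ⟨t, by omega, h5⟩
              · exact Or.inr ⟨⟨q, hq⟩, Nat.lt_succ_self q, h1, h2, h3, rfl⟩
          · intro s₃ hn hr hmin₃
            exact ⟨by rw [hn]; exact hq', by simp [hn, hj''],
              (h''.congr (fun l _ _ => by rw [hn]) hr).putNat (Or.inl rfl) _ _, hmin₃⟩
        · refine ⟨hq', by simpa using hj'', h''.putNat (Or.inl rfl) _ _, hmin'.congr (fun z => ?_)⟩
          refine or_congr_right ⟨fun ⟨t, h4, h5⟩ => ⟨t, by omega, h5⟩, fun ⟨t, h4, h5⟩ => ?_⟩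
          rcases Nat.lt_succ_iff_lt_or_eq.1 h4 with h6 | h6
          · exact ⟨t, h6, h5⟩
          · obtain rfl : t = ⟨q, hq⟩ := Fin.ext h6
            exact absurd (hcond.2 ⟨h5.1, h5.2.1, h5.2.2.1⟩) hc'
      · rintro s'' - ⟨hj'', h'', hmin'⟩
        refine ⟨hj'', by omega, h''.putNat (Or.inr rfl) _ _, hmin'.congr (fun z => ?_)⟩
        constructor
        · rintro (⟨l, h1, h2, h3⟩ | ⟨t, -, h2⟩)
          · exact ⟨l, h1, by omega, h3⟩
          · exact ⟨j, hij, by omega, Or.inr ⟨hf, t, h2⟩⟩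
        · rintro ⟨l, h1, h2, h3⟩
          rcases Nat.lt_succ_iff_lt_or_eq.1 h2 with h4 | rfl
          · exact Or.inl ⟨l, h1, h4, h3⟩
          · rcases h3 with ⟨h3, -⟩ | ⟨-, t, h3⟩
            · exact absurd h3 hf
            · exact Or.inr ⟨t, t.2, h3⟩
  · rintro s' - ⟨-, h', hmin⟩
    exact hQ s' h' hmin

/-- Augment along the cycle. -/
def Prog.push : Prog :=
  .for 27 (.var 28) (.var 26)
    (.ite (.natEq (.get 18 (.var 27)) (.const 0))
      (.setReal 1 (.get 17 (.var 27)) (.sub (.get 1 (.get 17 (.var 27))) (.get 10 (.const 0))))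
      (.setReal 1 (.get 17 (.var 27)) (.add (.get 1 (.get 17 (.var 27))) (.get 10 (.const 0)))))

theorem Rep.putReal_x {e : Fin m} {c : ℝ} (h : Rep s D σ) :
    Rep (s.putReal 1 e c) D { σ with x := update σ.x e c } := by
  constructor
  · exact h.n_eq
  · exact h.m_eq
  · exact h.tail
  · exact h.head
  · simpa using h.r
  · intro a
    simp only [State.putReal_real, update_apply, Fin.ext_iff, h.x]
    simp
  · simpa using h.y
  · exact h.pos
  · exact h.base
  · exact h.len
  · exact h.trav
  · exact h.mark
  · exact h.ps_length
  · exact h.ps_source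
  · exact h.ps_sink
  · exact h.ps_arcs_length
  · exact h.ps_arcs
  · simpa using h.ps_value
  · exact h.ps_end

theorem does_push {Q : State → Prop} {k : ℕ} {W : ℕ → Fin m} {F : ℕ → Prop} {c : ℕ → Fin n}
    {i : ℕ} {ε : ℝ} (h : CycleRep s D σ k W F c i) (ht : σ.Trail D k W F c) (hik : i < k)
    (hε : s.real 10 0 = ε)
    (hQ : ∀ s' x', Rep s' D { σ with x := x' } → σ.Pushed D W F c ε i k x' → Q s') :
    Does (n + m) .push s Q := by
  have hkn := ht.le_card
  -- The memory follows the changing flow `x'`, whereas the trail and `Cfg.Pushed` remain relative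
  -- to `σ`.
  refine does_for k (fun j s' => i ≤ j ∧ s'.real 10 0 = ε ∧ ∃ x', CycleRep s' D { σ with x := x' } k W F c i ∧
    σ.Pushed D W F c ε i j x')
    (le_eval_iterPoly _ _ _ (by omega)) ?_ ?_ ?_ ?_ ?_
  · simpa [h.start] using hik.le
  · rintro j s' - ⟨-, -, x', h', -⟩; exact h'.trail.length
  · rw [NExp.eval_var, h.start]
    refine ⟨le_rfl, hε, σ.x, h.putNat (Or.inr rfl) _ _, fun v => by simp, fun l h1 h2 => ?_,
      fun l h1 h2 => ?_, fun _ _ => rfl⟩ <;> omega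
  · rintro j s' hj hj' ⟨hij, hε', x', h', hp⟩
    have hW : (NExp.get 17 (.var 27)).eval s' = W j := by simp [hj', h'.trail.arc j hj]
    have hfin : ∀ z, CycleRep (s'.putReal 1 (W j) z) D { σ with x := update x' (W j) z } k W F c i :=
      fun z => ⟨h'.rep.putReal_x, h'.trail.congr rfl rfl rfl rfl rfl, h'.start⟩
    have hx := h'.rep.x (W j)
    simp only at hx
    refine does_ite (fun hc => does_setReal ?_) (fun hc => does_setReal ?_)
    · have hf : F j := (h'.trail.dir j hj).1 (by simpa [hj'] using hc)
      rw [RExp.eval_sub, RExp.eval_get, RExp.eval_get, NExp.eval_const, hW, hε', hx]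
      exact ⟨hj', by omega, by simpa using hε', _, (hfin _).putNat (Or.inr rfl) _ _,
        hp.step ht hij hj (fun _ => rfl) (fun h => absurd hf h)⟩
    · have hf : ¬ F j := fun hf => hc (by simpa [hj'] using (h'.trail.dir j hj).2 hf)
      rw [RExp.eval_add, RExp.eval_get, RExp.eval_get, NExp.eval_const, hW, hε', hx]
      exact ⟨hj', by omega, by simpa using hε', _, (hfin _).putNat (Or.inr rfl) _ _,
        hp.step ht hij hj (fun h => absurd h hf) (fun _ => rfl)⟩
  · rintro s' - ⟨-, -, x', h', hp⟩
    exact hQ s' x' h'.rep hp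

/-- Find a cycle, starting from the arc `var 21`, and augment along it. -/
def Prog.augment : Prog :=
  .seq .walk (.seq (.assign 28 (.sub (.get 16 (.var 23)) (.const 1))) (.seq .amount .push))

theorem does_augment (hρ : D.IsRank ρ) {Q : State → Prop} (h : Rep s D σ) (hI : σ.Inv D b x₀ Δ)
    (hΔ : 0 < Δ) (hq : ∀ e t, ¬ σ.SinkMovable D e t)
    (hleaf : ∀ e v, σ.Present e → D.Inc e v → ¬ σ.Leaf D v)
    {e₀ : Fin m} (he : s.nat 21 0 = e₀) (hp : σ.Present e₀)
    (hQ : ∀ s' (σ' : Cfg n m), Rep s' D σ' → σ'.Inv D b x₀ Δ → σ'.measure D < σ.measure D → Q s') :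
    Does (n + m) .augment s Q := by
  refine does_seq (does_walk hρ h hI hq hleaf he hp ?_)
  intro s₁ M k W F c i h₁ hI₁ hq₁ ht₁ hr₁ hik hci hseen
  refine does_seq (does_assign ?_)
  have hcyc : CycleRep (s₁.putNat 28 0 ((NExp.sub (.get 16 (.var 23)) (.const 1)).eval s₁)) D
      { σ with mark := M } k W F c i := by
    refine ⟨h₁.putNat (by norm_num) _ _, hr₁.congr ?_ ?_ ?_ ?_ ?_, by simp [hseen]⟩
    all_goals exact State.putNat_nat_of_ne _ (by norm_num) _ _
  refine does_seq (does_amount hcyc ht₁ hik ?_)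
  intro s₂ h₂ hmin
  refine does_push h₂ ht₁ hik rfl ?_
  intro s₃ x' h₃ hpush
  -- A forward arc contributes a limit, so the minimum is not the value `0` of the empty set.
  obtain ⟨j, hj1, hj2, hj3⟩ := ht₁.exists_forward hρ hik hci
  rcases hmin with ⟨-, hno⟩ | ⟨hpos, hmem, hmin⟩
  · exact absurd ⟨j, hj1, hj2, Or.inl ⟨hj3, rfl⟩⟩ (hno _)
  · obtain ⟨h4, h5⟩ := hpush.augment hI₁ hΔ hq₁ (fun e he => hleaf e _ he (Or.inl rfl)) ht₁ hci hpos
      hmem (fun j z h1 h2 h3 => hmin z ⟨j, h1, h2, h3⟩)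
    exact hQ s₃ _ h₃ h4 h5

end UT


namespace UT

open Function

variable {n m : ℕ} {s : State} {D : MultiDigraph (Fin n) (Fin m)} {σ : Cfg n m}
  {b : Fin n → ℝ} {x₀ : Fin m → ℝ} {Δ : ℝ} {ρ : Fin n → ℕ}

/-! ## The main program -/

/-- One iteration: execute the first step that is possible and set `var 20` to `1`, or set
`var 20` to `0` if no step is possible. -/
def Prog.iteration : Prog :=
  .seq (.search₂ 21 22 .numA .numV .sinkMovable)
  (.ite (.natLt (.var 21) .numA) (.seq .moveSink (.assign 20 (.const 1)))
  (.seq .leaves (.seq (.search₂ 21 22 .numV .numV .servable)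
  (.ite (.natLt (.var 21) .numV) (.seq .minSink (.seq .serve (.assign 20 (.const 1))))
  (.seq (.search₂ 21 22 .numA .numV .sourceMovable)
  (.ite (.natLt (.var 21) .numA) (.seq .moveSource (.assign 20 (.const 1)))
  (.seq (.search 21 .numA (.present (.var 21)))
  (.ite (.natLt (.var 21) .numA) (.seq .augment (.assign 20 (.const 1)))
    (.assign 20 (.const 0))))))))))

/-- The order of the tests matters: moving a source uses that nothing is servable, and augmenting
uses that all three kinds of moves are impossible. -/
theorem does_iteration (hρ : D.IsRank ρ) (hn : ∀ v, ρ v < n) {Q : State → Prop} (h : Rep s D σ)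
    (hI : σ.Inv D b x₀ Δ) (hΔ : 0 < Δ)
    (hstep : ∀ s' (σ' : Cfg n m), Rep s' D σ' → σ'.Inv D b x₀ Δ → σ'.measure D < σ.measure D →
      s'.nat 20 0 = 1 → Q s')
    (hdone : ∀ s', Rep s' D σ → (∀ u t, ¬ σ.Servable D u t) → (∀ a, ¬ σ.Present a) →
      s'.nat 20 0 = 0 → Q s') :
    Does (n + m) .iteration s Q := by
  have hlen := Cfg.Inv.length_trav_lt hρ hn hI.path
  have hfin : ∀ s' (σ' : Cfg n m), Rep s' D σ' → σ'.Inv D b x₀ Δ → σ'.measure D < σ.measure D →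
      Does (n + m) (.assign 20 (.const 1)) s' Q := fun s' σ' h1 h2 h3 =>
    does_assign (hstep _ σ' (h1.putNat (by norm_num) _ _) h2 h3 (by simp))
  have hltA : ∀ (s' : State) (e : Fin m), Rep s' D σ → s'.nat 21 0 = e →
      (Test.natLt (.var 21) .numA).holds s' := fun s' e h1 h2 => by
    rw [Test.holds_natLt, h1.eval_numA, NExp.eval_var, h2]; exact e.2
  have hltV : ∀ (s' : State) (e : Fin n), Rep s' D σ → s'.nat 21 0 = e →
      (Test.natLt (.var 21) .numV).holds s' := fun s' e h1 h2 => by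
    rw [Test.holds_natLt, h1.eval_numV, NExp.eval_var, h2]; exact e.2
  have hgeA : ∀ s' : State, Rep s' D σ → s'.nat 21 0 = m →
      ¬ (Test.natLt (.var 21) .numA).holds s' := fun s' h1 h2 => by
    rw [Test.holds_natLt, h1.eval_numA, NExp.eval_var, h2]; exact lt_irrefl _
  have hgeV : ∀ s' : State, Rep s' D σ → s'.nat 21 0 = n →
      ¬ (Test.natLt (.var 21) .numV).holds s' := fun s' h1 h2 => by
    rw [Test.holds_natLt, h1.eval_numV, NExp.eval_var, h2]; exact lt_irrefl _
  refine does_seq (does_searchSink h (fun e t hm => ?_) (fun hq q => ?_))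
  · have h₁ := h.putNat₂ (i := 21) (j := 22) (by norm_num) (by norm_num) e t
    refine does_ite (fun _ => ?_) (fun hc => absurd (hltA _ e h₁ (by simp)) hc)
    exact does_seq (does_moveSink h₁ (by simp) (by simp) hlen
      (fun s' h' => hfin s' _ h' (hI.moveSink hρ hm) (Cfg.measure_moveSink hρ hn hI hm)))
  have h₁ := h.putNat₂ (i := 21) (j := 22) (by norm_num) (by norm_num) m q
  refine does_ite (fun hc => absurd hc (hgeA _ h₁ (by simp))) (fun _ => ?_)
  refine does_seq (does_leaves h₁ (fun s₂ h₂ hl₂ => ?_))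
  refine does_seq (does_searchServable h₂ hl₂ (fun u t hm => ?_) (fun hserve q => ?_))
  · have h₃ := h₂.putNat₂ (i := 21) (j := 22) (by norm_num) (by norm_num) u t
    refine does_ite (fun _ => ?_) (fun hc => absurd (hltV _ u h₃ (by simp)) hc)
    refine does_seq (does_minSink h₃ (u := u) (t := t) (by simp) (by simp) hm.2.1 ?_)
    intro s₄ t' h₄ hu ht' hr hpos hmin
    have hm' : σ.Servable D u t' := ⟨hm.1, hr, hm.2.2.1.trans hpos.symm, by
      rw [hpos]; exact hm.2.2.2⟩
    have hut : u ≠ t' := by rintro rfl; linarith [hm'.1, hm'.2.1]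
    exact does_seq (does_serve h₄ hu ht' hut hlen (fun s' c h1 h2 h3 h' =>
      hfin s' _ h' (hI.serve hρ hΔ hm' hmin h1 h2 h3) (Cfg.measure_serve hm' h3)))
  have h₃ := h₂.putNat₂ (i := 21) (j := 22) (by norm_num) (by norm_num) n q
  refine does_ite (fun hc => absurd hc (hgeV _ h₃ (by simp))) (fun _ => ?_)
  refine does_seq (does_searchSource h₃ (fun v => by simpa using hl₂ v) (fun e u hm => ?_)
    (fun hsrc q' => ?_))
  · have h₄ := h₃.putNat₂ (i := 21) (j := 22) (by norm_num) (by norm_num) e u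
    refine does_ite (fun _ => ?_) (fun hc => absurd (hltA _ e h₄ (by simp)) hc)
    have hI' := hI.moveSource hρ hΔ hm hserve
    exact does_seq (does_moveSource h₄ (by simp) (by simp) hlen
      (fun s' h' => hfin s' _ h' hI' (Cfg.measure_moveSource hρ hn hI'.path hm.2.2.1)))
  have h₄ := h₃.putNat₂ (i := 21) (j := 22) (by norm_num) (by norm_num) m q'
  refine does_ite (fun hc => absurd hc (hgeA _ h₄ (by simp))) (fun _ => ?_)
  have hr := fun p => h₄.putNat (i := 21) (by norm_num) 0 p
  refine does_seq (does_search m (le_eval_iterPoly _ _ _ (by omega)) (fun p => (hr p).eval_numA)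
    (fun p hp hc => ?_) (fun hno => ?_))
  · have hpr : σ.Present ⟨p, hp⟩ := ((hr p).holds_present (a := ⟨p, hp⟩) (by simp)).1 hc
    refine does_ite (fun _ => ?_) (fun hc => absurd (hltA _ ⟨p, hp⟩ (hr p) (by simp)) hc)
    refine does_seq (does_augment hρ (hr p) hI hΔ hq ?_ (e₀ := ⟨p, hp⟩) (by simp) hpr
      (fun s' σ' h' hI' hm' => hfin s' σ' h' hI' hm'))
    rintro e v he (rfl | rfl)
    · exact hI.not_leaf_tail hρ hsrc he
    · exact hI.not_leaf_head hρ hq hserve he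
  · refine does_ite (fun hc => absurd hc (hgeA _ (hr m) (by simp))) (fun _ => does_assign ?_)
    refine hdone _ ((hr m).putNat (by norm_num) _ _) hserve (fun a ha => ?_) (by simp)
    exact hno a a.2 (((hr a).holds_present (a := a) (by simp)).2 ha)

/-- Initialize the positions of the terminals and the places where their paths are stored. -/
def Prog.init : Prog :=
  .for 21 (.const 0) .numV
    (.seq (.setNat 9 (.var 21) (.var 21))
      (.setNat 10 (.add (.var 21) (.const 1)) (.add (.get 10 (.var 21)) .numV)))

theorem does_init {x : Fin m → ℝ} {Q : State → Prop}
    (hQ : ∀ s', Rep s' D (Cfg.init b x) → Q s') :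
    Does (n + m) .init (inputState D b x) Q := by
  -- In the absence of multiplication, the block starts `v * n` are obtained by repeated addition.
  -- Round `j` writes entry `j + 1`, hence `v ≤ j` in the last clause.
  refine does_for n (fun j s' => s'.real = (inputState D b x).real ∧
    (∀ i, i ≠ 9 → i ≠ 10 → i ≠ 21 → s'.nat i = (inputState D b x).nat i) ∧
    (∀ v, v < j → s'.nat 9 v = v) ∧ ∀ v, v ≤ j → s'.nat 10 v = v * n)
    (le_eval_iterPoly _ _ _ (by omega)) (Nat.zero_le _) ?_ ?_ ?_ ?_
  · rintro j s' - ⟨-, h, -⟩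
    simp [NExp.numV, h, inputState]
  · refine ⟨rfl, fun i _ _ hi => State.putNat_nat_of_ne _ hi _ _, by simp, fun v hv => ?_⟩
    obtain rfl : v = 0 := by simpa using hv
    simp [inputState]
  · rintro j s' hj hj' ⟨h1, h2, h3, h4⟩
    refine does_seq (does_setNat (does_setNat ?_))
    simp only [NExp.numV, NExp.eval_add, NExp.eval_var, NExp.eval_get, NExp.eval_const,
      State.putNat_nat, Nat.reduceEqDiff, false_and, if_false, OfNat.zero_ne_ofNat, hj',
      h4 j le_rfl, h2 0 (by norm_num) (by norm_num) (by norm_num)]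
    refine ⟨by simp, h1, fun i hi hi' hi'' => ?_, fun v hv => ?_, fun v hv => ?_⟩
    · rw [State.putNat_nat_of_ne _ hi'', State.putNat_nat_of_ne _ hi', State.putNat_nat_of_ne _ hi,
        h2 i hi hi' hi'']
    · rcases Nat.lt_succ_iff_lt_or_eq.1 hv with hv' | rfl
      · simp [hv'.ne, h3 v hv']
      · simp
    · rcases Nat.lt_succ_iff_lt_or_eq.1 (Nat.lt_succ_iff.2 hv) with hv' | rfl
      · simp [hv'.ne, h4 v (by omega)]
      · simp [inputState, Nat.succ_mul]
  · rintro s' - ⟨h1, h2, h3, h4⟩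
    refine hQ s' ?_
    have h2' : ∀ i, i < 9 ∨ (10 < i ∧ i < 15) → s'.nat i = (inputState D b x).nat i := fun i hi =>
      h2 i (by omega) (by omega) (by omega)
    constructor
    · rw [h2' 0 (by norm_num)]; simp [inputState]
    · rw [h2' 0 (by norm_num)]; simp [inputState]
    · intro a; rw [h2' 1 (by norm_num)]; simp [inputState]
    · intro a; rw [h2' 2 (by norm_num)]; simp [inputState]
    · intro v; rw [h1]; simp [inputState, Cfg.init]
    · intro v; rw [h1]; simp [inputState, Cfg.init]
    · intro v; rw [h1]; simp [inputState, Cfg.init]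
    · intro v; exact h3 v v.2
    · intro v; exact h4 v v.2.le
    · intro v; rw [h2' 11 (by norm_num)]; simp [inputState, Cfg.init]
    · intro v j hj; simp [Cfg.init] at hj
    · intro a; rw [h2' 13 (by norm_num)]; simp [inputState, Cfg.init]
    · rw [h2' 3 (by norm_num)]; simp [inputState, Cfg.init]
    all_goals intro k hk; simp [Cfg.init] at hk

/-- The algorithm. -/
def Prog.unsplit : Prog :=
  .seq .init (.seq (.assign 20 (.const 1)) (.loop (.natEq (.var 20) (.const 1)) .iteration))

theorem does_unsplit (hρ : D.IsRank ρ) (hn : ∀ v, ρ v < n) {x : Fin m → ℝ}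
    (hx : D.IsTransshipment b x) (hΔ : 0 < Δ) (hd : ∀ t, -b t ≤ Δ) :
    Does (n + m) .unsplit (inputState D b x) (fun s' => ∃ σ : Cfg n m, Rep s' D σ ∧
      σ.Inv D b x Δ ∧ (∀ u t, ¬ σ.Servable D u t) ∧ ∀ a, ¬ σ.Present a) := by
  refine does_seq (does_init (fun s₁ h₁ => does_seq (does_assign ?_)))
  -- The summand `1` pays for the final round, which only clears the flag.
  refine does_loop (fun K s' => ∃ σ : Cfg n m, Rep s' D σ ∧ σ.Inv D b x Δ ∧
    ((s'.nat 20 0 = 1 ∧ K = σ.measure D + 1) ∨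
      (s'.nat 20 0 = 0 ∧ K = 0 ∧ (∀ u t, ¬ σ.Servable D u t) ∧ ∀ a, ¬ σ.Present a)))
    (k := (Cfg.init b x).measure D + 1) (le_eval_iterPoly _ _ _ ?_)
    ⟨_, h₁.putNat (by norm_num) _ _, Cfg.inv_init hx hΔ hd, Or.inl ⟨by simp, rfl⟩⟩ ?_ ?_
  · have := (Cfg.init b x).measure_le (D := D)
    omega
  · rintro K s' ⟨σ, h, hI, hcase⟩ hc
    have hc' : s'.nat 20 0 = 1 := hc
    rcases hcase with ⟨-, rfl⟩ | ⟨h0, -⟩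
    · refine does_iteration hρ hn h hI hΔ ?_ ?_
      · intro s₂ σ' h' hI' hm hflag
        exact ⟨_, by omega, σ', h', hI', Or.inl ⟨hflag, rfl⟩⟩
      · intro s₂ h' hserve habs hflag
        exact ⟨0, by omega, σ, h', hI, Or.inr ⟨hflag, rfl, hserve, habs⟩⟩
    · omega
  · rintro K s' ⟨σ, h, hI, hcase⟩ hc
    rcases hcase with ⟨h1, -⟩ | ⟨-, -, hserve, habs⟩
    · exact absurd h1 hc
    · exact ⟨σ, h, hI, hserve, habs⟩

theorem Rep.isOutput (h : Rep s D σ) : IsOutput s σ.y σ.ps :=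
  ⟨h.y, h.ps_length, h.ps_source, h.ps_sink, h.ps_arcs_length, h.ps_arcs, h.ps_value⟩

/-- A positive bound for all demands, which is the maximum demand if there is a sink. -/
theorem exists_demand_bound (b : Fin n → ℝ) :
    ∃ Δ : ℝ, 0 < Δ ∧ (∀ t, -b t ≤ Δ) ∧ ∀ h : (sinks b).Nonempty, Δ = dmax b h := by
  by_cases h : (sinks b).Nonempty
  · have hle : ∀ t, b t < 0 → -b t ≤ dmax b h := fun t ht => by
      rw [← abs_of_neg ht]
      exact Finset.le_sup' (fun t => |b t|) (by simpa [sinks] using ht)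
    have hpos : 0 < dmax b h := by
      obtain ⟨t, ht⟩ := h
      have ht' : b t < 0 := by simpa [sinks] using ht
      linarith [hle t ht']
    refine ⟨dmax b h, hpos, fun t => ?_, fun _ => rfl⟩
    by_cases ht : b t < 0
    · exact hle t ht
    · linarith [not_lt.1 ht]
  -- Without sinks any positive number will do.
  · refine ⟨1, one_pos, fun t => ?_, fun h' => absurd h' h⟩
    by_contra hlt
    exact h ⟨t, by simp only [sinks, Finset.mem_filter, Finset.mem_univ, true_and]; linarith⟩

end UT

/-- There is a program (one for all instances) that turns every transshipment `x` in an acyclic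
digraph with `n` vertices and `m` arcs, within a number of steps that is polynomial in `n + m`,
into an unsplittable transshipment `y` with `y a < x a + dmax` on every arc `a`. -/
theorem mainTheorem1 :
    ∃ (P : UT.Prog) (q : Polynomial ℕ),
      ∀ (n m : ℕ) (D : UT.MultiDigraph (Fin n) (Fin m)) (b : Fin n → ℝ) (x : Fin m → ℝ),
        D.Acyclic → D.IsTransshipment b x →
        ∃ (T : ℕ) (s : UT.State) (y : Fin m → ℝ) (ps : List (UT.FlowPath (Fin n) (Fin m))),
          UT.Exec P (UT.inputState D b x) T s ∧
          T ≤ q.eval (n + m) ∧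
          UT.IsOutput s y ps ∧
          D.IsUnsplittable b y ps ∧
          ∀ (h : (UT.sinks b).Nonempty) (a : Fin m), y a < x a + UT.dmax b h := by
  refine ⟨.unsplit, UT.Prog.unsplit.timePoly, fun n m D b x hD hx => ?_⟩
  -- The rank serves the analysis only; the program does not compute it.
  obtain ⟨ρ, hρ, hn⟩ := hD.exists_rank
  obtain ⟨Δ, hΔ, hd, hmax⟩ := UT.exists_demand_bound b
  obtain ⟨T, s, hexec, hT, σ, hrep, hI, hserve, habs⟩ :=
    UT.does_unsplit hρ (by simpa using hn) hx hΔ hd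
  refine ⟨T, s, σ.y, σ.ps, hexec, hT, hrep.isOutput, hI.isUnsplittable hρ hserve habs,
    fun h a => ?_⟩
  rw [← hmax h]
  -- At the end no arc carries unrouted flow, so the bound for absent arcs applies to every arc.
  exact hI.marks.load_absent a (habs a)
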